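/- **Notation.** Let $m,N\ge 1$ be integers and $\kappa\in\mathbb C$. Write $E_{ab}$ for the matrix units, $I=E_{11}+\dots+E_{mm}$, $\sigma_{pq}\in S_N$ for the transposition of $p$ and $q$, and $\sigma_p=\sigma_{p,p+1}$. *The affine Lie algebra.* $\widehat{\mathfrak{sl}}_m=\mathfrak{sl}_m[t,t^{-1}]\oplus\mathbb C\,C$, where $C$ is central and $[Xt^i,Yt^j]=[X,Y]\,t^{i+j}+i\,\delta_{i,-j}\operatorname{tr}(XY)\,C$. It is the direct sum of the subalgebras $\mathfrak p=\mathfrak{sl}_m[t]\oplus\mathbb C\,C$ and $\mathfrak q=t^{-1}\mathfrak{sl}_m[t^{-1}]$, and $\mathfrak{sl}_m\subset\mathfrak p$ as the constant currents. *The algebras.* The degenerate affine Hecke algebra $H_N$ is the complex associative algebra generated by $\mathbb C S_N$ and pairwise commuting elements $u_1,\dots,u_N$, subject to $\sigma_pu_q=u_q\sigma_p$ for $q\ne p,p+1$ and $\sigma_pu_p=u_{p+1}\sigma_p-1$. Put $z_p=u_p-\sum_{r<p}\sigma_{rp}$. The trigonometric Cherednik algebra $T_N$ (with parameter $\kappa$)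 is generated by $\mathbb C[x_1^{\pm1},\dots,x_N^{\pm1}]$ and $H_N$, subject to $\sigma x_p\sigma^{-1}=x_{\sigma(p)}$ for $\sigma\in S_N$, to $[z_p,x_q]=-x_p\sigma_{pq}$ for $q\ne p$, and to $[z_p,x_p]=\kappa x_p+\sum_{r\ne p}x_p\sigma_{pr}$. *The functor $F_N$.* For an $\mathfrak{sl}_m$-module $U$ let $F_N(U)=(\mathbb C^m)^{\otimes N}\otimes U$, a tensor product of $\mathfrak{sl}_m$-modules. Let $E_{ab}^{(p)}$ denote $E_{ab}$ acting in the $p$-th tensor factor $\mathbb C^m$. The group $S_N$ acts on $F_N(U)$ by permutations of these factors, and $z_p$ acts as $$\sum_{a,b=1}^m E_{ab}^{(p)}\otimes E_{ba}-\tfrac1m\,\mathrm{id}\otimes I,\quad\text{by which is meant}\quad \sum_{a,b=1}^m E_{ab}^{(p)}\otimes\bigl(E_{ba}-\tfrac{\delta_{ab}}m I\bigr).$$ *The functor $A_N$.* Let $V$ be an $\widehat{\mathfrak{sl}}_m$-module such that for every $v\in V$ there is an $i$ with $t^i\mathfrak{sl}_m[t]\,v=0$. Let $$A_N(V)=\mathbb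 C[x_1^{\pm1},\dots,x_N^{\pm1}]\otimes(\mathbb C^m)^{\otimes N}\otimes V,$$ where $Xt^j$ acts as $\sum_{q}x_q^{\,j}\otimes X^{(q)}\otimes\mathrm{id}+\mathrm{id}\otimes\mathrm{id}\otimes Xt^j$ and $C$ acts through $V$. Let $x_p^{\pm1}$ act on $A_N(V)$ by multiplication, let $S_N$ act by simultaneous permutations of the variables and of the factors $\mathbb C^m$, and let $z_p$ act as $$\kappa\,x_p\partial_p\otimes\mathrm{id}\otimes\mathrm{id}+\sum_{r\ne p}\frac{x_p}{x_p-x_r}(1-\sigma_{pr})\otimes\sigma_{pr}\otimes\mathrm{id}+\sum_{i\ge0}\ \sum_{a,b=1}^m x_p^{-i}\otimes E_{ab}^{(p)}\otimes\bigl(E_{ba}-\tfrac{\delta_{ab}}mI\bigr)t^i .$$ **Theorem.** Let $U$ be any $\mathfrak{sl}_m$-module, and let $V$ be the $\widehat{\mathfrak{sl}}_m$-module of level $\ell=\kappa-m$ parabolically induced from $U$. That is, $V$ is induced from the $\mathfrak p$-module $U$ on which $\mathfrak{sl}_m$ acts in the given way, $t\,\mathfrak{sl}_m[t]$ acts as zero,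 and $C$ acts as the scalar $\ell$. Then: 1. for every $v\in V$ there is an $i$ with $t^i\mathfrak{sl}_m[t]\,v=0$, so that $A_N(V)$ and the above operators on it are defined; 2. the above formulas define an action of $H_N$ on $F_N(U)$ commuting with $\mathfrak{sl}_m$, so that $F_N(U)$ is a bimodule over $\mathfrak{sl}_m$ and $H_N$; 3. the above formulas define an action of $T_N$ on $A_N(V)$. This action descends to the space of coinvariants $A_N(V)_{\mathfrak q}=A_N(V)/\mathfrak q A_N(V)$ and commutes there with the action of $\mathfrak{sl}_m$, so that $A_N(V)_{\mathfrak q}$ is a bimodule over $\mathfrak{sl}_m$ and $T_N$; 4. this bimodule is isomorphic to the induced bimodule $$\operatorname{Ind}_{H_N}^{T_N}F_N(U)=T_N\otimes_{H_N}F_N(U),$$ on which $T_N$ acts by left multiplication and $\mathfrak{sl}_m$ acts through $F_N(U)$. -/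

import Mathlib

open scoped TensorProduct

noncomputable section

namespace AST

attribute [local instance 100] LieRing.ofAssociativeRing

/-! ### The Lie algebra `sl_m`, and the affine Lie algebra -/

/-- The complex special linear Lie algebra `sl_m`. -/
abbrev sl (m : ℕ) : Type := ↥(LieAlgebra.SpecialLinear.sl (Fin m) ℂ)

theorem sl_trace {m : ℕ} (X : sl m) : Matrix.trace (X : Matrix (Fin m) (Fin m) ℂ) = 0 := by
  have h := X.2
  simpa [LieAlgebra.SpecialLinear.sl] using h

/-- The traceless part `E_ab - (δ_ab / m) I` of the matrix unit `E_ab`. -/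
def slE {m : ℕ} (a b : Fin m) : sl m :=
  ⟨Matrix.single a b (1 : ℂ) - (if a = b then (1 / (m : ℂ)) else 0) • (1 : Matrix (Fin m) (Fin m) ℂ),
    by
      have hm : (m : ℂ) ≠ 0 := by
        have := a.pos
        exact_mod_cast this.ne'
      change Matrix.trace (_ : Matrix (Fin m) (Fin m) ℂ) = 0
      by_cases h : a = b
      · subst h
        simp [Matrix.trace_sub, Matrix.trace_smul, Matrix.trace_one, hm]
      · simp [h]⟩

/-- The bilinear form `(X, Y) ↦ - tr (X Y)` on `sl_m`. -/
def negTraceForm (m : ℕ) : LinearMap.BilinForm ℂ (sl m) :=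
  LinearMap.mk₂ ℂ (fun X Y => - Matrix.trace (X.1 * Y.1))
    (by intro X X' Y; simp [add_mul]; ring) (by intro c X Y; simp)
    (by intro X Y Y'; simp [mul_add]; ring) (by intro c X Y; simp)

theorem negTraceForm_symm (m : ℕ) : (negTraceForm m).IsSymm :=
  ⟨fun X Y => congrArg Neg.neg (Matrix.trace_mul_comm X.1 Y.1)⟩

theorem negTraceForm_invariant (m : ℕ) : (negTraceForm m).lieInvariant (sl m) := by
  intro X Y Z
  have h : ∀ A B : sl m, (⁅A, B⁆ : sl m).1 = A.1 * B.1 - B.1 * A.1 :=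
    fun A B => rfl
  simp only [negTraceForm, LinearMap.mk₂_apply, h, sub_mul, mul_sub, Matrix.trace_sub]
  rw [← Matrix.mul_assoc Y.1 Z.1 X.1, Matrix.trace_mul_comm (Y.1 * Z.1) X.1, Matrix.mul_assoc,
    Matrix.mul_assoc]
  ring

/-- The loop algebra `sl_m[t, t⁻¹]`. -/
abbrev Loop (m : ℕ) : Type := LieAlgebra.loopAlgebra ℂ ℤ (sl m)

/-- The 2-cocycle `(X t^i, Y t^j) ↦ i δ_{i,-j} tr (X Y)` of the loop algebra. -/
abbrev affineCocycle (m : ℕ) := LieAlgebra.LoopAlgebra.twoCocycleOfBilinear ℂ ℤ (sl m)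
  (negTraceForm m) (negTraceForm_invariant m) (negTraceForm_symm m)

/-- The affine Lie algebra `ŝl_m`: the central extension of `sl_m[t, t⁻¹]` by `ℂ C` with
`[X t^i, Y t^j] = [X, Y] t^(i+j) + i δ_{i,-j} tr (X Y) C`, see `current_lie_current`. -/
def Affine (m : ℕ) : Type := LieAlgebra.ofTwoCocycle (affineCocycle m)

instance (m : ℕ) : LieRing (Affine m) := inferInstanceAs (LieRing (LieAlgebra.ofTwoCocycle (affineCocycle m)))

instance (m : ℕ) : LieAlgebra ℂ (Affine m) :=
  inferInstanceAs (LieAlgebra ℂ (LieAlgebra.ofTwoCocycle (affineCocycle m)))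

/-- The element `X t^i` of `ŝl_m`. -/
def current {m : ℕ} (i : ℤ) : sl m →ₗ[ℂ] Affine m where
  toFun X := LieAlgebra.ofProd _ (AddMonoidAlgebra.single i (1 : ℂ) ⊗ₜ[ℂ] X, 0)
  map_add' X Y := congrArg (LieAlgebra.ofProd (affineCocycle m))
    (Prod.ext (TensorProduct.tmul_add _ X Y) (add_zero _).symm)
  map_smul' c X := congrArg (LieAlgebra.ofProd (affineCocycle m))
    (Prod.ext (TensorProduct.tmul_smul c _ X) (smul_zero c).symm)

/-- The central element `C` of `ŝl_m`. -/
def central (m : ℕ) : Affine m :=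
  LieAlgebra.ofProd _ (0, (TrivialLieModule.equiv ℂ (Loop m) ℂ).symm 1)

/-- The loop part of an element of `ŝl_m`. -/
def loopPart (m : ℕ) : Affine m →ₗ⁅ℂ⁆ Loop m where
  toFun ξ := ((LieAlgebra.ofProd _).symm ξ).1
  map_add' _ _ := rfl
  map_smul' _ _ := rfl
  map_lie' := rfl

theorem current_lie_current {m : ℕ} (i j : ℤ) (X Y : sl m) :
    ⁅current i X, current j Y⁆ = current (i + j) ⁅X, Y⁆ +
      (if i = -j then (i : ℂ) * Matrix.trace (X.1 * Y.1) else 0) •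
        central m := by
  have h : (affineCocycle m).1.1
        (AddMonoidAlgebra.single i (1 : ℂ) ⊗ₜ[ℂ] X) (AddMonoidAlgebra.single j (1 : ℂ) ⊗ₜ[ℂ] Y) =
      (if i = -j then (i : ℂ) * Matrix.trace (X.1 * Y.1) else 0) •
        (TrivialLieModule.equiv ℂ (Loop m) ℂ).symm 1 := by
    rw [← map_smul]
    refine congrArg (TrivialLieModule.equiv ℂ (Loop m) ℂ).symm ?_
    rw [LieAlgebra.LoopAlgebra.residuePairing_apply_apply,
      LieAlgebra.LoopAlgebra.toFinsupp_single_tmul, LieAlgebra.LoopAlgebra.toFinsupp_single_tmul,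
      Finsupp.sum_single_index (by simp)]
    by_cases hij : i = -j
    · subst hij
      simp [negTraceForm]
    · simp [Finsupp.single_eq_of_ne (Ne.symm hij), hij]
  refine congrArg (LieAlgebra.ofProd (affineCocycle m)) (Prod.ext ?_ ?_)
  · change ⁅AddMonoidAlgebra.single i (1 : ℂ) ⊗ₜ[ℂ] X, AddMonoidAlgebra.single j (1 : ℂ) ⊗ₜ[ℂ] Y⁆ =
      AddMonoidAlgebra.single (i + j) (1 : ℂ) ⊗ₜ[ℂ] ⁅X, Y⁆ + _ • (0 : Loop m)
    rw [LieAlgebra.ExtendScalars.bracket_tmul]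
    rw [AddMonoidAlgebra.single_mul_single, mul_one, smul_zero, add_zero]
  · change (affineCocycle m).1.1 (AddMonoidAlgebra.single i (1 : ℂ) ⊗ₜ[ℂ] X)
      (AddMonoidAlgebra.single j (1 : ℂ) ⊗ₜ[ℂ] Y) + ⁅_, (0 : TrivialLieModule ℂ (Loop m) ℂ)⁆ -
      ⁅_, (0 : TrivialLieModule ℂ (Loop m) ℂ)⁆ = 0 + _ • _
    rw [h, lie_zero, lie_zero, add_zero, sub_zero, zero_add]
    rfl

theorem central_lie {m : ℕ} (ξ : Affine m) : ⁅central m, ξ⁆ = 0 := by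
  refine congrArg (LieAlgebra.ofProd (affineCocycle m)) (Prod.ext ?_ ?_)
  · exact zero_lie _
  · change (affineCocycle m).1.1 0 _ + ⁅(0 : Loop m), _⁆ - ⁅_, _⁆ = 0
    rw [map_zero, LinearMap.zero_apply, zero_lie, zero_add, sub_eq_zero]
    exact (trivial_lie_zero (Loop m) (TrivialLieModule ℂ (Loop m) ℂ) _ _).symm

theorem lie_central {m : ℕ} (ξ : Affine m) : ⁅ξ, central m⁆ = 0 := by
  rw [← lie_skew, central_lie, neg_zero]

/-- The coefficient at `t^0` of an element of `ŝl_m`. -/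
def coeffZero (m : ℕ) : Affine m →ₗ[ℂ] sl m :=
  Finsupp.lapply 0 ∘ₗ (LieAlgebra.LoopAlgebra.toFinsupp ℂ ℤ (sl m)).toLinearMap ∘ₗ
    (loopPart m : Affine m →ₗ[ℂ] Loop m)

/-- The coefficient at `C` of an element of `ŝl_m`. -/
def coeffCentral (m : ℕ) : Affine m →ₗ[ℂ] ℂ where
  toFun ξ := TrivialLieModule.equiv ℂ (Loop m) ℂ ((LieAlgebra.ofProd (affineCocycle m)).symm ξ).2
  map_add' _ _ := rfl
  map_smul' _ _ := rfl

theorem coeffZero_current {m : ℕ} (i : ℤ) (X : sl m) :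
    coeffZero m (current i X) = if i = 0 then X else 0 := by
  change LieAlgebra.LoopAlgebra.toFinsupp ℂ ℤ (sl m) (AddMonoidAlgebra.single i 1 ⊗ₜ[ℂ] X) 0 = _
  rw [LieAlgebra.LoopAlgebra.toFinsupp_single_tmul, Finsupp.single_apply]

theorem coeffZero_central (m : ℕ) : coeffZero m (central m) = 0 := by
  change LieAlgebra.LoopAlgebra.toFinsupp ℂ ℤ (sl m) 0 0 = _
  simp

theorem coeffCentral_current {m : ℕ} (i : ℤ) (X : sl m) : coeffCentral m (current i X) = 0 := rfl

theorem coeffCentral_central (m : ℕ) : coeffCentral m (central m) = 1 := rfl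

theorem lie_mem_span {m : ℕ} {S : Set (Affine m)}
    (hS : ∀ x ∈ S, ∀ y ∈ S, ⁅x, y⁆ ∈ Submodule.span ℂ S) {x y : Affine m}
    (hx : x ∈ Submodule.span ℂ S) (hy : y ∈ Submodule.span ℂ S) :
    ⁅x, y⁆ ∈ Submodule.span ℂ S := by
  induction hx, hy using Submodule.span_induction₂ with
  | mem_mem x y hx hy => exact hS x hx y hy
  | zero_left y _ => rw [zero_lie]; exact zero_mem _
  | zero_right x _ => rw [lie_zero]; exact zero_mem _
  | add_left x y z _ _ _ h1 h2 => rw [add_lie]; exact add_mem h1 h2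
  | add_right x y z _ _ _ h1 h2 => rw [lie_add]; exact add_mem h1 h2
  | smul_left r x y _ _ h => rw [smul_lie]; exact Submodule.smul_mem _ _ h
  | smul_right r x y _ _ h => rw [lie_smul]; exact Submodule.smul_mem _ _ h

/-- The subalgebra `𝔭 = sl_m[t] ⊕ ℂ C` of `ŝl_m`. -/
def pSub (m : ℕ) : LieSubalgebra ℂ (Affine m) where
  toSubmodule := Submodule.span ℂ {ξ | (∃ (i : ℤ) (X : sl m), 0 ≤ i ∧ ξ = current i X) ∨ ξ = central m}
  lie_mem' := by
    refine lie_mem_span ?_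
    rintro _ (⟨i, X, hi, rfl⟩ | rfl) y hy
    · rcases hy with ⟨j, Y, hj, rfl⟩ | rfl
      · rw [current_lie_current]
        exact add_mem (Submodule.subset_span (Or.inl ⟨i + j, _, by omega, rfl⟩))
          (Submodule.smul_mem _ _ (Submodule.subset_span (Or.inr rfl)))
      · rw [lie_central]; exact zero_mem _
    · rw [central_lie]; exact zero_mem _

/-- The subalgebra `𝔮 = t⁻¹ sl_m[t⁻¹]` of `ŝl_m`. -/
def qSub (m : ℕ) : LieSubalgebra ℂ (Affine m) where
  toSubmodule := Submodule.span ℂ {ξ | ∃ (i : ℤ) (X : sl m), i < 0 ∧ ξ = current i X}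
  lie_mem' := by
    refine lie_mem_span ?_
    rintro _ ⟨i, X, hi, rfl⟩ _ ⟨j, Y, hj, rfl⟩
    rw [current_lie_current, if_neg (by omega), zero_smul, add_zero]
    exact Submodule.subset_span ⟨i + j, _, by omega, rfl⟩

/-- The embedding `sl_m → ŝl_m`, `X ↦ X t^0`. -/
def slEmb (m : ℕ) : sl m →ₗ⁅ℂ⁆ Affine m where
  __ := current 0
  map_lie' := by
    intro X Y
    change current 0 ⁅X, Y⁆ = ⁅current 0 X, current 0 Y⁆
    simp [current_lie_current]

/-! ### Parabolic induction -/

section Induction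

variable {A B M : Type*} [Ring A] [Algebra ℂ A] [Ring B] [Algebra ℂ B] [AddCommGroup M] [Module ℂ M]

/-- The subspace of `B ⊗ M` spanned by the elements `b f(a) ⊗ v - b ⊗ a v`. -/
def indRel (f : A →ₐ[ℂ] B) (ρ : A →ₐ[ℂ] Module.End ℂ M) : Submodule ℂ (B ⊗[ℂ] M) :=
  Submodule.span ℂ {y | ∃ (b : B) (a : A) (v : M), y = (b * f a) ⊗ₜ[ℂ] v - b ⊗ₜ[ℂ] (ρ a v)}

/-- The induced module `B ⊗_A M` of an `A`-module `M`, along an algebra homomorphism `f : A → B`. -/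
abbrev Ind (f : A →ₐ[ℂ] B) (ρ : A →ₐ[ℂ] Module.End ℂ M) := (B ⊗[ℂ] M) ⧸ indRel f ρ

theorem indRel_le_comap (f : A →ₐ[ℂ] B) (ρ : A →ₐ[ℂ] Module.End ℂ M) (b : B) :
    indRel f ρ ≤ (indRel f ρ).comap ((LinearMap.mulLeft ℂ b).rTensor M) := by
  refine Submodule.span_le.2 ?_
  rintro _ ⟨c, a, v, rfl⟩
  refine Submodule.subset_span ⟨b * c, a, v, ?_⟩
  simp [mul_assoc]

/-- Left multiplication by `b` in the first factor of the induced module. -/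
def Ind.mulLeft (f : A →ₐ[ℂ] B) (ρ : A →ₐ[ℂ] Module.End ℂ M) (b : B) : Module.End ℂ (Ind f ρ) :=
  Submodule.mapQ _ _ ((LinearMap.mulLeft ℂ b).rTensor M) (indRel_le_comap f ρ b)

theorem Ind.mulLeft_mk (f : A →ₐ[ℂ] B) (ρ : A →ₐ[ℂ] Module.End ℂ M) (b c : B) (v : M) :
    Ind.mulLeft f ρ b ((indRel f ρ).mkQ (c ⊗ₜ[ℂ] v)) = (indRel f ρ).mkQ ((b * c) ⊗ₜ[ℂ] v) := rfl

theorem Ind.hom_ext {f : A →ₐ[ℂ] B} {ρ : A →ₐ[ℂ] Module.End ℂ M} {P : Type*} [AddCommGroup P]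
    [Module ℂ P] {g h : Ind f ρ →ₗ[ℂ] P}
    (H : ∀ b v, g ((indRel f ρ).mkQ (b ⊗ₜ[ℂ] v)) = h ((indRel f ρ).mkQ (b ⊗ₜ[ℂ] v))) : g = h :=
  Submodule.linearMap_qext _ (TensorProduct.ext' H)

/-- The action of `B` on the induced module by left multiplication in the first factor. -/
def Ind.action (f : A →ₐ[ℂ] B) (ρ : A →ₐ[ℂ] Module.End ℂ M) : B →ₐ[ℂ] Module.End ℂ (Ind f ρ) :=
  AlgHom.ofLinearMap
    { toFun := Ind.mulLeft f ρ
      map_add' := fun b c => Ind.hom_ext fun d v => by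
        rw [LinearMap.add_apply]
        simp only [Ind.mulLeft_mk, add_mul, TensorProduct.add_tmul, map_add]
      map_smul' := fun r b => Ind.hom_ext fun d v => by
        rw [RingHom.id_apply, LinearMap.smul_apply]
        simp only [Ind.mulLeft_mk, smul_mul_assoc, ← TensorProduct.smul_tmul', map_smul] }
    (Ind.hom_ext fun d v => by
      change Ind.mulLeft f ρ 1 _ = _
      rw [Ind.mulLeft_mk, one_mul, Module.End.one_apply])
    (fun b c => Ind.hom_ext fun d v => by
      refine (Ind.mulLeft_mk f ρ (b * c) d v).trans ?_
      rw [mul_assoc]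
      rfl)

/-- The operator `1 ⊗ g` on the induced module, for an operator `g` on `M` that commutes with the
action of `A`. -/
def Ind.map (f : A →ₐ[ℂ] B) (ρ : A →ₐ[ℂ] Module.End ℂ M) (g : Module.End ℂ M)
    (hg : ∀ a, Commute (ρ a) g) : Module.End ℂ (Ind f ρ) :=
  Submodule.mapQ _ _ (g.lTensor B) (by
    refine Submodule.span_le.2 ?_
    rintro _ ⟨c, a, v, rfl⟩
    refine Submodule.subset_span ⟨c, a, g v, ?_⟩
    have h : ρ a (g v) = g (ρ a v) := LinearMap.congr_fun (hg a) v
    simp [h])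

end Induction

section ParabolicInduction

variable (m : ℕ) (ℓ : ℂ) (U : Type*) [AddCommGroup U] [Module ℂ U] [LieRingModule (sl m) U]
  [LieModule ℂ (sl m) U]

/-- The linear map underlying `pRep`. -/
def pAct : Affine m →ₗ[ℂ] Module.End ℂ U :=
  (LieModule.toEnd ℂ (sl m) U : sl m →ₗ[ℂ] Module.End ℂ U) ∘ₗ coeffZero m +
    ℓ • (coeffCentral m).smulRight (1 : Module.End ℂ U)

theorem pAct_current (i : ℤ) (X : sl m) :
    pAct m ℓ U (current i X) = if i = 0 then LieModule.toEnd ℂ (sl m) U X else 0 := by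
  simp only [pAct, LinearMap.add_apply, LinearMap.comp_apply, coeffZero_current,
    LinearMap.smul_apply, LinearMap.smulRight_apply, coeffCentral_current, zero_smul, smul_zero,
    add_zero]
  split_ifs <;> simp

theorem pAct_central : pAct m ℓ U (central m) = ℓ • 1 := by
  simp [pAct, coeffZero_central, coeffCentral_central]

theorem pAct_lie {x y : Affine m} (hx : x ∈ pSub m) (hy : y ∈ pSub m) :
    pAct m ℓ U ⁅x, y⁆ = ⁅pAct m ℓ U x, pAct m ℓ U y⁆ := by
  induction hx, hy using Submodule.span_induction₂ with
  | mem_mem x y hx hy =>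
    rcases hx with ⟨i, X, hi, rfl⟩ | rfl
    · rcases hy with ⟨j, Y, hj, rfl⟩ | rfl
      · rw [current_lie_current, map_add, map_smul, pAct_central, pAct_current, pAct_current,
          pAct_current]
        by_cases h0 : i = 0
        · subst h0
          by_cases hj0 : j = 0
          · subst hj0; simp
          · simp [hj0]
        · rw [if_neg (by omega), if_neg (by omega), if_neg h0]
          simp
      · rw [lie_central, map_zero, pAct_central, lie_smul, Ring.lie_def, mul_one, one_mul, sub_self,
          smul_zero]
    · rw [central_lie, map_zero, pAct_central, smul_lie, Ring.lie_def, mul_one, one_mul, sub_self,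
        smul_zero]
  | zero_left y _ => simp
  | zero_right x _ => simp
  | add_left x y z _ _ _ h1 h2 => simp [add_lie, h1, h2]
  | add_right x y z _ _ _ h1 h2 => simp [lie_add, h1, h2]
  | smul_left r x y _ _ h => simp [smul_lie, h]
  | smul_right r x y _ _ h => simp [lie_smul, h]

/-- The action of `𝔭` on `U` that extends the action of `sl_m`: the elements of `t sl_m[t]` act
as zero, and `C` acts as the scalar `ℓ`. -/
def pRep : pSub m →ₗ⁅ℂ⁆ Module.End ℂ U where
  toFun ξ := pAct m ℓ U ξ
  map_add' _ _ := map_add _ _ _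
  map_smul' _ _ := map_smul _ _ _
  map_lie' {x y} := pAct_lie m ℓ U x.2 y.2

/-- The embedding `U(𝔭) → U(ŝl_m)`. -/
def pToAffine : UniversalEnvelopingAlgebra ℂ (pSub m) →ₐ[ℂ] UniversalEnvelopingAlgebra ℂ (Affine m) :=
  UniversalEnvelopingAlgebra.lift ℂ ((UniversalEnvelopingAlgebra.ι ℂ).comp (pSub m).incl)

/-- The `ŝl_m`-module `U(ŝl_m) ⊗_{U(𝔭)} U` of level `ℓ` parabolically induced from `U`. -/
def ParInd := Ind (pToAffine m) (UniversalEnvelopingAlgebra.lift ℂ (pRep m ℓ U))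

instance : AddCommGroup (ParInd m ℓ U) :=
  inferInstanceAs (AddCommGroup (Ind (pToAffine m) (UniversalEnvelopingAlgebra.lift ℂ (pRep m ℓ U))))

instance : Module ℂ (ParInd m ℓ U) :=
  inferInstanceAs (Module ℂ (Ind (pToAffine m) (UniversalEnvelopingAlgebra.lift ℂ (pRep m ℓ U))))

/-- The action of `ŝl_m` on the induced module. -/
def parIndRep : Affine m →ₗ⁅ℂ⁆ Module.End ℂ (ParInd m ℓ U) :=
  (UniversalEnvelopingAlgebra.lift ℂ).symm
    (Ind.action (pToAffine m) (UniversalEnvelopingAlgebra.lift ℂ (pRep m ℓ U)))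

instance : LieRingModule (Affine m) (ParInd m ℓ U) :=
  LieRingModule.compLieHom (ParInd m ℓ U) (parIndRep m ℓ U)

instance : LieModule ℂ (Affine m) (ParInd m ℓ U) :=
  LieModule.compLieHom (ParInd m ℓ U) (parIndRep m ℓ U)

end ParabolicInduction

/-- The annihilation condition on an `ŝl_m`-module `V`: for any `v` in `V` there is a degree `i` such
that the subspace `t^i sl_m[t]` annihilates `v`. -/
def IsSmooth (m : ℕ) (V : Type*) [AddCommGroup V] [LieRingModule (Affine m) V] : Prop :=
  ∀ v : V, ∃ i : ℤ, ∀ j, i ≤ j → ∀ X : sl m, ⁅(current j X : Affine m), v⁆ = 0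

/-! ### The degenerate affine Hecke algebra and the trigonometric Cherednik algebra -/

/-- The generators of the degenerate affine Hecke algebra: permutations, and `u_1, …, u_N`. -/
inductive HGen (N : ℕ) : Type
  | perm (σ : Equiv.Perm (Fin N))
  | u (p : Fin N)

/-- The element `z_p = u_p - σ_{1p} - … - σ_{p-1,p}`, in the free algebra. -/
def zFree {N : ℕ} (p : Fin N) : FreeAlgebra ℂ (HGen N) :=
  FreeAlgebra.ι ℂ (HGen.u p) - ∑ r ∈ Finset.Iio p, FreeAlgebra.ι ℂ (HGen.perm (Equiv.swap r p))

open FreeAlgebra HGen in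
/-- The defining relations of the degenerate affine Hecke algebra. -/
inductive HRel (N : ℕ) : FreeAlgebra ℂ (HGen N) → FreeAlgebra ℂ (HGen N) → Prop
  | perm_one : HRel N (ι ℂ (perm 1)) 1
  | perm_mul (σ τ : Equiv.Perm (Fin N)) :
      HRel N (ι ℂ (perm (σ * τ))) (ι ℂ (perm σ) * ι ℂ (perm τ))
  | u_comm (p q : Fin N) : HRel N (ι ℂ (u p) * ι ℂ (u q)) (ι ℂ (u q) * ι ℂ (u p))
  | cross_ne (p p' q : Fin N) (hp : (p' : ℕ) = p + 1) (hq : q ≠ p) (hq' : q ≠ p') :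
      HRel N (ι ℂ (perm (Equiv.swap p p')) * ι ℂ (u q)) (ι ℂ (u q) * ι ℂ (perm (Equiv.swap p p')))
  | cross_eq (p p' : Fin N) (hp : (p' : ℕ) = p + 1) :
      HRel N (ι ℂ (perm (Equiv.swap p p')) * ι ℂ (u p))
        (ι ℂ (u p') * ι ℂ (perm (Equiv.swap p p')) - 1)

/-- The degenerate affine Hecke algebra `H_N`. -/
abbrev HeckeAlg (N : ℕ) : Type := RingQuot (HRel N)

/-- The permutation `σ` as an element of `H_N`. -/
def HeckeAlg.perm {N : ℕ} (σ : Equiv.Perm (Fin N)) : HeckeAlg N :=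
  RingQuot.mkAlgHom ℂ (HRel N) (FreeAlgebra.ι ℂ (HGen.perm σ))

/-- The element `z_p` of `H_N`. -/
def HeckeAlg.z {N : ℕ} (p : Fin N) : HeckeAlg N := RingQuot.mkAlgHom ℂ (HRel N) (zFree p)

/-- The generators of the trigonometric Cherednik algebra: those of `H_N`, and `x_p`, `x_p⁻¹`. -/
inductive TGen (N : ℕ) : Type
  | hecke (g : HGen N)
  | x (p : Fin N)
  | xinv (p : Fin N)

/-- The homomorphism of free algebras that sends the generators of `H_N` to themselves. -/
def heckeFree (N : ℕ) : FreeAlgebra ℂ (HGen N) →ₐ[ℂ] FreeAlgebra ℂ (TGen N) :=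
  FreeAlgebra.lift ℂ fun g => FreeAlgebra.ι ℂ (TGen.hecke g)

/-- The generator `x_p`, in the free algebra. -/
def xFree {N : ℕ} (p : Fin N) : FreeAlgebra ℂ (TGen N) := FreeAlgebra.ι ℂ (TGen.x p)

/-- The generator `x_p⁻¹`, in the free algebra. -/
def xinvFree {N : ℕ} (p : Fin N) : FreeAlgebra ℂ (TGen N) := FreeAlgebra.ι ℂ (TGen.xinv p)

/-- The permutation `σ`, in the free algebra. -/
def permFree {N : ℕ} (σ : Equiv.Perm (Fin N)) : FreeAlgebra ℂ (TGen N) :=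
  heckeFree N (FreeAlgebra.ι ℂ (HGen.perm σ))

/-- The defining relations of the trigonometric Cherednik algebra: it is generated by `H_N` and by
the Laurent polynomials in `x_1, …, x_N`, subject to `σ x_p σ⁻¹ = x_{σ(p)}`,
`[z_p, x_q] = - x_p σ_{pq}` for `q ≠ p`, and `[z_p, x_p] = κ x_p + ∑_{r ≠ p} x_p σ_{pr}`. -/
inductive TRel (N : ℕ) (κ : ℂ) : FreeAlgebra ℂ (TGen N) → FreeAlgebra ℂ (TGen N) → Prop
  | hecke (a b : FreeAlgebra ℂ (HGen N)) (h : HRel N a b) : TRel N κ (heckeFree N a) (heckeFree N b)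
  | x_comm (p q : Fin N) : TRel N κ (xFree p * xFree q) (xFree q * xFree p)
  | x_mul_xinv (p : Fin N) : TRel N κ (xFree p * xinvFree p) 1
  | xinv_mul_x (p : Fin N) : TRel N κ (xinvFree p * xFree p) 1
  | perm_x (σ : Equiv.Perm (Fin N)) (p : Fin N) :
      TRel N κ (permFree σ * xFree p) (xFree (σ p) * permFree σ)
  | cross_ne (p q : Fin N) (h : q ≠ p) :
      TRel N κ (heckeFree N (zFree p) * xFree q - xFree q * heckeFree N (zFree p))
        (- (xFree p * permFree (Equiv.swap p q)))
  | cross_eq (p : Fin N) :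
      TRel N κ (heckeFree N (zFree p) * xFree p - xFree p * heckeFree N (zFree p))
        (κ • xFree p + ∑ r ∈ Finset.univ.erase p, xFree p * permFree (Equiv.swap p r))

/-- The trigonometric Cherednik algebra `T_N` with parameter `κ`. -/
abbrev Cherednik (N : ℕ) (κ : ℂ) : Type := RingQuot (TRel N κ)

/-- The element `x_p` of `T_N`. -/
def Cherednik.x {N : ℕ} (κ : ℂ) (p : Fin N) : Cherednik N κ := RingQuot.mkAlgHom ℂ (TRel N κ) (xFree p)

/-- The element `x_p⁻¹` of `T_N`. -/
def Cherednik.xinv {N : ℕ} (κ : ℂ) (p : Fin N) : Cherednik N κ :=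
  RingQuot.mkAlgHom ℂ (TRel N κ) (xinvFree p)

/-- The canonical homomorphism `H_N → T_N`. -/
def heckeToCherednik (N : ℕ) (κ : ℂ) : HeckeAlg N →ₐ[ℂ] Cherednik N κ :=
  RingQuot.liftAlgHom ℂ ⟨(RingQuot.mkAlgHom ℂ (TRel N κ)).comp (heckeFree N),
    fun _ _ h => RingQuot.mkAlgHom_rel ℂ (TRel.hecke _ _ h)⟩

/-! ### The vector spaces `(ℂ^m)^{⊗ N}` and `ℂ[x_1, x_1⁻¹, …, x_N, x_N⁻¹]` -/

/-- The tensor power `(ℂ^m)^{⊗ N}`. -/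
def TPow (m N : ℕ) : Type := ⨂[ℂ] _ : Fin N, (Fin m → ℂ)

instance (m N : ℕ) : AddCommGroup (TPow m N) := inferInstanceAs (AddCommGroup (⨂[ℂ] _ : Fin N, (Fin m → ℂ)))

instance (m N : ℕ) : Module ℂ (TPow m N) := inferInstanceAs (Module ℂ (⨂[ℂ] _ : Fin N, (Fin m → ℂ)))

/-- The operator `X^{(q)} = id^{⊗ (q-1)} ⊗ X ⊗ id^{⊗ (N-q)}` on `(ℂ^m)^{⊗ N}`. -/
def site {m N : ℕ} (q : Fin N) : Matrix (Fin m) (Fin m) ℂ →ₗ[ℂ] Module.End ℂ (TPow m N) where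
  toFun X := PiTensorProduct.map (Function.update (fun _ => LinearMap.id) q (Matrix.toLin' X))
  map_add' X Y := by
    rw [map_add]
    exact PiTensorProduct.map_update_add _ q _ _
  map_smul' c X := by
    rw [map_smul]
    exact PiTensorProduct.map_update_smul _ q _ _

theorem site_mul {m N : ℕ} (q : Fin N) (X Y : Matrix (Fin m) (Fin m) ℂ) :
    (site q (X * Y) : Module.End ℂ (TPow m N)) = site q X * site q Y := by
  refine Eq.trans (congrArg PiTensorProduct.map (funext fun s => ?_)) (PiTensorProduct.map_mul _ _)
  by_cases hs : s = q
  · subst hs; simp [Matrix.toLin'_mul, Module.End.mul_eq_comp]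
  · simp only [Function.update_of_ne hs, Module.End.mul_eq_comp, LinearMap.comp_id]

theorem site_comm {m N : ℕ} {q r : Fin N} (h : q ≠ r) (X Y : Matrix (Fin m) (Fin m) ℂ) :
    (site q X * site r Y : Module.End ℂ (TPow m N)) = site r Y * site q X := by
  refine Eq.trans (PiTensorProduct.map_mul _ _).symm
    (Eq.trans (congrArg PiTensorProduct.map (funext fun s => ?_)) (PiTensorProduct.map_mul _ _))
  by_cases hs : s = q
  · subst hs
    simp only [Function.update_self, Function.update_of_ne h, Module.End.mul_eq_comp,
      LinearMap.comp_id, LinearMap.id_comp]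
  · simp only [Function.update_of_ne hs, Module.End.mul_eq_comp, LinearMap.comp_id,
      LinearMap.id_comp]

/-- The permutation `σ` of the tensor factors of `(ℂ^m)^{⊗ N}`: the vector in position `p` is moved
to position `σ p`. -/
def permT {m N : ℕ} (σ : Equiv.Perm (Fin N)) : Module.End ℂ (TPow m N) :=
  (PiTensorProduct.reindex ℂ (fun _ => Fin m → ℂ) σ).toLinearMap

/-- The ring of Laurent polynomials in `x_1, …, x_N`; the monomial `x^λ` is `single λ 1`. -/
abbrev Laurent (N : ℕ) : Type := AddMonoidAlgebra ℂ (Fin N → ℤ)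

/-- The monomial `x^λ`. -/
def mono {N : ℕ} (l : Fin N → ℤ) : Laurent N := AddMonoidAlgebra.single l 1

/-- The Laurent monomial `x_p^i`. -/
def xpow {N : ℕ} (p : Fin N) (i : ℤ) : Laurent N := mono (Pi.single p i)

/-- The permutation of the variables `x_p ↦ x_{σ(p)}`. -/
def permL {N : ℕ} (σ : Equiv.Perm (Fin N)) : Laurent N →ₐ[ℂ] Laurent N :=
  AddMonoidAlgebra.mapDomainAlgHom ℂ ℂ (LinearMap.funLeft ℤ ℤ σ.symm).toAddMonoidHom

/-- The linear operator on Laurent polynomials with prescribed values on the monomials. -/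
def onMono {N : ℕ} (F : (Fin N → ℤ) → Laurent N) : Module.End ℂ (Laurent N) :=
  (AddMonoidAlgebra.basis (Fin N → ℤ) ℂ).constr ℂ F

theorem onMono_mono {N : ℕ} (F : (Fin N → ℤ) → Laurent N) (l : Fin N → ℤ) :
    onMono F (mono l) = F l := by
  rw [onMono, mono, ← AddMonoidAlgebra.basis_apply, Module.Basis.constr_basis]

theorem linearMap_ext_mono {N : ℕ} {P : Type*} [AddCommGroup P] [Module ℂ P]
    {F G : Laurent N →ₗ[ℂ] P} (h : ∀ l, F (mono l) = G (mono l)) : F = G :=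
  (AddMonoidAlgebra.basis (Fin N → ℤ) ℂ).ext fun l => by
    rw [AddMonoidAlgebra.basis_apply]; exact h l

theorem mono_mul_mono {N : ℕ} (l l' : Fin N → ℤ) : mono l * mono l' = mono (l + l') := by
  rw [mono, mono, AddMonoidAlgebra.single_mul_single, mul_one, mono]

theorem permL_mono {N : ℕ} (σ : Equiv.Perm (Fin N)) (l : Fin N → ℤ) :
    permL σ (mono l) = mono (l ∘ σ.symm) := by
  simp only [permL, mono, AddMonoidAlgebra.mapDomainAlgHom_apply, AddMonoidAlgebra.mapDomain_single]
  rfl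

theorem permL_xpow {N : ℕ} (σ : Equiv.Perm (Fin N)) (p : Fin N) (i : ℤ) :
    permL σ (xpow p i) = xpow (σ p) i := by
  rw [xpow, permL_mono, xpow]
  congr 1
  funext r
  simp [Pi.single_apply, Equiv.symm_apply_eq]

/-- The operator `x_p ∂_p` on Laurent polynomials. -/
def euler {N : ℕ} (p : Fin N) : Module.End ℂ (Laurent N) := onMono fun l => (l p : ℂ) • mono l

/-- The operator `x_p / (x_p - x_r) (1 - σ_{pr})` on Laurent polynomials for `p ≠ r`, written out on
monomials; see `sub_mul_dunkl`. -/
def dunkl {N : ℕ} (p r : Fin N) : Module.End ℂ (Laurent N) := onMono fun l =>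
  ∑ k ∈ Finset.range (l p - l r).toNat,
      mono (Function.update (Function.update l p (l r + k + 1)) r (l p - 1 - k)) -
    ∑ k ∈ Finset.range (l r - l p).toNat,
      mono (Function.update (Function.update l p (l p + k + 1)) r (l r - 1 - k))

theorem sub_mul_dunkl {N : ℕ} {p r : Fin N} (h : p ≠ r) (f : Laurent N) :
    (xpow p 1 - xpow r 1) * dunkl p r f = xpow p 1 * (f - permL (Equiv.swap p r) f) := by
  suffices H : LinearMap.mulLeft ℂ (xpow p 1 - xpow r 1) ∘ₗ dunkl p r =
      LinearMap.mulLeft ℂ (xpow p 1) ∘ₗ (LinearMap.id - (permL (Equiv.swap p r)).toLinearMap) from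
    LinearMap.congr_fun H f
  refine linearMap_ext_mono fun l => ?_
  change (xpow p 1 - xpow r 1) * dunkl p r (mono l) =
    xpow p 1 * (mono l - permL (Equiv.swap p r) (mono l))
  rw [dunkl, onMono_mono, permL_mono]
  have hp : ∀ c d : ℤ, xpow p 1 * mono (Function.update (Function.update l p c) r d) =
      mono (Function.update (Function.update l p (c + 1)) r d) := fun c d => by
    rw [xpow, mono_mul_mono]
    congr 1
    funext s
    by_cases h1 : s = r
    · subst h1; simp [h.symm]
    · by_cases h2 : s = p
      · subst h2; simp [h1, add_comm]
      · simp [h1, h2]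
  have hr : ∀ c d : ℤ, xpow r 1 * mono (Function.update (Function.update l p c) r d) =
      mono (Function.update (Function.update l p c) r (d + 1)) := fun c d => by
    rw [xpow, mono_mul_mono]
    congr 1
    funext s
    by_cases h1 : s = r
    · subst h1; simp [add_comm]
    · simp [h1]
  have hl : l = Function.update (Function.update l p (l p)) r (l r) := by simp
  have hs : l ∘ (Equiv.swap p r).symm = Function.update (Function.update l p (l r)) r (l p) := by
    funext s
    by_cases h1 : s = r
    · subst h1; simp
    · by_cases h2 : s = p
      · subst h2; simp [h1]
      · simp [h1, h2, Equiv.swap_apply_of_ne_of_ne]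
  have tel : ∀ (a b : ℤ) (n : ℕ), (xpow p 1 - xpow r 1) * ∑ k ∈ Finset.range n,
      mono (Function.update (Function.update l p (b + k + 1)) r (a - 1 - k)) =
      mono (Function.update (Function.update l p (b + n + 1)) r (a - n)) -
        mono (Function.update (Function.update l p (b + 1)) r a) := fun a b n => by
    have := Finset.sum_range_sub
      (fun k : ℕ => mono (Function.update (Function.update l p (b + k + 1)) r (a - k))) n
    simp only [Nat.cast_zero, add_zero, sub_zero] at this
    rw [← this, Finset.mul_sum]
    refine Finset.sum_congr rfl fun k _ => ?_
    have e1 : b + ((k + 1 : ℕ) : ℤ) + 1 = b + k + 1 + 1 := by push_cast; ring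
    have e2 : a - ((k + 1 : ℕ) : ℤ) = a - 1 - k := by push_cast; ring
    have e3 : a - 1 - (k : ℤ) + 1 = a - k := by ring
    rw [sub_mul, hp, hr, e1, e2, e3]
  have hl' : xpow p 1 * mono l = mono (Function.update (Function.update l p (l p + 1)) r (l r)) :=
    (congrArg (fun l' => xpow p 1 * mono l') hl).trans (hp _ _)
  rw [mul_sub, tel, tel, hs, mul_sub, hp, hl']
  rcases le_total (l r) (l p) with hle | hle
  · have e1 : ((l p - l r).toNat : ℤ) = l p - l r := Int.toNat_of_nonneg (by omega)
    have e2 : ((l r - l p).toNat : ℤ) = 0 := by omega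
    have e3 : l r + (l p - l r) + 1 = l p + 1 := by ring
    have e4 : l p - (l p - l r) = l r := by ring
    rw [e1, e2, e3, e4, add_zero, sub_zero, sub_self, sub_zero]
  · have e1 : ((l r - l p).toNat : ℤ) = l r - l p := Int.toNat_of_nonneg (by omega)
    have e2 : ((l p - l r).toNat : ℤ) = 0 := by omega
    have e3 : l p + (l r - l p) + 1 = l r + 1 := by ring
    have e4 : l r - (l r - l p) = l p := by ring
    rw [e1, e2, e3, e4, add_zero, sub_zero, sub_self, zero_sub, neg_sub]

/-! ### The functor `F_N` -/

theorem sum_lie_sum {ι A : Type*} [Fintype ι] [Ring A] (s t : ι → A)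
    (h : ∀ q r, q ≠ r → s q * t r = t r * s q) : ⁅∑ q, s q, ∑ q, t q⁆ = ∑ q, ⁅s q, t q⁆ := by
  rw [Ring.lie_def, Finset.sum_mul_sum, Finset.sum_mul_sum,
    Finset.sum_comm (f := fun i j => t i * s j), ← Finset.sum_sub_distrib]
  refine Finset.sum_congr rfl fun q _ => ?_
  rw [← Finset.sum_sub_distrib, Finset.sum_eq_single q]
  · rw [Ring.lie_def]
  · intro r _ hr
    rw [h q r hr.symm, sub_self]
  · intro hq
    exact absurd (Finset.mem_univ q) hq

/-- The diagonal action of `sl_m` on `(ℂ^m)^{⊗ N}`. -/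
def tensorRep (m N : ℕ) : sl m →ₗ⁅ℂ⁆ Module.End ℂ (TPow m N) where
  toFun X := ∑ q, site q X.1
  map_add' X Y := by simp [Finset.sum_add_distrib]
  map_smul' c X := by simp [Finset.smul_sum]
  map_lie' {X Y} := by
    refine Eq.trans ?_ (sum_lie_sum (fun q => site q X.1) (fun q => site q Y.1)
      fun q r h => site_comm h _ _).symm
    refine Finset.sum_congr rfl fun q _ => ?_
    have h : (⁅X, Y⁆ : sl m).1 = X.1 * Y.1 - Y.1 * X.1 := rfl
    rw [h, map_sub, site_mul, site_mul, Ring.lie_def]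

instance (m N : ℕ) : LieRingModule (sl m) (TPow m N) :=
  LieRingModule.compLieHom (TPow m N) (tensorRep m N)

instance (m N : ℕ) : LieModule ℂ (sl m) (TPow m N) :=
  LieModule.compLieHom (TPow m N) (tensorRep m N)

section FN

variable (m N : ℕ) (U : Type*) [AddCommGroup U] [Module ℂ U] [LieRingModule (sl m) U]
  [LieModule ℂ (sl m) U]

/-- The `sl_m`-module `F_N(U) = (ℂ^m)^{⊗ N} ⊗ U`, a tensor product of `sl_m`-modules. -/
abbrev FN := TPow m N ⊗[ℂ] U

/-- `ρ` is Cherednik's action of `H_N` on `F_N(U)`: permutations act by permutations of the tensor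
factors `ℂ^m`, and `z_p` acts as `∑_{a,b} E_ab^{(p)} ⊗ E_ba - (1/m) id ⊗ I`, that is as
`∑_{a,b} E_ab^{(p)} ⊗ (E_ba - (δ_ab/m) I)`. These elements generate `H_N`. -/
structure IsHeckeAction (ρ : HeckeAlg N →ₐ[ℂ] Module.End ℂ (FN m N U)) : Prop where
  perm : ∀ σ, ρ (HeckeAlg.perm σ) = (permT σ).rTensor U
  z : ∀ p, ρ (HeckeAlg.z p) = ∑ a, ∑ b,
    TensorProduct.map (site p (Matrix.single a b 1)) (LieModule.toEnd ℂ (sl m) U (slE b a))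

end FN

/-! ### The functor `A_N` -/

/-- The vector space `ℂ[x_1, x_1⁻¹, …, x_N, x_N⁻¹] ⊗ (ℂ^m)^{⊗ N}`, which is the tensor product of
`N` copies of `ℂ^m[t, t⁻¹]`. -/
def LT (m N : ℕ) : Type := Laurent N ⊗[ℂ] TPow m N

instance (m N : ℕ) : AddCommGroup (LT m N) := inferInstanceAs (AddCommGroup (Laurent N ⊗[ℂ] TPow m N))

instance (m N : ℕ) : Module ℂ (LT m N) := inferInstanceAs (Module ℂ (Laurent N ⊗[ℂ] TPow m N))

/-- The operator `f ⊗ g` on `ℂ[x_1, x_1⁻¹, …, x_N, x_N⁻¹] ⊗ (ℂ^m)^{⊗ N}`. -/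
def opLT {m N : ℕ} : Module.End ℂ (Laurent N) →ₗ[ℂ] Module.End ℂ (TPow m N) →ₗ[ℂ]
    Module.End ℂ (LT m N) :=
  TensorProduct.mapBilinear (RingHom.id ℂ) (Laurent N) (TPow m N) (Laurent N) (TPow m N)

theorem opLT_mul {m N : ℕ} (f f' : Module.End ℂ (Laurent N)) (g g' : Module.End ℂ (TPow m N)) :
    opLT f g * opLT f' g' = opLT (f * f') (g * g') :=
  (TensorProduct.map_mul f f' g g').symm

/-- Substitution of `x_q` for `t`. -/
def evalAt {N : ℕ} (q : Fin N) : AddMonoidAlgebra ℂ ℤ →ₐ[ℂ] Laurent N :=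
  AddMonoidAlgebra.mapDomainAlgHom ℂ ℂ (AddMonoidHom.single (fun _ : Fin N => ℤ) q)

theorem evalAt_single {N : ℕ} (q : Fin N) (i : ℤ) :
    evalAt q (AddMonoidAlgebra.single i 1) = xpow q i := by
  simp only [evalAt, xpow, mono, AddMonoidAlgebra.mapDomainAlgHom_apply,
    AddMonoidAlgebra.mapDomain_single]
  rfl

/-- The action of the loop algebra in the `q`-th factor `ℂ^m[t, t⁻¹]`: the element `X t^j` acts as
`x_q^j ⊗ X^{(q)}`. -/
def loopSite {m N : ℕ} (q : Fin N) : Loop m →ₗ[ℂ] Module.End ℂ (LT m N) :=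
  TensorProduct.lift (opLT.compl₁₂ ((LinearMap.mul ℂ (Laurent N)) ∘ₗ (evalAt q).toLinearMap)
    (site q ∘ₗ (LieAlgebra.SpecialLinear.sl (Fin m) ℂ).toSubmodule.subtype))

theorem loopSite_tmul {m N : ℕ} (q : Fin N) (f : AddMonoidAlgebra ℂ ℤ) (X : sl m) :
    (loopSite q (f ⊗ₜ[ℂ] X) : Module.End ℂ (LT m N)) =
      opLT (LinearMap.mulLeft ℂ (evalAt q f)) (site q X.1) := rfl

theorem mulLeft_mul_mulLeft {N : ℕ} (f g : Laurent N) :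
    LinearMap.mulLeft ℂ f * LinearMap.mulLeft ℂ g = LinearMap.mulLeft ℂ (f * g) :=
  (LinearMap.mulLeft_mul ..).symm

theorem loopSite_comm {m N : ℕ} {q r : Fin N} (h : q ≠ r) (x y : Loop m) :
    (loopSite q x * loopSite r y : Module.End ℂ (LT m N)) = loopSite r y * loopSite q x := by
  induction x using TensorProduct.induction_on with
  | zero => rw [map_zero, zero_mul, mul_zero]
  | add x x' hx hx' => rw [map_add, add_mul, mul_add, hx, hx']
  | tmul f X =>
    induction y using TensorProduct.induction_on with
    | zero => rw [map_zero, zero_mul, mul_zero]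
    | add y y' hy hy' => rw [map_add, add_mul, mul_add, hy, hy']
    | tmul g Y =>
      rw [loopSite_tmul, loopSite_tmul, opLT_mul, opLT_mul,
        site_comm h, mulLeft_mul_mulLeft, mulLeft_mul_mulLeft, mul_comm]

theorem loopSite_lie {m N : ℕ} (q : Fin N) (x y : Loop m) :
    (loopSite q ⁅x, y⁆ : Module.End ℂ (LT m N)) =
      loopSite q x * loopSite q y - loopSite q y * loopSite q x := by
  induction x using TensorProduct.induction_on with
  | zero =>
    refine (congrArg (loopSite q) (zero_lie y)).trans ?_
    rw [map_zero, zero_mul, mul_zero, sub_zero]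
  | add x x' hx hx' =>
    refine (congrArg (loopSite q) (add_lie x x' y)).trans ?_
    rw [map_add, map_add, hx, hx', add_mul, mul_add]
    abel
  | tmul f X =>
    induction y using TensorProduct.induction_on with
    | zero =>
      refine (congrArg (loopSite q) (lie_zero (f ⊗ₜ[ℂ] X : Loop m))).trans ?_
      rw [map_zero, zero_mul, mul_zero, sub_zero]
    | add y y' hy hy' =>
      refine (congrArg (loopSite q) (lie_add (f ⊗ₜ[ℂ] X : Loop m) y y')).trans ?_
      rw [map_add, map_add, hy, hy', add_mul, mul_add]
      abel
    | tmul g Y =>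
      have h : (⁅X, Y⁆ : sl m).1 = X.1 * Y.1 - Y.1 * X.1 := rfl
      rw [LieAlgebra.ExtendScalars.bracket_tmul, loopSite_tmul, loopSite_tmul, loopSite_tmul,
        opLT_mul, opLT_mul, ← site_mul, ← site_mul,
        mulLeft_mul_mulLeft, mulLeft_mul_mulLeft, mul_comm (evalAt q g), ← map_mul, h,
        map_sub, map_sub]

/-- The action of `ŝl_m` on the tensor product of `N` copies of `ℂ^m[t, t⁻¹]`: `X t^j` acts as
`∑_q x_q^j ⊗ X^{(q)}`, and `C` acts as zero. -/
def loopRep (m N : ℕ) : Loop m →ₗ⁅ℂ⁆ Module.End ℂ (LT m N) where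
  __ := ∑ q, loopSite q
  map_lie' {x y} := by
    change (∑ q, loopSite q : Loop m →ₗ[ℂ] Module.End ℂ (LT m N)) ⁅x, y⁆ =
      ⁅(∑ q, loopSite q : Loop m →ₗ[ℂ] Module.End ℂ (LT m N)) x,
        (∑ q, loopSite q : Loop m →ₗ[ℂ] Module.End ℂ (LT m N)) y⁆
    rw [LinearMap.sum_apply, LinearMap.sum_apply, LinearMap.sum_apply]
    refine Eq.trans ?_ (sum_lie_sum (fun q => loopSite q x) (fun q => loopSite q y)
      fun q r h => loopSite_comm h x y).symm
    exact Finset.sum_congr rfl fun q _ => loopSite_lie q x y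

instance (m N : ℕ) : LieRingModule (Affine m) (LT m N) :=
  LieRingModule.compLieHom (LT m N) ((loopRep m N).comp (loopPart m))

instance (m N : ℕ) : LieModule ℂ (Affine m) (LT m N) :=
  LieModule.compLieHom (LT m N) ((loopRep m N).comp (loopPart m))

section AN

variable (m N : ℕ) (κ : ℂ) (V : Type*) [AddCommGroup V] [Module ℂ V] [LieRingModule (Affine m) V]
  [LieModule ℂ (Affine m) V]

/-- The `ŝl_m`-module `A_N(V) = ℂ[x_1, x_1⁻¹, …, x_N, x_N⁻¹] ⊗ (ℂ^m)^{⊗ N} ⊗ V`, a tensor product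
of `ŝl_m`-modules. -/
abbrev AN := LT m N ⊗[ℂ] V

/-- The summand `x_p^{-i} ⊗ (∑_{a,b} E_ab^{(p)} ⊗ E_ba t^i - (1/m) id ⊗ I t^i)` of the operator of
`z_p`, written as `∑_{a,b} x_p^{-i} ⊗ E_ab^{(p)} ⊗ (E_ba - (δ_ab/m) I) t^i`. -/
def currentTerm (p : Fin N) (i : ℕ) : Module.End ℂ (AN m N V) :=
  ∑ a, ∑ b, TensorProduct.map
    (opLT (LinearMap.mulLeft ℂ (xpow p (-(i : ℤ)))) (site p (Matrix.single a b 1)))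
    (LieModule.toEnd ℂ (Affine m) V (current i (slE b a)))

/-- On a smooth module, only finitely many of the summands are nonzero on a given vector. -/
theorem currentTerm_finite {m N : ℕ} {V : Type*} [AddCommGroup V] [Module ℂ V]
    [LieRingModule (Affine m) V] [LieModule ℂ (Affine m) V] (hV : IsSmooth m V) (p : Fin N)
    (w : AN m N V) : (Function.support fun i => currentTerm m N V p i w).Finite := by
  induction w using TensorProduct.induction_on with
  | zero => simp
  | add w w' hw hw' =>
    refine (hw.union hw').subset fun i hi => ?_
    by_contra hc
    rw [Set.mem_union, not_or, Function.mem_support, Function.mem_support, not_not, not_not] at hc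
    exact hi (by simp only [map_add, hc.1, hc.2, add_zero])
  | tmul a v =>
    obtain ⟨i₀, hi₀⟩ := hV v
    refine (Set.finite_lt_nat i₀.toNat).subset fun i hi => ?_
    by_contra hc
    have hle : i₀ ≤ (i : ℤ) := by
      have : ¬ i < i₀.toNat := hc
      omega
    refine hi ?_
    simp only [currentTerm, LinearMap.sum_apply, TensorProduct.map_tmul, LieModule.toEnd_apply_apply,
      hi₀ i hle, TensorProduct.tmul_zero, Finset.sum_const_zero]

/-- The operator of `z_p` on `A_N(V)`:
`κ x_p ∂_p ⊗ id ⊗ id + ∑_{r ≠ p} x_p / (x_p - x_r) (1 - σ_{pr}) ⊗ σ_{pr} ⊗ id +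
∑_{i ≥ 0} x_p^{-i} ⊗ (∑_{a,b} E_ab^{(p)} ⊗ E_ba t^i - (1/m) id ⊗ I t^i)`. -/
def cherednikOp (p : Fin N) (w : AN m N V) : AN m N V :=
  (κ • opLT (euler p) 1 + ∑ r ∈ Finset.univ.erase p, opLT (dunkl p r) (permT (Equiv.swap p r)) :
    Module.End ℂ (LT m N)).rTensor V w +
  ∑ᶠ i : ℕ, currentTerm m N V p i w

/-- `ρ` is the action of `T_N` on `A_N(V)`: `x_p` and `x_p⁻¹` act by multiplication, permutations act
by simultaneous permutations of the variables and of the tensor factors `ℂ^m`, and `z_p` acts as the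
Cherednik operator. These elements generate `T_N`. -/
structure IsCherednikAction (ρ : Cherednik N κ →ₐ[ℂ] Module.End ℂ (AN m N V)) : Prop where
  x : ∀ p, ρ (Cherednik.x κ p) =
    (opLT (LinearMap.mulLeft ℂ (xpow p 1)) 1).rTensor V
  xinv : ∀ p, ρ (Cherednik.xinv κ p) =
    (opLT (LinearMap.mulLeft ℂ (xpow p (-1))) 1).rTensor V
  perm : ∀ σ, ρ (heckeToCherednik N κ (HeckeAlg.perm σ)) =
    (opLT (permL σ).toLinearMap (permT σ)).rTensor V
  z : ∀ p w, ρ (heckeToCherednik N κ (HeckeAlg.z p)) w = cherednikOp m N κ V p w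

end AN

/-! ### Coinvariants -/

section Coinvariants

variable (m : ℕ) (W : Type*) [AddCommGroup W] [Module ℂ W] [LieRingModule (Affine m) W]
  [LieModule ℂ (Affine m) W]

/-- The image `𝔮 W` of the action of `𝔮` on an `ŝl_m`-module `W`. -/
def qImage : Submodule ℂ W := Submodule.span ℂ {w | ∃ ξ ∈ qSub m, ∃ v : W, w = ⁅ξ, v⁆}

/-- The space `W_𝔮` of `𝔮`-coinvariants of `W`. -/
abbrev Coinv := W ⧸ qImage m W

theorem slEmb_lie_q {m : ℕ} (X : sl m) {ξ : Affine m} (hξ : ξ ∈ qSub m) : ⁅slEmb m X, ξ⁆ ∈ qSub m := by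
  change ⁅(current 0 X : Affine m), ξ⁆ ∈ Submodule.span ℂ _
  induction hξ using Submodule.span_induction with
  | mem ξ h =>
    obtain ⟨i, Y, hi, rfl⟩ := h
    refine Submodule.subset_span ⟨i, ⁅X, Y⁆, hi, ?_⟩
    rw [current_lie_current, if_neg (by omega), zero_smul, add_zero, zero_add]
  | zero => rw [lie_zero]; exact zero_mem _
  | add x y _ _ hx hy => rw [lie_add]; exact add_mem hx hy
  | smul c x _ hx => rw [lie_smul]; exact Submodule.smul_mem _ _ hx

theorem slEmb_qImage (X : sl m) :
    qImage m W ≤ (qImage m W).comap (LieModule.toEnd ℂ (Affine m) W (slEmb m X)) := by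
  refine Submodule.span_le.2 ?_
  rintro _ ⟨ξ, hξ, v, rfl⟩
  change ⁅slEmb m X, ⁅ξ, v⁆⁆ ∈ qImage m W
  rw [leibniz_lie]
  exact add_mem (Submodule.subset_span ⟨_, slEmb_lie_q X hξ, v, rfl⟩)
    (Submodule.subset_span ⟨ξ, hξ, _, rfl⟩)

/-- The action of `sl_m` on the space of `𝔮`-coinvariants of an `ŝl_m`-module. -/
def coinvRep : sl m →ₗ⁅ℂ⁆ Module.End ℂ (Coinv m W) where
  toFun X := Submodule.mapQ _ _ (LieModule.toEnd ℂ (Affine m) W (slEmb m X)) (slEmb_qImage m W X)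
  map_add' X Y := Submodule.linearMap_qext _ (LinearMap.ext fun w => by
    change (qImage m W).mkQ ⁅slEmb m (X + Y), w⁆ =
      (qImage m W).mkQ ⁅slEmb m X, w⁆ + (qImage m W).mkQ ⁅slEmb m Y, w⁆
    rw [map_add, add_lie, map_add])
  map_smul' c X := Submodule.linearMap_qext _ (LinearMap.ext fun w => by
    change (qImage m W).mkQ ⁅slEmb m (c • X), w⁆ = c • (qImage m W).mkQ ⁅slEmb m X, w⁆
    rw [map_smul, smul_lie, map_smul])
  map_lie' {X Y} := Submodule.linearMap_qext _ (LinearMap.ext fun w => by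
    change (qImage m W).mkQ ⁅slEmb m ⁅X, Y⁆, w⁆ =
      (qImage m W).mkQ ⁅slEmb m X, ⁅slEmb m Y, w⁆⁆ - (qImage m W).mkQ ⁅slEmb m Y, ⁅slEmb m X, w⁆⁆
    rw [LieHom.map_lie, lie_lie, map_sub])

end Coinvariants

end AST

end

open scoped TensorProduct
noncomputable section
namespace AST
attribute [local instance 100] LieRing.ofAssociativeRing


/-! ### Generators of algebras, and stable subspaces -/

section Generators

variable {A M : Type*} [Ring A] [Algebra ℂ A] [AddCommGroup M] [Module ℂ M]

/-! Write Ω_p^(k) = ∑ E_ab^(p) ⊗ (E_ba − δ_ab/m) t^k for the Casimir operator between the p-th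
factor ℂ^m and the last factor, so that z_p acts by Ω_p^(0) on F_N(U), and by a
differential-difference part plus ∑_{k≥0} x_p^{-k} Ω_p^(k) on A_N(V).

Existence of the actions. The relations of H_N follow from σ z_p = z_{σ(p)} σ and [z_p, z_q] = σ_pq
(z_p − z_q) (`HeckeData`). On F_N(U) the second relation is the classical Yang-Baxter equation
(`casimir_commutator`), because σ_pq is itself a Casimir operator (`permT_swap`). On A_N(V) the
relations between z_p and x_q come from the twisted Leibniz rule `dunkl_mul`. These relations and
σ-equivariance already force the defect [z_p, z_q] − σ_pq (z_p − z_q) to commute with every x_r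
(`CrossData.zDefect_comm`). Hence it suffices to evaluate the defect on vectors 1 ⊗ t ⊗ v, where the
first z applied has no differential part; there the divided differences of x_q^{-k} cancel the
Yang-Baxter terms (`an_zDefect`).

Descent to coinvariants. The commutator of z_p with X t^{-n} equals ∑_{i<n} ∑_{a,b} ([E_ba, X]
t^{i-n}) ∘ (x_p^{-i} E_ab^(p)), which has image in 𝔮 A_N(V) (`anZ_lie`). The current parts telescope
and leave i < n. What remains is a multiple of x_p^{-n} X^(p): the derivation contributes −κn, the
central charge contributes nℓ, and the required total is −nm because ∑ [E_ba, X] E_ab = −m X. This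
is why the level is κ − m (`commutator_terms`).

The isomorphism. The map t ⊗ u ↦ 1 ⊗ t ⊗ u is H_N-equivariant, since U is killed by t sl_m[t] and
only the current with k = 0 survives (`anRep_fnEmb`); it therefore induces a T_N-map from the
induced module to the coinvariants. It is onto because V is generated by U under 𝔮, and in the
coinvariants 𝔮 can be moved off V (`indToCoinv_surjective`). For injectivity, T_N is spanned by
products of Laurent polynomials with elements of H_N (`cherednik_span`), so the induced module is
spanned by the f ⊗ (t ⊗ u). A left inverse exists because V maps 𝔮-equivariantly to U(𝔮) ⊗ U
(`triOfParInd`), and the antipode of U(𝔮) then gives a map from coinvariants to ℂ[x^{±1}] ⊗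
(ℂ^m)^{⊗N} ⊗ U (`anProj`). Neither a PBW basis of T_N nor one of the enveloping algebra is used: the
𝔭 ⊕ 𝔮 action on U(𝔮) ⊗ U is built directly (`triAct`). -/

/-- A subspace stable under generators of an algebra is stable under the algebra. -/
theorem stable_of_adjoin_eq_top {s : Set A} (hs : Algebra.adjoin ℂ s = ⊤)
    (F : A →ₐ[ℂ] Module.End ℂ M) (S : Submodule ℂ M) (h : ∀ a ∈ s, ∀ v ∈ S, F a v ∈ S) (a : A) :
    ∀ v ∈ S, F a v ∈ S := by
  have ha : a ∈ Algebra.adjoin ℂ s := hs ▸ Algebra.mem_top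
  induction ha using Algebra.adjoin_induction with
  | mem a ha => exact h a ha
  | algebraMap r =>
    intro v hv
    rw [AlgHom.commutes, Module.algebraMap_end_apply]
    exact S.smul_mem r hv
  | add a b _ _ ha hb =>
    intro v hv
    rw [map_add]
    exact add_mem (ha v hv) (hb v hv)
  | mul a b _ _ ha hb =>
    intro v hv
    rw [map_mul]
    exact ha _ (hb v hv)

/-- An operator that commutes with generators of an algebra commutes with the algebra. -/
theorem commute_of_adjoin_eq_top {B : Type*} [Ring B] [Algebra ℂ B] {s : Set A}
    (hs : Algebra.adjoin ℂ s = ⊤) (F : A →ₐ[ℂ] B) (T : B) (h : ∀ a ∈ s, Commute (F a) T) (a : A) :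
    Commute (F a) T := by
  have ha : a ∈ Algebra.adjoin ℂ s := hs ▸ Algebra.mem_top
  induction ha using Algebra.adjoin_induction with
  | mem a ha => exact h a ha
  | algebraMap r => rw [AlgHom.commutes]; exact Algebra.commutes r T
  | add a b _ _ ha hb => rw [map_add]; exact ha.add_left hb
  | mul a b _ _ ha hb => rw [map_mul]; exact ha.mul_left hb

/-- A subspace of an algebra that contains `1` and is stable under left multiplication by
generators is everything. -/
theorem eq_top_of_mul_mem {s : Set A} (hs : Algebra.adjoin ℂ s = ⊤) (S : Submodule ℂ A)
    (h1 : 1 ∈ S) (h : ∀ a ∈ s, ∀ b ∈ S, a * b ∈ S) : S = ⊤ := by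
  refine eq_top_iff.2 fun a _ => ?_
  have := stable_of_adjoin_eq_top hs (Algebra.lmul ℂ A) S h a 1 h1
  simpa using this

end Generators

/-- The canonical map of L corestricts to the generated subalgebra, hence lifts to U(L); followed by
the inclusion, the lift is the identity by uniqueness, so every element lies in the subalgebra. -/
theorem adjoin_range_ι (L : Type*) [LieRing L] [LieAlgebra ℂ L] :
    Algebra.adjoin ℂ (Set.range (UniversalEnvelopingAlgebra.ι ℂ : L → _)) = ⊤ := by
  set S := Algebra.adjoin ℂ (Set.range (UniversalEnvelopingAlgebra.ι ℂ : L → _))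
  let f : L →ₗ⁅ℂ⁆ S :=
    { toFun := fun x => ⟨UniversalEnvelopingAlgebra.ι ℂ x, Algebra.subset_adjoin ⟨x, rfl⟩⟩
      map_add' := fun x y => Subtype.ext (map_add _ x y)
      map_smul' := fun c x => Subtype.ext (map_smul _ c x)
      map_lie' := fun {x y} => Subtype.ext (LieHom.map_lie _ x y) }
  have h : S.val.comp (UniversalEnvelopingAlgebra.lift ℂ f) = AlgHom.id ℂ _ := by
    refine UniversalEnvelopingAlgebra.hom_ext ℂ (LieHom.ext fun x => ?_)
    change ((UniversalEnvelopingAlgebra.lift ℂ f (UniversalEnvelopingAlgebra.ι ℂ x) : S) :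
      UniversalEnvelopingAlgebra ℂ L) = UniversalEnvelopingAlgebra.ι ℂ x
    rw [UniversalEnvelopingAlgebra.lift_ι_apply]
    rfl
  refine eq_top_iff.2 fun a _ => ?_
  rw [← AlgHom.id_apply (R := ℂ) a, ← h]
  exact (UniversalEnvelopingAlgebra.lift ℂ f a).2

theorem adjoin_mkAlgHom_ι {X : Type*} (r : FreeAlgebra ℂ X → FreeAlgebra ℂ X → Prop) :
    Algebra.adjoin ℂ (Set.range fun g => RingQuot.mkAlgHom ℂ r (FreeAlgebra.ι ℂ g)) = ⊤ := by
  have h : (Set.range fun g => RingQuot.mkAlgHom ℂ r (FreeAlgebra.ι ℂ g)) =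
      RingQuot.mkAlgHom ℂ r '' Set.range (FreeAlgebra.ι ℂ) := Set.range_comp _ _
  rw [h, ← AlgHom.map_adjoin, FreeAlgebra.adjoin_range_ι, Algebra.map_top,
    AlgHom.range_eq_top]
  exact RingQuot.mkAlgHom_surjective ℂ r

/-! ### The module `U(𝔮) ⊗ U` over a Lie algebra `𝔮 ⊕ 𝔭` -/

section Decomposition

variable {L : Type*} [LieRing L] [LieAlgebra ℂ L] (p q : LieSubalgebra ℂ L)
  (hpq : IsCompl q.toSubmodule p.toSubmodule)
  {U : Type*} [AddCommGroup U] [Module ℂ U] (ρ : p →ₗ⁅ℂ⁆ Module.End ℂ U)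

/-- The underlying vector space `U(𝔮) ⊗ U`. -/
abbrev TriMod (U : Type*) [AddCommGroup U] [Module ℂ U] := UniversalEnvelopingAlgebra ℂ q ⊗[ℂ] U

/-- Left multiplication by an element of `𝔮`. -/
def triLeft (U : Type*) [AddCommGroup U] [Module ℂ U] : q →ₗ[ℂ] Module.End ℂ (TriMod q U) :=
  LinearMap.rTensorHom U ∘ₗ LinearMap.mul ℂ (UniversalEnvelopingAlgebra ℂ q) ∘ₗ
    (UniversalEnvelopingAlgebra.ι ℂ : q →ₗ⁅ℂ⁆ UniversalEnvelopingAlgebra ℂ q).toLinearMap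

theorem triLeft_tmul (y : q) (b : UniversalEnvelopingAlgebra ℂ q) (u : U) :
    triLeft q U y (b ⊗ₜ u) = (UniversalEnvelopingAlgebra.ι ℂ y * b) ⊗ₜ u := rfl

theorem triLeft_lie (y y' : q) :
    triLeft q U ⁅y, y'⁆ = triLeft q U y * triLeft q U y' - triLeft q U y' * triLeft q U y := by
  refine TensorProduct.ext' fun b u => ?_
  simp only [LinearMap.sub_apply, Module.End.mul_apply, triLeft_tmul, LieHom.map_lie, Ring.lie_def,
    sub_mul, TensorProduct.sub_tmul, mul_assoc]

/-- The action of `𝔮` on `Hom(L, U(𝔮) ⊗ U)`. -/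
def triHom (U : Type*) [AddCommGroup U] [Module ℂ U] :
    q →ₗ⁅ℂ⁆ Module.End ℂ (L →ₗ[ℂ] TriMod q U) where
  toFun y :=
    { toFun := fun f => triLeft q U y ∘ₗ f - f ∘ₗ (LieAlgebra.ad ℂ L y : L →ₗ[ℂ] L)
      map_add' := fun f g => by ext x; simp; abel
      map_smul' := fun c f => by ext x; simp [smul_sub] }
  map_add' y y' := by
    ext f x
    simp
    abel
  map_smul' c y := by
    ext f x
    simp [smul_sub]
  map_lie' {y y'} := by
    ext f x
    simp only [LinearMap.coe_mk, AddHom.coe_mk, LinearMap.sub_apply, LinearMap.comp_apply,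
      triLeft_lie, Ring.lie_def, Module.End.mul_apply, LieAlgebra.ad_apply, map_sub,
      LieSubalgebra.coe_bracket, lie_lie]
    abel

variable {q}

/-- The map `u ↦ (x ↦ x_𝔮 ⊗ u + 1 ⊗ x_𝔭 u)`. -/
def triInit : U →ₗ[ℂ] L →ₗ[ℂ] TriMod q U :=
  (TensorProduct.mk ℂ (UniversalEnvelopingAlgebra ℂ q) U ∘ₗ
    (UniversalEnvelopingAlgebra.ι ℂ : q →ₗ⁅ℂ⁆ UniversalEnvelopingAlgebra ℂ q).toLinearMap ∘ₗ
      (Submodule.projectionOnto _ _ hpq : L →ₗ[ℂ] q)).flip +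
  ((ρ : p →ₗ[ℂ] Module.End ℂ U).compr₂ (TensorProduct.mk ℂ (UniversalEnvelopingAlgebra ℂ q) U 1) ∘ₗ
    (Submodule.projectionOnto _ _ hpq.symm : L →ₗ[ℂ] p)).flip

theorem triInit_q (u : U) (y : q) :
    triInit p hpq ρ u (y : L) = UniversalEnvelopingAlgebra.ι ℂ y ⊗ₜ u := by
  have h1 : (Submodule.projectionOnto _ _ hpq : L →ₗ[ℂ] q) y = y :=
    Submodule.projectionOnto_apply_left hpq y
  have h2 : (Submodule.projectionOnto _ _ hpq.symm : L →ₗ[ℂ] p) y = 0 :=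
    Submodule.projectionOnto_apply_right hpq.symm y
  change UniversalEnvelopingAlgebra.ι ℂ (L := q) ((Submodule.projectionOnto _ _ hpq : L →ₗ[ℂ] q) y) ⊗ₜ u +
    1 ⊗ₜ[ℂ] (ρ ((Submodule.projectionOnto _ _ hpq.symm : L →ₗ[ℂ] p) y) u) = _
  rw [h1, h2, map_zero, LinearMap.zero_apply, TensorProduct.tmul_zero, add_zero]

theorem triInit_p (u : U) (x : p) : triInit p hpq ρ u (x : L) = 1 ⊗ₜ (ρ x u) := by
  have h1 : (Submodule.projectionOnto _ _ hpq : L →ₗ[ℂ] q) x = 0 :=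
    Submodule.projectionOnto_apply_right hpq x
  have h2 : (Submodule.projectionOnto _ _ hpq.symm : L →ₗ[ℂ] p) x = x :=
    Submodule.projectionOnto_apply_left hpq.symm x
  change UniversalEnvelopingAlgebra.ι ℂ (L := q) ((Submodule.projectionOnto _ _ hpq : L →ₗ[ℂ] q) x) ⊗ₜ u +
    1 ⊗ₜ[ℂ] (ρ ((Submodule.projectionOnto _ _ hpq.symm : L →ₗ[ℂ] p) x) u) = _
  rw [h1, h2, map_zero, TensorProduct.zero_tmul, zero_add]

/-- The action of `L` on `U(𝔮) ⊗ U`, as a linear map. -/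
def triAct : L →ₗ[ℂ] Module.End ℂ (TriMod q U) :=
  (TensorProduct.lift ((UniversalEnvelopingAlgebra.lift ℂ (triHom q U)).toLinearMap.compl₂
    (triInit p hpq ρ))).flip

theorem triAct_one (x : L) (u : U) :
    triAct p hpq ρ x (1 ⊗ₜ u) = triInit p hpq ρ u x := by
  change UniversalEnvelopingAlgebra.lift ℂ (triHom q U) 1 (triInit p hpq ρ u) x = _
  rw [map_one, Module.End.one_apply]

/-- This recursion, x(yw) = y(xw) − [y, x]w, is what a Lie action in which 𝔮 acts by left
multiplication must satisfy. It says that w ↦ (x ↦ xw) is 𝔮-equivariant into Hom(L, U(𝔮) ⊗ U) with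
the action `triHom`. As U(𝔮) ⊗ U is free over U(𝔮), such a map is fixed by its values on 1 ⊗ U,
which is how `triAct` is defined. -/
theorem triAct_mul (x : L) (y : q) (w : TriMod q U) :
    triAct p hpq ρ x (triLeft q U y w) =
      triLeft q U y (triAct p hpq ρ x w) - triAct p hpq ρ ⁅(y : L), x⁆ w := by
  induction w using TensorProduct.induction_on with
  | zero => simp only [map_zero, sub_zero]
  | add w w' h h' => simp only [map_add, h, h']; abel
  | tmul b u =>
    change UniversalEnvelopingAlgebra.lift ℂ (triHom q U) (UniversalEnvelopingAlgebra.ι ℂ y * b)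
      (triInit p hpq ρ u) x = _
    rw [map_mul, UniversalEnvelopingAlgebra.lift_ι_apply]
    rfl

theorem tri_induction {P : Submodule ℂ (TriMod q U)} (h1 : ∀ u : U, 1 ⊗ₜ u ∈ P)
    (h : ∀ (y : q), ∀ w ∈ P, triLeft q U y w ∈ P) (w : TriMod q U) : w ∈ P := by
  induction w using TensorProduct.induction_on with
  | zero => exact zero_mem P
  | add w w' h h' => exact add_mem h h'
  | tmul b u =>
    have : P.comap ((TensorProduct.mk ℂ (UniversalEnvelopingAlgebra ℂ q) U).flip u) = ⊤ := by
      refine eq_top_of_mul_mem (adjoin_range_ι q) _ (h1 u) ?_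
      rintro _ ⟨y, rfl⟩ b hb
      exact h y _ hb
    exact Submodule.eq_top_iff'.1 this b

/-- Induction on w for all y at once: pulling z out of z w produces the bracket of z with y, so the
hypothesis is needed at that bracket as well as at y. -/
theorem triAct_q (y : q) (w : TriMod q U) : triAct p hpq ρ (y : L) w = triLeft q U y w := by
  suffices H : ∀ w : TriMod q U, w ∈ (⨅ y : q,
      LinearMap.eqLocus (triAct p hpq ρ (y : L)) (triLeft q U y)) from
    (Submodule.mem_iInf _).1 (H w) y
  refine tri_induction (fun u => (Submodule.mem_iInf _).2 fun y => ?_)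
    (fun z w hw => (Submodule.mem_iInf _).2 fun y => ?_)
  · rw [LinearMap.mem_eqLocus, triAct_one, triInit_q, triLeft_tmul, mul_one]
  · have hw' := fun y => (Submodule.mem_iInf _).1 hw y
    simp only [LinearMap.mem_eqLocus] at hw' ⊢
    rw [triAct_mul, hw', ← LieSubalgebra.coe_bracket, hw', triLeft_lie]
    simp only [LinearMap.sub_apply, Module.End.mul_apply]
    abel

theorem triAct_lie_q (x : L) (y : q) (w : TriMod q U) : triAct p hpq ρ ⁅x, (y : L)⁆ w =
    triAct p hpq ρ x (triAct p hpq ρ (y : L) w) - triAct p hpq ρ (y : L) (triAct p hpq ρ x w) := by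
  rw [triAct_q, triAct_q, triAct_mul, ← lie_skew, map_neg, LinearMap.neg_apply]
  abel

/-- On 1 ⊗ u both arguments are split along 𝔮 ⊕ 𝔭. Pairs involving 𝔮 are covered by the recursion,
and pairs in 𝔭 by ρ being a representation. The step from w to y w is the Jacobi identity, using the
claim for w at ([y, x], x'), (x, [y, x']) and (x, x'). -/
theorem triAct_lie (x x' : L) (w : TriMod q U) : triAct p hpq ρ ⁅x, x'⁆ w =
    triAct p hpq ρ x (triAct p hpq ρ x' w) - triAct p hpq ρ x' (triAct p hpq ρ x w) := by
  suffices H : ∀ w : TriMod q U, w ∈ (⨅ x : L, ⨅ x' : L,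
      LinearMap.eqLocus (triAct p hpq ρ ⁅x, x'⁆)
        (triAct p hpq ρ x * triAct p hpq ρ x' - triAct p hpq ρ x' * triAct p hpq ρ x)) from
    (Submodule.mem_iInf _).1 ((Submodule.mem_iInf _).1 (H w) x) x'
  have split : ∀ x : L, ∃ (y : q) (z : p), x = y + z := fun x => by
    have : x ∈ q.toSubmodule ⊔ p.toSubmodule := by rw [hpq.sup_eq_top]; trivial
    obtain ⟨y, hy, z, hz, h⟩ := Submodule.mem_sup.1 this
    exact ⟨⟨y, hy⟩, ⟨z, hz⟩, h.symm⟩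
  refine tri_induction (fun u => ?_) (fun y w hw => ?_)
  · simp only [Submodule.mem_iInf, LinearMap.mem_eqLocus, LinearMap.sub_apply,
      Module.End.mul_apply]
    intro x x'
    obtain ⟨y, z, rfl⟩ := split x
    obtain ⟨y', z', rfl⟩ := split x'
    have e1 := triAct_lie_q p hpq ρ y y' (1 ⊗ₜ u)
    have e2 := triAct_lie_q p hpq ρ z y' (1 ⊗ₜ u)
    have e3 := triAct_lie_q p hpq ρ z' y (1 ⊗ₜ u)
    rw [← lie_skew, map_neg, LinearMap.neg_apply] at e3
    have e4 : triAct p hpq ρ ⁅(z : L), (z' : L)⁆ (1 ⊗ₜ u) =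
        triAct p hpq ρ z (triAct p hpq ρ z' (1 ⊗ₜ u)) -
          triAct p hpq ρ z' (triAct p hpq ρ z (1 ⊗ₜ u)) := by
      simp only [triAct_one, triInit_p, ← LieSubalgebra.coe_bracket, LieHom.map_lie, Ring.lie_def,
        LinearMap.sub_apply, Module.End.mul_apply, TensorProduct.tmul_sub]
    rw [add_lie, lie_add, lie_add]
    simp only [map_add, LinearMap.add_apply]
    rw [e1, e2, e4, neg_eq_iff_eq_neg.1 e3]
    abel
  · simp only [Submodule.mem_iInf, LinearMap.mem_eqLocus, LinearMap.sub_apply,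
      Module.End.mul_apply] at hw ⊢
    intro x x'
    rw [triAct_mul, leibniz_lie, map_add, LinearMap.add_apply, hw ⁅(y : L), x⁆ x',
      hw x ⁅(y : L), x'⁆, hw x x', triAct_mul p hpq ρ x' y w, triAct_mul p hpq ρ x y w]
    simp only [map_sub, triAct_mul]
    abel

/-- The action of `L` on `U(𝔮) ⊗ U`. -/
def triRep : L →ₗ⁅ℂ⁆ Module.End ℂ (TriMod q U) where
  __ := triAct p hpq ρ
  map_lie' {x x'} := LinearMap.ext fun w => triAct_lie p hpq ρ x x' w

end Decomposition


/-! ### The decomposition of the affine Lie algebra -/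

/-- The coefficient at `t^i` of an element of `ŝl_m`. -/
def coeffAt (m : ℕ) (i : ℤ) : Affine m →ₗ[ℂ] sl m :=
  Finsupp.lapply i ∘ₗ (LieAlgebra.LoopAlgebra.toFinsupp ℂ ℤ (sl m)).toLinearMap ∘ₗ
    (loopPart m : Affine m →ₗ[ℂ] Loop m)

theorem coeffAt_current {m : ℕ} (i j : ℤ) (X : sl m) :
    coeffAt m i (current j X) = if j = i then X else 0 := by
  change LieAlgebra.LoopAlgebra.toFinsupp ℂ ℤ (sl m) (AddMonoidAlgebra.single j 1 ⊗ₜ[ℂ] X) i = _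
  rw [LieAlgebra.LoopAlgebra.toFinsupp_single_tmul, Finsupp.single_apply]

theorem coeffAt_central (m : ℕ) (i : ℤ) : coeffAt m i (central m) = 0 := by
  change LieAlgebra.LoopAlgebra.toFinsupp ℂ ℤ (sl m) 0 i = _
  simp

theorem affine_eq_zero {m : ℕ} {ξ : Affine m} (h : ∀ i, coeffAt m i ξ = 0)
    (hC : coeffCentral m ξ = 0) : ξ = 0 := by
  have h1 : ((LieAlgebra.ofProd (affineCocycle m)).symm ξ).1 = 0 :=
    (LieAlgebra.LoopAlgebra.toFinsupp ℂ ℤ (sl m)).map_eq_zero_iff.1 (Finsupp.ext h)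
  have h2 : ((LieAlgebra.ofProd (affineCocycle m)).symm ξ).2 = 0 :=
    (TrivialLieModule.equiv ℂ (Loop m) ℂ).map_eq_zero_iff.1 hC
  exact congrArg (LieAlgebra.ofProd (affineCocycle m)) (Prod.ext h1 h2)

theorem affine_eq_top {m : ℕ} {S : Submodule ℂ (Affine m)} (h : ∀ i X, current i X ∈ S)
    (hC : central m ∈ S) : S = ⊤ := by
  let inl : Loop m →ₗ[ℂ] Affine m :=
    { toFun := fun l => LieAlgebra.ofProd (affineCocycle m) (l, 0)
      map_add' := fun l l' => congrArg (LieAlgebra.ofProd (affineCocycle m))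
        (Prod.ext rfl (add_zero _).symm)
      map_smul' := fun c l => congrArg (LieAlgebra.ofProd (affineCocycle m))
        (Prod.ext rfl (smul_zero c).symm) }
  have hl : ∀ l : Loop m, inl l ∈ S := fun l => by
    induction l using TensorProduct.induction_on with
    | zero => rw [map_zero]; exact zero_mem S
    | add l l' h h' => rw [map_add]; exact add_mem h h'
    | tmul f X =>
      have : S.comap (inl ∘ₗ (TensorProduct.mk ℂ (AddMonoidAlgebra ℂ ℤ) (sl m)).flip X) = ⊤ := by
        rw [eq_top_iff, ← (AddMonoidAlgebra.basis ℤ ℂ).span_eq, Submodule.span_le]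
        rintro _ ⟨i, rfl⟩
        rw [AddMonoidAlgebra.basis_apply]
        exact h i X
      exact Submodule.eq_top_iff'.1 this f
  refine Submodule.eq_top_iff'.2 fun ξ => ?_
  have : ξ = inl (loopPart m ξ) + coeffCentral m ξ • central m := by
    refine congrArg (LieAlgebra.ofProd (affineCocycle m)) (Prod.ext ?_ ?_)
    · change _ = loopPart m ξ + coeffCentral m ξ • (0 : Loop m)
      rw [smul_zero, add_zero]
      rfl
    · change _ = 0 + coeffCentral m ξ • (TrivialLieModule.equiv ℂ (Loop m) ℂ).symm 1
      rw [zero_add, ← map_smul, smul_eq_mul, mul_one]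
      exact ((TrivialLieModule.equiv ℂ (Loop m) ℂ).symm_apply_apply _).symm
  rw [this]
  exact add_mem (hl _) (S.smul_mem _ hC)

theorem current_mem_pSub {m : ℕ} {i : ℤ} (hi : 0 ≤ i) (X : sl m) : current i X ∈ pSub m :=
  Submodule.subset_span (Or.inl ⟨i, X, hi, rfl⟩)

theorem central_mem_pSub (m : ℕ) : central m ∈ pSub m := Submodule.subset_span (Or.inr rfl)

theorem current_mem_qSub {m : ℕ} {i : ℤ} (hi : i < 0) (X : sl m) : current i X ∈ qSub m :=
  Submodule.subset_span ⟨i, X, hi, rfl⟩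

/-- Coefficients separate the two summands: those at negative powers of t vanish on 𝔭, while those
at nonnegative powers and at C vanish on 𝔮. -/
theorem qSub_isCompl_pSub (m : ℕ) : IsCompl (qSub m).toSubmodule (pSub m).toSubmodule := by
  constructor
  · rw [Submodule.disjoint_def]
    intro ξ hq hp
    have hp' : ∀ i < 0, (pSub m).toSubmodule ≤ LinearMap.ker (coeffAt m i) := fun i hi => by
      refine Submodule.span_le.2 ?_
      rintro _ (⟨j, X, hj, rfl⟩ | rfl)
      · rw [SetLike.mem_coe, LinearMap.mem_ker, coeffAt_current, if_neg (by omega)]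
      · exact coeffAt_central m i
    have hq' : ∀ i, 0 ≤ i → (qSub m).toSubmodule ≤ LinearMap.ker (coeffAt m i) := fun i hi => by
      refine Submodule.span_le.2 ?_
      rintro _ ⟨j, X, hj, rfl⟩
      rw [SetLike.mem_coe, LinearMap.mem_ker, coeffAt_current, if_neg (by omega)]
    have hC : (qSub m).toSubmodule ≤ LinearMap.ker (coeffCentral m) := by
      refine Submodule.span_le.2 ?_
      rintro _ ⟨j, X, hj, rfl⟩
      exact coeffCentral_current j X
    refine affine_eq_zero (fun i => ?_) (hC hq)
    rcases lt_or_ge i 0 with hi | hi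
    · exact hp' i hi hp
    · exact hq' i hi hq
  · rw [codisjoint_iff]
    refine affine_eq_top (fun i X => ?_) (Submodule.mem_sup_right (central_mem_pSub m))
    rcases lt_or_ge i 0 with hi | hi
    · exact Submodule.mem_sup_left (current_mem_qSub hi X)
    · exact Submodule.mem_sup_right (current_mem_pSub hi X)

/-! ### The parabolically induced module -/

section ParabolicInduction

variable (m : ℕ) (ℓ : ℂ) (U : Type*) [AddCommGroup U] [Module ℂ U] [LieRingModule (sl m) U]
  [LieModule ℂ (sl m) U]

/-- The projection to the induced module. -/
def parMk : UniversalEnvelopingAlgebra ℂ (Affine m) ⊗[ℂ] U →ₗ[ℂ] ParInd m ℓ U :=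
  (indRel (pToAffine m) (UniversalEnvelopingAlgebra.lift ℂ (pRep m ℓ U))).mkQ

theorem parMk_surjective : Function.Surjective (parMk m ℓ U) := Submodule.mkQ_surjective _

/-- The embedding of `U` into the induced module. -/
def vac : U →ₗ[ℂ] ParInd m ℓ U :=
  parMk m ℓ U ∘ₗ TensorProduct.mk ℂ (UniversalEnvelopingAlgebra ℂ (Affine m)) U 1

variable {m ℓ U}

theorem lie_vac {ξ : Affine m} (hξ : ξ ∈ pSub m) (u : U) :
    ⁅ξ, vac m ℓ U u⁆ = vac m ℓ U (pAct m ℓ U ξ u) := by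
  refine (Submodule.Quotient.eq _).2 (Submodule.subset_span
    ⟨1, UniversalEnvelopingAlgebra.ι ℂ (⟨ξ, hξ⟩ : pSub m), u, ?_⟩)
  have h1 : pToAffine m (UniversalEnvelopingAlgebra.ι ℂ (⟨ξ, hξ⟩ : pSub m)) =
      UniversalEnvelopingAlgebra.ι ℂ ξ := UniversalEnvelopingAlgebra.lift_ι_apply ℂ _ _
  have h2 : UniversalEnvelopingAlgebra.lift ℂ (pRep m ℓ U)
      (UniversalEnvelopingAlgebra.ι ℂ (⟨ξ, hξ⟩ : pSub m)) = pAct m ℓ U ξ :=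
    UniversalEnvelopingAlgebra.lift_ι_apply ℂ _ _
  rw [h1, h2, one_mul]
  change (UniversalEnvelopingAlgebra.ι ℂ ξ * 1) ⊗ₜ u - _ = _
  rw [mul_one]
  rfl

theorem current_lie_vac_pos {i : ℤ} (hi : 0 < i) (X : sl m) (u : U) :
    ⁅current i X, vac m ℓ U u⁆ = 0 := by
  rw [lie_vac (current_mem_pSub hi.le X), pAct_current, if_neg hi.ne', LinearMap.zero_apply,
    map_zero]

theorem current_zero_lie_vac (X : sl m) (u : U) :
    ⁅current 0 X, vac m ℓ U u⁆ = vac m ℓ U ⁅X, u⁆ := by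
  rw [lie_vac (current_mem_pSub le_rfl X), pAct_current, if_pos rfl, LieModule.toEnd_apply_apply]

theorem parInd_induction {S : Submodule ℂ (ParInd m ℓ U)} (hvac : ∀ u, vac m ℓ U u ∈ S)
    (h : ∀ (ξ : Affine m), ∀ v ∈ S, ⁅ξ, v⁆ ∈ S) (v : ParInd m ℓ U) : v ∈ S := by
  obtain ⟨y, rfl⟩ := parMk_surjective m ℓ U v
  induction y using TensorProduct.induction_on with
  | zero => rw [map_zero]; exact zero_mem S
  | add y y' hy hy' => rw [map_add]; exact add_mem hy hy'
  | tmul b u =>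
    have key : S.comap (parMk m ℓ U ∘ₗ (TensorProduct.mk ℂ _ U).flip u) = ⊤ := by
      refine eq_top_of_mul_mem (adjoin_range_ι (Affine m)) _ (hvac u) ?_
      rintro _ ⟨ξ, rfl⟩ b hb
      exact h ξ _ hb
    exact Submodule.eq_top_iff'.1 key b

theorem central_lie_parInd (v : ParInd m ℓ U) : ⁅central m, v⁆ = ℓ • v := by
  suffices H : v ∈ LinearMap.eqLocus (LieModule.toEnd ℂ (Affine m) (ParInd m ℓ U) (central m))
      (ℓ • LinearMap.id) from H
  refine parInd_induction (fun u => ?_) (fun ξ v hv => ?_) v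
  · rw [LinearMap.mem_eqLocus, LieModule.toEnd_apply_apply, lie_vac (central_mem_pSub m),
      pAct_central]
    simp
  · rw [LinearMap.mem_eqLocus, LieModule.toEnd_apply_apply] at hv ⊢
    rw [leibniz_lie, central_lie, zero_lie, zero_add, hv]
    simp

theorem parInd_isSmooth : IsSmooth m (ParInd m ℓ U) := by
  let S : Submodule ℂ (ParInd m ℓ U) :=
    { carrier := {v | ∃ i : ℤ, ∀ j, i ≤ j → ∀ X : sl m, ⁅(current j X : Affine m), v⁆ = 0}
      add_mem' := by
        rintro v v' ⟨i, h⟩ ⟨i', h'⟩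
        refine ⟨max i i', fun j hj X => ?_⟩
        rw [lie_add, h j (le_trans (le_max_left _ _) hj), h' j (le_trans (le_max_right _ _) hj),
          add_zero]
      zero_mem' := ⟨0, fun j _ X => lie_zero _⟩
      smul_mem' := by
        rintro c v ⟨i, h⟩
        exact ⟨i, fun j hj X => by rw [lie_smul, h j hj, smul_zero]⟩ }
  refine fun v => parInd_induction (S := S) (fun u => ⟨1, fun j hj X => ?_⟩) ?_ v
  · exact current_lie_vac_pos (by omega) X u
  · intro ξ v hv
    have : S.comap ((LieModule.toEnd ℂ (Affine m) (ParInd m ℓ U)).toLinearMap.flip v) = ⊤ := by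
      obtain ⟨i, hi⟩ := hv
      -- With t^j v = 0 for j ≥ i, the bound for Y t^k v has three parts: j ≥ i removes the term
      -- with t^j on v, j ≥ i − k removes the current t^{j+k}, and j ≥ 1 − k excludes j = −k, hence
      -- the central term.
      refine affine_eq_top (fun k Y => ⟨max i (max (i - k) (1 - k)), fun j hj X => ?_⟩)
        ⟨i, fun j hj X => ?_⟩
      · change ⁅current j X, ⁅current k Y, v⁆⁆ = 0
        rw [leibniz_lie, current_lie_current, if_neg (by omega), zero_smul, add_zero,
          hi _ (by omega), hi _ (by omega), lie_zero, add_zero]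
      · change ⁅current j X, ⁅central m, v⁆⁆ = 0
        rw [central_lie_parInd, lie_smul, hi j hj, smul_zero]
    exact Submodule.eq_top_iff'.1 this ξ

/-- The universal property of the induced module. -/
def parIndLift {W : Type*} [AddCommGroup W] [Module ℂ W] (ρ : Affine m →ₗ⁅ℂ⁆ Module.End ℂ W)
    (j : U →ₗ[ℂ] W) (h : ∀ ξ ∈ pSub m, ∀ u, ρ ξ (j u) = j (pAct m ℓ U ξ u)) :
    ParInd m ℓ U →ₗ[ℂ] W :=
  Submodule.liftQ _ (TensorProduct.lift
    ((UniversalEnvelopingAlgebra.lift ℂ ρ).toLinearMap.compl₂ j)) (by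
    refine Submodule.span_le.2 ?_
    rintro _ ⟨b, a, u, rfl⟩
    rw [SetLike.mem_coe, LinearMap.mem_ker, map_sub, sub_eq_zero]
    change UniversalEnvelopingAlgebra.lift ℂ ρ (b * pToAffine m a) (j u) =
      UniversalEnvelopingAlgebra.lift ℂ ρ b (j _)
    rw [map_mul, Module.End.mul_apply]
    congr 1
    -- Equivariance under 𝔭 extends to U(𝔭) by induction on products of generators. The intersection
    -- over all u is needed because a product ξ b sends u to ξ applied to another vector of U.
    have key : ⨅ u, LinearMap.eqLocus
        ((((UniversalEnvelopingAlgebra.lift ℂ ρ).comp (pToAffine m)).toLinearMap).flip (j u))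
        (j ∘ₗ ((UniversalEnvelopingAlgebra.lift ℂ (pRep m ℓ U)).toLinearMap).flip u) = ⊤ := by
      refine eq_top_of_mul_mem (adjoin_range_ι (pSub m)) _ ?_ ?_
      · simp only [Submodule.mem_iInf, LinearMap.mem_eqLocus]
        intro u
        change UniversalEnvelopingAlgebra.lift ℂ ρ (pToAffine m 1) (j u) =
          j (UniversalEnvelopingAlgebra.lift ℂ (pRep m ℓ U) 1 u)
        rw [map_one, map_one, map_one, Module.End.one_apply, Module.End.one_apply]
      · rintro _ ⟨ξ, rfl⟩ b hb
        simp only [Submodule.mem_iInf, LinearMap.mem_eqLocus] at hb ⊢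
        intro u
        have hb' : UniversalEnvelopingAlgebra.lift ℂ ρ (pToAffine m b) (j u) =
          j (UniversalEnvelopingAlgebra.lift ℂ (pRep m ℓ U) b u) := hb u
        have h1 : pToAffine m (UniversalEnvelopingAlgebra.ι ℂ ξ) =
            UniversalEnvelopingAlgebra.ι ℂ (ξ : Affine m) :=
          UniversalEnvelopingAlgebra.lift_ι_apply ℂ _ _
        change UniversalEnvelopingAlgebra.lift ℂ ρ
            (pToAffine m (UniversalEnvelopingAlgebra.ι ℂ ξ * b)) (j u) =
          j (UniversalEnvelopingAlgebra.lift ℂ (pRep m ℓ U)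
            (UniversalEnvelopingAlgebra.ι ℂ ξ * b) u)
        rw [map_mul, map_mul, map_mul, Module.End.mul_apply, Module.End.mul_apply, hb', h1,
          UniversalEnvelopingAlgebra.lift_ι_apply, UniversalEnvelopingAlgebra.lift_ι_apply,
          h _ ξ.2]
        rfl
    exact (Submodule.mem_iInf _).1 (Submodule.eq_top_iff'.1 key a) u)

theorem parIndLift_vac {W : Type*} [AddCommGroup W] [Module ℂ W]
    (ρ : Affine m →ₗ⁅ℂ⁆ Module.End ℂ W) (j : U →ₗ[ℂ] W)
    (h : ∀ ξ ∈ pSub m, ∀ u, ρ ξ (j u) = j (pAct m ℓ U ξ u)) (u : U) :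
    parIndLift ρ j h (vac m ℓ U u) = j u := by
  change UniversalEnvelopingAlgebra.lift ℂ ρ 1 (j u) = j u
  rw [map_one, Module.End.one_apply]

theorem parIndLift_lie {W : Type*} [AddCommGroup W] [Module ℂ W]
    (ρ : Affine m →ₗ⁅ℂ⁆ Module.End ℂ W) (j : U →ₗ[ℂ] W)
    (h : ∀ ξ ∈ pSub m, ∀ u, ρ ξ (j u) = j (pAct m ℓ U ξ u)) (ξ : Affine m) (v : ParInd m ℓ U) :
    parIndLift ρ j h ⁅ξ, v⁆ = ρ ξ (parIndLift ρ j h v) := by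
  obtain ⟨y, rfl⟩ := parMk_surjective m ℓ U v
  induction y using TensorProduct.induction_on with
  | zero => rw [map_zero, lie_zero, map_zero, map_zero]
  | add y y' hy hy' => rw [map_add, lie_add, map_add, map_add, map_add, hy, hy']
  | tmul b u =>
    change UniversalEnvelopingAlgebra.lift ℂ ρ (UniversalEnvelopingAlgebra.ι ℂ ξ * b) (j u) =
      ρ ξ (UniversalEnvelopingAlgebra.lift ℂ ρ b (j u))
    rw [map_mul, UniversalEnvelopingAlgebra.lift_ι_apply, Module.End.mul_apply]

variable (m ℓ U)

/-- The triangular model `U(𝔮) ⊗ U` of the induced module. -/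
def triOfParInd : ParInd m ℓ U →ₗ[ℂ] TriMod (qSub m) U :=
  parIndLift (triRep (pSub m) (qSub_isCompl_pSub m) (pRep m ℓ U))
    (TensorProduct.mk ℂ (UniversalEnvelopingAlgebra ℂ (qSub m)) U 1) (fun ξ hξ u =>
      (triAct_one _ _ _ ξ u).trans (triInit_p _ _ _ u ⟨ξ, hξ⟩))

theorem triOfParInd_vac (u : U) : triOfParInd m ℓ U (vac m ℓ U u) = 1 ⊗ₜ u :=
  parIndLift_vac _ _ _ u

theorem triOfParInd_lie (y : qSub m) (v : ParInd m ℓ U) :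
    triOfParInd m ℓ U ⁅(y : Affine m), v⁆ = triLeft (qSub m) U y (triOfParInd m ℓ U v) :=
  (parIndLift_lie _ _ _ (y : Affine m) v).trans (triAct_q _ _ _ y _)

variable {m ℓ U}

/-- The induced module is generated by `U` under the action of `𝔮`. -/
theorem parInd_induction_q {S : Submodule ℂ (ParInd m ℓ U)} (hvac : ∀ u, vac m ℓ U u ∈ S)
    (h : ∀ ξ ∈ qSub m, ∀ v ∈ S, ⁅ξ, v⁆ ∈ S) (v : ParInd m ℓ U) : v ∈ S := by
  -- T is the smallest subspace containing U and stable under 𝔮. To see that the whole algebra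
  -- preserves it, the vectors of T sent into T by every η are shown to have the same two
  -- properties: for ξ in 𝔮, η ξ v = [η, ξ] v + ξ η v, where [η, ξ] is again an arbitrary element
  -- applied to v. Minimality then gives the claim.
  let T := sInf {T : Submodule ℂ (ParInd m ℓ U) | (∀ u, vac m ℓ U u ∈ T) ∧
    ∀ ξ ∈ qSub m, ∀ v ∈ T, ⁅ξ, v⁆ ∈ T}
  have hTvac : ∀ u, vac m ℓ U u ∈ T := fun u => Submodule.mem_sInf.2 fun T' hT' => hT'.1 u
  have hTq : ∀ ξ ∈ qSub m, ∀ v ∈ T, ⁅ξ, v⁆ ∈ T := fun ξ hξ v hv => Submodule.mem_sInf.2 fun T' hT' =>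
    hT'.2 ξ hξ v (Submodule.mem_sInf.1 hv T' hT')
  have split : ∀ x : Affine m, ∃ y ∈ qSub m, ∃ z ∈ pSub m, y + z = x := fun x => by
    refine Submodule.mem_sup.1 ?_
    rw [(qSub_isCompl_pSub m).sup_eq_top]
    trivial
  let T₁ : Submodule ℂ (ParInd m ℓ U) :=
    ⨅ ξ : Affine m, T.comap (LieModule.toEnd ℂ (Affine m) (ParInd m ℓ U) ξ)
  have hT₁ : ∀ v, v ∈ T₁ ↔ ∀ ξ : Affine m, ⁅ξ, v⁆ ∈ T := fun v => Submodule.mem_iInf _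
  have hle : T ≤ T ⊓ T₁ := by
    refine sInf_le ⟨fun u => ⟨hTvac u, (hT₁ _).2 fun ξ => ?_⟩, fun ξ hξ v hv =>
      ⟨hTq ξ hξ v hv.1, (hT₁ _).2 fun η => ?_⟩⟩
    · obtain ⟨y, hy, z, hz, rfl⟩ := split ξ
      rw [add_lie, lie_vac hz]
      exact add_mem (hTq y hy _ (hTvac u)) (hTvac _)
    · rw [leibniz_lie]
      exact add_mem ((hT₁ v).1 hv.2 _) (hTq ξ hξ _ ((hT₁ v).1 hv.2 η))
  have hv : v ∈ T := parInd_induction hTvac (fun ξ v hv => (hT₁ v).1 (hle hv).2 ξ) v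
  exact Submodule.mem_sInf.1 hv S ⟨hvac, h⟩

end ParabolicInduction


/-! ### Operators on Laurent polynomials -/

theorem mono_zero {N : ℕ} : (mono 0 : Laurent N) = 1 := rfl

theorem xpow_zero {N : ℕ} (p : Fin N) : xpow p 0 = 1 := by
  rw [xpow, Pi.single_zero, mono_zero]

theorem xpow_add {N : ℕ} (p : Fin N) (i j : ℤ) : xpow p (i + j) = xpow p i * xpow p j := by
  rw [xpow, xpow, xpow, mono_mul_mono, Pi.single_add]

theorem xpow_mul_neg {N : ℕ} (p : Fin N) (i : ℤ) : xpow p i * xpow p (-i) = 1 := by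
  rw [← xpow_add, add_neg_cancel, xpow_zero]

theorem mono_injective {N : ℕ} : Function.Injective (mono : (Fin N → ℤ) → Laurent N) := by
  intro l l' h
  have := congrArg (AddMonoidAlgebra.coeff) h
  simpa [mono, Finsupp.single_left_inj] using this

theorem xpow_sub_ne_zero {N : ℕ} {p r : Fin N} (h : p ≠ r) : xpow p 1 - xpow r 1 ≠ 0 := by
  intro h0
  have h1 := congrFun (mono_injective (sub_eq_zero.1 h0)) p
  simp [h] at h1

/-- Laurent polynomials form a domain, so identities for divided differences may be checked after
multiplication by x_p − x_r. This replaces the monomial formula for `dunkl` by its characterization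
`sub_mul_dunkl` everywhere below. -/
theorem eq_of_sub_mul_eq {N : ℕ} {p r : Fin N} (h : p ≠ r) {f g : Laurent N}
    (e : (xpow p 1 - xpow r 1) * f = (xpow p 1 - xpow r 1) * g) : f = g := by
  have h1 : (xpow p 1 - xpow r 1) * (f - g) = 0 := by rw [mul_sub, e, sub_self]
  rcases mul_eq_zero.1 h1 with h1 | h1
  · exact absurd h1 (xpow_sub_ne_zero h)
  · exact sub_eq_zero.1 h1

theorem permL_one {N : ℕ} : (permL (1 : Equiv.Perm (Fin N))).toLinearMap = 1 :=
  linearMap_ext_mono fun l => permL_mono 1 l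

theorem permL_mul {N : ℕ} (σ τ : Equiv.Perm (Fin N)) :
    (permL (σ * τ)).toLinearMap = (permL σ).toLinearMap * (permL τ).toLinearMap :=
  linearMap_ext_mono fun l => by
    change permL (σ * τ) (mono l) = permL σ (permL τ (mono l))
    rw [permL_mono, permL_mono, permL_mono]
    rfl

theorem permL_mul_mulLeft {N : ℕ} (σ : Equiv.Perm (Fin N)) (f : Laurent N) :
    (permL σ).toLinearMap * LinearMap.mulLeft ℂ f =
      LinearMap.mulLeft ℂ (permL σ f) * (permL σ).toLinearMap :=
  LinearMap.ext fun g => map_mul (permL σ) f g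

theorem euler_mono {N : ℕ} (p : Fin N) (l : Fin N → ℤ) : euler p (mono l) = (l p : ℂ) • mono l :=
  onMono_mono _ l

theorem euler_one {N : ℕ} (p : Fin N) : euler p (1 : Laurent N) = 0 := by
  rw [← mono_zero, euler_mono]; simp

theorem euler_xpow {N : ℕ} (p q : Fin N) (i : ℤ) :
    euler p (xpow q i) = (if p = q then (i : ℂ) else 0) • xpow q i := by
  rw [xpow, euler_mono, Pi.single_apply]
  split_ifs <;> simp

theorem euler_mul_mulLeft {N : ℕ} (p : Fin N) (l : Fin N → ℤ) :
    euler p * LinearMap.mulLeft ℂ (mono l) =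
      LinearMap.mulLeft ℂ (mono l) * euler p + (l p : ℂ) • LinearMap.mulLeft ℂ (mono l) :=
  linearMap_ext_mono fun l' => by
    change euler p (mono l * mono l') = mono l * euler p (mono l') + (l p : ℂ) • (mono l * mono l')
    rw [mono_mul_mono, euler_mono, euler_mono, mul_smul_comm, mono_mul_mono, ← add_smul]
    congr 1
    push_cast [Pi.add_apply]
    ring

theorem permL_mul_euler {N : ℕ} (σ : Equiv.Perm (Fin N)) (p : Fin N) :
    (permL σ).toLinearMap * euler p = euler (σ p) * (permL σ).toLinearMap :=
  linearMap_ext_mono fun l => by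
    change permL σ (euler p (mono l)) = euler (σ p) (permL σ (mono l))
    rw [euler_mono, map_smul, permL_mono, euler_mono]
    simp

theorem dunkl_one {N : ℕ} {p r : Fin N} (h : p ≠ r) : dunkl p r (1 : Laurent N) = 0 :=
  eq_of_sub_mul_eq h (by rw [sub_mul_dunkl h, map_one, sub_self, mul_zero, mul_zero])

/-- The twisted Leibniz rule of a divided difference: with s = σ_pr, fg − s(f)s(g) = f(g − s(g)) +
(f − s(f))s(g). All relations between z_p and Laurent polynomials come from it. -/
theorem dunkl_mul {N : ℕ} {p r : Fin N} (h : p ≠ r) (f g : Laurent N) :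
    dunkl p r (f * g) = f * dunkl p r g + dunkl p r f * permL (Equiv.swap p r) g := by
  refine eq_of_sub_mul_eq h ?_
  have h1 := sub_mul_dunkl h f
  have h2 := sub_mul_dunkl h g
  rw [sub_mul_dunkl h, map_mul, mul_add]
  linear_combination (-f) * h2 - permL (Equiv.swap p r) g * h1

theorem dunkl_mul_mulLeft {N : ℕ} {p r : Fin N} (h : p ≠ r) (f : Laurent N) :
    dunkl p r * LinearMap.mulLeft ℂ f = LinearMap.mulLeft ℂ f * dunkl p r +
      LinearMap.mulLeft ℂ (dunkl p r f) * (permL (Equiv.swap p r)).toLinearMap :=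
  LinearMap.ext fun g => dunkl_mul h f g

theorem dunkl_xpow_left {N : ℕ} {p r : Fin N} (h : p ≠ r) : dunkl p r (xpow p 1) = xpow p 1 :=
  eq_of_sub_mul_eq h (by
    rw [sub_mul_dunkl h, permL_xpow, Equiv.swap_apply_left]; ring)

theorem dunkl_xpow_right {N : ℕ} {p r : Fin N} (h : p ≠ r) : dunkl p r (xpow r 1) = -xpow p 1 :=
  eq_of_sub_mul_eq h (by
    rw [sub_mul_dunkl h, permL_xpow, Equiv.swap_apply_right]; ring)

theorem dunkl_xpow_of_ne {N : ℕ} {p r q : Fin N} (h : p ≠ r) (hp : q ≠ p) (hr : q ≠ r) (i : ℤ) :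
    dunkl p r (xpow q i) = 0 :=
  eq_of_sub_mul_eq h (by
    rw [sub_mul_dunkl h, permL_xpow, Equiv.swap_apply_of_ne_of_ne hp hr]; ring)

theorem permL_mul_dunkl {N : ℕ} (σ : Equiv.Perm (Fin N)) {p r : Fin N} (h : p ≠ r) :
    (permL σ).toLinearMap * dunkl p r = dunkl (σ p) (σ r) * (permL σ).toLinearMap :=
  LinearMap.ext fun f => by
    change permL σ (dunkl p r f) = dunkl (σ p) (σ r) (permL σ f)
    have hσ : σ p ≠ σ r := σ.injective.ne h
    refine eq_of_sub_mul_eq hσ ?_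
    have h1 : permL (Equiv.swap (σ p) (σ r)) (permL σ f) = permL σ (permL (Equiv.swap p r) f) := by
      have e1 := LinearMap.congr_fun (permL_mul (Equiv.swap (σ p) (σ r)) σ) f
      have e2 := LinearMap.congr_fun (permL_mul σ (Equiv.swap p r)) f
      rw [Equiv.swap_apply_apply, inv_mul_cancel_right] at e1
      rw [Equiv.swap_apply_apply]
      exact e1.symm.trans e2
    rw [sub_mul_dunkl hσ, h1, ← permL_xpow, ← permL_xpow, ← map_sub, ← map_mul, sub_mul_dunkl h,
      ← map_sub, ← map_mul]

/-- The sum of the monomials `x_r^{-(k+1)} x_p^{-l}` with `k + l + 1 = n`. -/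
def negSum {N : ℕ} (p r : Fin N) (n : ℕ) : Laurent N :=
  ∑ k ∈ Finset.range n, xpow r (-((k : ℤ) + 1)) * xpow p (-((n : ℤ) - 1 - k))

theorem sub_mul_negSum {N : ℕ} (p r : Fin N) (n : ℕ) :
    (xpow p 1 - xpow r 1) * negSum p r n = xpow p 1 * (xpow r (-n) - xpow p (-n)) := by
  have key := Finset.sum_range_sub
    (fun k : ℕ => xpow r (-(k : ℤ)) * xpow p (-((n : ℤ) - 1 - k))) n
  -- Boundary terms of the telescoping sum: the exponent of x_p is 1 at k = n and 1 − n at k = 0, so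
  -- both contain the factor x_p that is split off.
  have e0 : xpow r (-(n : ℤ)) * xpow p (-((n : ℤ) - 1 - n)) -
      xpow r (-((0 : ℕ) : ℤ)) * xpow p (-((n : ℤ) - 1 - (0 : ℕ))) =
      xpow p 1 * (xpow r (-n) - xpow p (-n)) := by
    rw [mul_sub, ← xpow_add, Nat.cast_zero, neg_zero, xpow_zero, one_mul, mul_comm]
    congr 2 <;> ring_nf
  rw [← e0, ← key, negSum, Finset.mul_sum]
  refine Finset.sum_congr rfl fun k _ => ?_
  have e1 : -((n : ℤ) - 1 - ((k + 1 : ℕ) : ℤ)) = 1 + -((n : ℤ) - 1 - k) := by push_cast; ring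
  have e2 : -(k : ℤ) = 1 + -((k : ℤ) + 1) := by ring
  rw [e1, e2, xpow_add p, xpow_add r, Nat.cast_add, Nat.cast_one]
  ring

theorem dunkl_xpow_right_neg {N : ℕ} {p r : Fin N} (h : p ≠ r) (n : ℕ) :
    dunkl p r (xpow r (-n)) = negSum p r n :=
  eq_of_sub_mul_eq h (by
    rw [sub_mul_dunkl h, permL_xpow, Equiv.swap_apply_right, sub_mul_negSum])

theorem dunkl_xpow_left_neg {N : ℕ} {p r : Fin N} (h : p ≠ r) (n : ℕ) :
    dunkl p r (xpow p (-n)) = -negSum p r n :=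
  eq_of_sub_mul_eq h (by
    rw [sub_mul_dunkl h, permL_xpow, Equiv.swap_apply_left, mul_neg, sub_mul_negSum]; ring)

/-! ### Operators on tensor powers -/

/-- The pure tensor. -/
def tpure {m N : ℕ} : MultilinearMap ℂ (fun _ : Fin N => Fin m → ℂ) (TPow m N) :=
  PiTensorProduct.tprod ℂ

theorem TPow.hom_ext {m N : ℕ} {P : Type*} [AddCommGroup P] [Module ℂ P]
    {f g : TPow m N →ₗ[ℂ] P} (h : ∀ v, f (tpure v) = g (tpure v)) : f = g :=
  PiTensorProduct.ext (MultilinearMap.ext h)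

theorem site_tpure {m N : ℕ} (q : Fin N) (X : Matrix (Fin m) (Fin m) ℂ) (v : Fin N → Fin m → ℂ) :
    site q X (tpure v) = tpure (Function.update v q (X.mulVec (v q))) := by
  refine (PiTensorProduct.map_tprod _ _).trans (congrArg (PiTensorProduct.tprod ℂ) ?_)
  funext s
  by_cases hs : s = q
  · subst hs; simp
  · simp [hs]

theorem permT_tpure {m N : ℕ} (σ : Equiv.Perm (Fin N)) (v : Fin N → Fin m → ℂ) :
    permT σ (tpure v) = tpure (v ∘ σ.symm) :=
  PiTensorProduct.reindex_tprod σ v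

theorem permT_one {m N : ℕ} : (permT 1 : Module.End ℂ (TPow m N)) = 1 :=
  TPow.hom_ext fun v => permT_tpure 1 v

theorem permT_mul {m N : ℕ} (σ τ : Equiv.Perm (Fin N)) :
    (permT (σ * τ) : Module.End ℂ (TPow m N)) = permT σ * permT τ :=
  TPow.hom_ext fun v => by
    rw [Module.End.mul_apply, permT_tpure, permT_tpure, permT_tpure]
    rfl

theorem permT_mul_site {m N : ℕ} (σ : Equiv.Perm (Fin N)) (q : Fin N)
    (X : Matrix (Fin m) (Fin m) ℂ) :
    (permT σ * site q X : Module.End ℂ (TPow m N)) = site (σ q) X * permT σ :=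
  TPow.hom_ext fun v => by
    rw [Module.End.mul_apply, Module.End.mul_apply, site_tpure, permT_tpure, permT_tpure,
      site_tpure]
    congr 1
    funext s
    by_cases hs : s = σ q
    · subst hs; simp
    · have : σ.symm s ≠ q := fun h => hs (by rw [← h, Equiv.apply_symm_apply])
      simp [hs, this]

/-- The flip of ℂ^m ⊗ ℂ^m is the Casimir tensor of gl_m. This is what makes the Yang-Baxter equation
into a relation with permutations. -/
theorem permT_swap {m N : ℕ} {p q : Fin N} (h : p ≠ q) :
    (permT (Equiv.swap p q) : Module.End ℂ (TPow m N)) =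
      ∑ a, ∑ b, site p (Matrix.single a b 1) * site q (Matrix.single b a 1) :=
  TPow.hom_ext fun v => by
    have e : ∀ (w : Fin m → ℂ), w = ∑ a, w a • (Pi.single a 1 : Fin m → ℂ) := fun w => by
      simpa using (pi_eq_sum_univ' w)
    have hs : v ∘ (Equiv.swap p q).symm = Function.update (Function.update v q (v p)) p (v q) := by
      funext s
      by_cases h1 : s = p
      · subst h1; simp
      · by_cases h2 : s = q
        · subst h2; simp [h1]
        · simp [h1, h2, Equiv.swap_apply_of_ne_of_ne]
    have hE : ∀ (a b : Fin m) (w : Fin m → ℂ),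
        (Matrix.single a b (1 : ℂ)).mulVec w = w b • Pi.single a 1 := fun a b w => by
      rw [Matrix.single_mulVec]
      funext c
      simp [Function.update_apply, Pi.single_apply]
    rw [permT_tpure, hs]
    simp only [LinearMap.sum_apply, Module.End.mul_apply, site_tpure, Function.update_of_ne h, hE]
    have l1 : ∀ (w : Fin m → ℂ) (x : Fin N → Fin m → ℂ) (s : Fin N),
        tpure (Function.update x s w) = ∑ a, w a • tpure (Function.update x s (Pi.single a 1)) :=
      fun w x s => by
        conv_lhs => rw [e w]
        rw [MultilinearMap.map_update_sum]
        exact Finset.sum_congr rfl fun a _ => MultilinearMap.map_update_smul _ _ _ _ _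
    rw [l1 (v q)]
    refine Finset.sum_congr rfl fun a _ => ?_
    rw [Function.update_comm h.symm, l1 (v p), Finset.smul_sum]
    refine Finset.sum_congr rfl fun b _ => ?_
    rw [MultilinearMap.map_update_smul, Function.update_comm h, smul_comm]
    conv_rhs => rw [Function.update_comm h.symm, MultilinearMap.map_update_smul]
    rw [Function.update_comm h.symm]

/-! ### Casimir elements -/

/-- The projection of `gl_m` to `sl_m`. -/
def slProj {m : ℕ} (hm : 0 < m) : Matrix (Fin m) (Fin m) ℂ →ₗ[ℂ] sl m where
  toFun X := ⟨X - ((1 / (m : ℂ)) * X.trace) • (1 : Matrix (Fin m) (Fin m) ℂ), by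
    have hm' : (m : ℂ) ≠ 0 := by exact_mod_cast hm.ne'
    change Matrix.trace (_ : Matrix (Fin m) (Fin m) ℂ) = 0
    simp only [Matrix.trace_sub, Matrix.trace_smul, Matrix.trace_one, Fintype.card_fin, smul_eq_mul]
    field_simp
    ring⟩
  map_add' X Y := Subtype.ext (by
    change _ = (X - ((1 / (m : ℂ)) * X.trace) • (1 : Matrix (Fin m) (Fin m) ℂ)) +
      (Y - ((1 / (m : ℂ)) * Y.trace) • (1 : Matrix (Fin m) (Fin m) ℂ))
    simp only [Matrix.trace_add, mul_add, add_smul]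
    abel)
  map_smul' c X := Subtype.ext (by
    simp [smul_sub, smul_smul, mul_left_comm])

theorem slProj_coe {m : ℕ} (hm : 0 < m) (X : Matrix (Fin m) (Fin m) ℂ) :
    (slProj hm X : Matrix (Fin m) (Fin m) ℂ) =
      X - ((1 / (m : ℂ)) * X.trace) • (1 : Matrix (Fin m) (Fin m) ℂ) := rfl

theorem slProj_single {m : ℕ} (hm : 0 < m) (a b : Fin m) :
    slProj hm (Matrix.single a b 1) = slE a b := Subtype.ext (by
  rw [slProj_coe, slE]
  by_cases h : a = b
  · subst h; simp
  · simp [h])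

/-- Scalar matrices are central and commutators are traceless, so removing the trace part is a Lie
homomorphism gl_m → sl_m. Currents can thus be indexed by all matrices, and the matrix units used
freely. -/
theorem slProj_lie {m : ℕ} (hm : 0 < m) (X Y : Matrix (Fin m) (Fin m) ℂ) :
    ⁅slProj hm X, slProj hm Y⁆ = slProj hm (X * Y - Y * X) := Subtype.ext (by
  have h : ∀ A B : sl m, (⁅A, B⁆ : sl m).1 = A.1 * B.1 - B.1 * A.1 := fun A B => rfl
  rw [h, slProj_coe, slProj_coe, slProj_coe, Matrix.trace_sub, Matrix.trace_mul_comm X Y, sub_self,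
    mul_zero, zero_smul, sub_zero]
  simp only [sub_mul, mul_sub, smul_mul_assoc, mul_smul_comm, one_mul, mul_one, smul_sub]
  module)

theorem slProj_val {m : ℕ} (hm : 0 < m) (X : sl m) : slProj hm X.1 = X := Subtype.ext (by
  rw [slProj_coe, sl_trace, mul_zero, zero_smul, sub_zero])

section Casimir

variable {m : ℕ} {A : Type*} [Ring A] [Algebra ℂ A]

theorem mul_single_eq_sum (X : Matrix (Fin m) (Fin m) ℂ) (a b : Fin m) :
    X * Matrix.single a b 1 = ∑ c, X c a • Matrix.single c b (1 : ℂ) := by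
  ext i j
  by_cases h : b = j <;> simp [Matrix.sum_apply, Matrix.mul_apply, Matrix.single_apply, h]

theorem single_mul_eq_sum (X : Matrix (Fin m) (Fin m) ℂ) (a b : Fin m) :
    Matrix.single a b 1 * X = ∑ c, X b c • Matrix.single a c (1 : ℂ) := by
  ext i j
  by_cases h : a = i <;> simp [Matrix.sum_apply, Matrix.mul_apply, Matrix.single_apply, h]

/-- The tensor ∑ E_ab ⊗ E_ba is the canonical element of the trace form, so an operator on the first
slot may be replaced by its adjoint on the second; the adjoint of left multiplication by X is right
multiplication by X. -/
theorem casimir_mul_left {M : Type*} [AddCommGroup M] [Module ℂ M]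
    (B : Matrix (Fin m) (Fin m) ℂ →ₗ[ℂ] Matrix (Fin m) (Fin m) ℂ →ₗ[ℂ] M)
    (X : Matrix (Fin m) (Fin m) ℂ) :
    ∑ a, ∑ b, B (X * Matrix.single a b 1) (Matrix.single b a 1) =
      ∑ a, ∑ b, B (Matrix.single a b 1) (Matrix.single b a 1 * X) := by
  simp only [mul_single_eq_sum, single_mul_eq_sum, map_sum, map_smul, LinearMap.sum_apply,
    LinearMap.smul_apply]
  rw [Finset.sum_comm]
  conv_rhs => rw [Finset.sum_comm]
  refine Finset.sum_congr rfl fun b _ => ?_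
  rw [Finset.sum_comm]

/-- The same principle, for right multiplication by X, whose adjoint is left multiplication. -/
theorem casimir_mul_right {M : Type*} [AddCommGroup M] [Module ℂ M]
    (B : Matrix (Fin m) (Fin m) ℂ →ₗ[ℂ] Matrix (Fin m) (Fin m) ℂ →ₗ[ℂ] M)
    (X : Matrix (Fin m) (Fin m) ℂ) :
    ∑ a, ∑ b, B (Matrix.single a b 1 * X) (Matrix.single b a 1) =
      ∑ a, ∑ b, B (Matrix.single a b 1) (X * Matrix.single b a 1) := by
  simp only [mul_single_eq_sum, single_mul_eq_sum, map_sum, map_smul, LinearMap.sum_apply,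
    LinearMap.smul_apply]
  refine Finset.sum_congr rfl fun b _ => ?_
  rw [Finset.sum_comm]

/-- The element `∑ e(E_ab) φ(E_ba)`. -/
def casimir (e φ : Matrix (Fin m) (Fin m) ℂ →ₗ[ℂ] A) : A :=
  ∑ a, ∑ b, e (Matrix.single a b 1) * φ (Matrix.single b a 1)

/-- The bilinear map `(X, Y) ↦ e(X) φ(Y)`. -/
def prodForm (e φ : Matrix (Fin m) (Fin m) ℂ →ₗ[ℂ] A) :
    Matrix (Fin m) (Fin m) ℂ →ₗ[ℂ] Matrix (Fin m) (Fin m) ℂ →ₗ[ℂ] A :=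
  (LinearMap.mul ℂ A).compl₁₂ e φ

theorem prodForm_apply (e φ : Matrix (Fin m) (Fin m) ℂ →ₗ[ℂ] A) (X Y : Matrix (Fin m) (Fin m) ℂ) :
    prodForm e φ X Y = e X * φ Y := rfl

variable {e e' φ ψ χ : Matrix (Fin m) (Fin m) ℂ →ₗ[ℂ] A}

/-- A normal form for Ω₁₂ Ω₁₃: the first two slots carry independent matrix units, and everything
else is pushed into the third. Comparison with the normal form of Ω₁₂ Ω₂₃ then shows only a change
in the order of the two factors in the third slot. -/
theorem casimir_mul_casimir_left (he : ∀ X Y, e (X * Y) = e X * e Y)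
    (hee' : ∀ X Y, Commute (e X) (e' Y)) :
    casimir e e' * casimir e χ = ∑ a, ∑ b, ∑ c, ∑ d,
        e (Matrix.single a b 1) * e' (Matrix.single c d 1) *
          χ (Matrix.single b a 1 * Matrix.single d c 1) := by
  have h1 : ∀ c d, casimir e e' * e (Matrix.single c d 1) = ∑ a, ∑ b, e (Matrix.single a b 1) *
      e' (Matrix.single c d 1 * Matrix.single b a 1) := fun c d => by
    have := casimir_mul_right (prodForm e e') (Matrix.single c d 1)
    simp only [prodForm_apply] at this
    rw [← this, casimir, Finset.sum_mul]
    refine Finset.sum_congr rfl fun a _ => ?_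
    rw [Finset.sum_mul]
    refine Finset.sum_congr rfl fun b _ => ?_
    rw [he, mul_assoc, mul_assoc, (hee' _ _).eq]
  have h2 : ∀ a b, ∑ c, ∑ d, e' (Matrix.single c d 1 * Matrix.single b a 1) *
      χ (Matrix.single d c 1) = ∑ c, ∑ d, e' (Matrix.single c d 1) *
      χ (Matrix.single b a 1 * Matrix.single d c 1) := fun a b => by
    simpa only [prodForm_apply] using casimir_mul_right (prodForm e' χ) (Matrix.single b a 1)
  rw [show casimir e χ = ∑ c, ∑ d, e (Matrix.single c d 1) * χ (Matrix.single d c 1) from rfl]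
  simp only [Finset.mul_sum, ← mul_assoc, h1, Finset.sum_mul]
  have h3 : ∀ a b, ∑ c, ∑ d, e (Matrix.single a b 1) * e' (Matrix.single c d 1) *
      χ (Matrix.single b a 1 * Matrix.single d c 1) = ∑ c, ∑ d, e (Matrix.single a b 1) *
      e' (Matrix.single c d 1 * Matrix.single b a 1) * χ (Matrix.single d c 1) := fun a b => by
    simp only [mul_assoc, ← Finset.mul_sum]
    rw [h2]
  simp only [h3]
  rw [Finset.sum_congr rfl fun c _ => Finset.sum_comm, Finset.sum_comm]
  refine Finset.sum_congr rfl fun a _ => ?_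
  rw [Finset.sum_congr rfl fun c _ => Finset.sum_comm, Finset.sum_comm]

/-- The companion normal form for Ω₁₂ Ω₂₃, with the opposite order in the third slot. -/
theorem casimir_mul_casimir_right (he' : ∀ X Y, e' (X * Y) = e' X * e' Y) :
    casimir e e' * casimir e' χ = ∑ a, ∑ b, ∑ c, ∑ d,
        e (Matrix.single a b 1) * e' (Matrix.single c d 1) *
          χ (Matrix.single d c 1 * Matrix.single b a 1) := by
  have h2 : ∀ a b, ∑ c, ∑ d, e' (Matrix.single b a 1 * Matrix.single c d 1) *
      χ (Matrix.single d c 1) = ∑ c, ∑ d, e' (Matrix.single c d 1) *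
      χ (Matrix.single d c 1 * Matrix.single b a 1) := fun a b => by
    simpa only [prodForm_apply] using casimir_mul_left (prodForm e' χ) (Matrix.single b a 1)
  rw [casimir, Finset.sum_mul]
  refine Finset.sum_congr rfl fun a _ => ?_
  rw [Finset.sum_mul]
  refine Finset.sum_congr rfl fun b _ => ?_
  simp only [mul_assoc, ← Finset.mul_sum]
  rw [← h2, casimir]
  simp only [he', Finset.mul_sum, mul_assoc]

/-- The classical Yang-Baxter equation for Casimir elements. -/
theorem casimir_commutator (he : ∀ X Y, e (X * Y) = e X * e Y)
    (he' : ∀ X Y, e' (X * Y) = e' X * e' Y) (hee' : ∀ X Y, Commute (e X) (e' Y))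
    (heφ : ∀ X Y, Commute (e' X) (φ Y)) (heψ : ∀ X Y, Commute (e X) (ψ Y))
    (hχ : ∀ X Y, φ X * ψ Y - ψ Y * φ X = χ (X * Y - Y * X)) :
    casimir e φ * casimir e' ψ - casimir e' ψ * casimir e φ =
      casimir e e' * (casimir e χ - casimir e' χ) := by
  rw [mul_sub, casimir_mul_casimir_left he hee', casimir_mul_casimir_right he']
  -- The normal forms differ by χ of a commutator of matrix units, which is φψ − ψφ. The two halves
  -- are matched with the two products on the left merely by moving factors of different slots past
  -- each other.
  simp only [← Finset.sum_sub_distrib, ← mul_sub, ← map_sub, ← hχ]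
  rw [casimir, casimir, Finset.sum_mul, Finset.mul_sum, ← Finset.sum_sub_distrib]
  refine Finset.sum_congr rfl fun a _ => ?_
  rw [Finset.sum_mul, Finset.mul_sum, ← Finset.sum_sub_distrib]
  refine Finset.sum_congr rfl fun b _ => ?_
  rw [Finset.sum_mul, Finset.mul_sum, ← Finset.sum_sub_distrib]
  refine Finset.sum_congr rfl fun c _ => ?_
  rw [Finset.sum_mul, Finset.mul_sum, ← Finset.sum_sub_distrib]
  refine Finset.sum_congr rfl fun d _ => ?_
  rw [mul_sub]
  congr 1
  · rw [mul_assoc, mul_assoc, ← mul_assoc (φ _), ← (heφ _ _).eq, mul_assoc]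
  · rw [mul_assoc, ← mul_assoc (ψ _), ← (heψ _ _).eq, mul_assoc, ← mul_assoc,
      ← (hee' _ _).eq, mul_assoc]

/-- Multiplication by X in the first slot, on either side, is transferred to the second slot by
adjointness. No multiplicativity of φ is needed, so this applies to currents at any power of t. -/
theorem casimir_invariant (he : ∀ X Y, e (X * Y) = e X * e Y) (X : Matrix (Fin m) (Fin m) ℂ)
    (heφ : ∀ Y, Commute (e X) (φ Y)) :
    casimir e φ * e X - e X * casimir e φ = -∑ a, ∑ b, e (Matrix.single a b 1) *
      φ (Matrix.single b a 1 * X - X * Matrix.single b a 1) := by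
  have h1 := casimir_mul_left (prodForm e φ) X
  have h2 := casimir_mul_right (prodForm e φ) X
  simp only [prodForm_apply] at h1 h2
  simp only [map_sub, mul_sub, Finset.sum_sub_distrib, ← h1, ← h2, neg_sub, he, casimir,
    Finset.sum_mul, Finset.mul_sum, mul_assoc]
  simp only [(heφ _).eq]

end Casimir


/-! ### Homomorphisms from the Hecke and Cherednik algebras -/

section Lifts

variable {N : ℕ} {A : Type*} [Ring A]

/-- Elements of an algebra that satisfy the relations of `H_N`, written with the `z_p`. -/
structure HeckeData (P : Equiv.Perm (Fin N) →* A) (Z : Fin N → A) : Prop where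
  perm_z : ∀ σ p, P σ * Z p = Z (σ p) * P σ
  z_comm : ∀ p q, p ≠ q → Z p * Z q - Z q * Z p = P (Equiv.swap p q) * (Z p - Z q)

/-- The Jucys-Murphy element. -/
def jucysMurphy (P : Equiv.Perm (Fin N) →* A) (q : Fin N) : A :=
  ∑ r ∈ Finset.Iio q, P (Equiv.swap r q)

theorem perm_mul_swap (P : Equiv.Perm (Fin N) →* A) (τ : Equiv.Perm (Fin N)) (r q : Fin N) :
    P τ * P (Equiv.swap r q) = P (Equiv.swap (τ r) (τ q)) * P τ := by
  rw [← map_mul, ← map_mul, Equiv.swap_apply_apply, inv_mul_cancel_right]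

theorem perm_mul_jucysMurphy (P : Equiv.Perm (Fin N) →* A) {τ : Equiv.Perm (Fin N)} {q : Fin N}
    (hq : τ q = q) (h : ∀ s, τ s < q ↔ s < q) :
    P τ * jucysMurphy P q = jucysMurphy P q * P τ := by
  rw [jucysMurphy, Finset.mul_sum, Finset.sum_mul]
  refine Finset.sum_equiv τ (fun s => ?_) (fun s _ => ?_)
  · rw [Finset.mem_Iio, Finset.mem_Iio, h]
  · rw [perm_mul_swap, hq]

variable {P : Equiv.Perm (Fin N) →* A} {Z : Fin N → A}

/-- For p < q the Jucys-Murphy element of p involves only transpositions fixing q and preserving the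
set of indices below q, so it commutes with z_q and with the Jucys-Murphy element of q. In the
remaining commutator of z_p with the latter only σ_pq contributes, giving σ_pq (z_q − z_p), which
cancels [z_p, z_q]. -/
theorem HeckeData.u_comm_of_lt (D : HeckeData P Z) {p q : Fin N} (h : p < q) :
    (Z p + jucysMurphy P p) * (Z q + jucysMurphy P q) =
      (Z q + jucysMurphy P q) * (Z p + jucysMurphy P p) := by
  have h1 : jucysMurphy P p * Z q = Z q * jucysMurphy P p := by
    rw [jucysMurphy, Finset.mul_sum, Finset.sum_mul]
    refine Finset.sum_congr rfl fun r hr => ?_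
    have hr' : r < p := Finset.mem_Iio.1 hr
    rw [D.perm_z, Equiv.swap_apply_of_ne_of_ne (hr'.trans h).ne' h.ne']
  have h2 : jucysMurphy P p * jucysMurphy P q = jucysMurphy P q * jucysMurphy P p := by
    rw [jucysMurphy, Finset.mul_sum, Finset.sum_mul]
    refine Finset.sum_congr rfl fun r hr => ?_
    have hr' : r < p := Finset.mem_Iio.1 hr
    refine perm_mul_jucysMurphy P
      (Equiv.swap_apply_of_ne_of_ne (hr'.trans h).ne' h.ne') fun s => ?_
    by_cases h1 : s = r
    · subst h1; rw [Equiv.swap_apply_left]; exact ⟨fun _ => hr'.trans h, fun _ => h⟩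
    · by_cases h2 : s = p
      · subst h2; rw [Equiv.swap_apply_right]; exact ⟨fun _ => h, fun _ => hr'.trans h⟩
      · rw [Equiv.swap_apply_of_ne_of_ne h1 h2]
  have h3 : Z p * jucysMurphy P q - jucysMurphy P q * Z p =
      P (Equiv.swap p q) * (Z q - Z p) := by
    rw [jucysMurphy, Finset.mul_sum, Finset.sum_mul, ← Finset.sum_sub_distrib,
      Finset.sum_eq_single p]
    · rw [mul_sub, D.perm_z _ q, Equiv.swap_apply_right]
    · intro s hs hsp
      rw [D.perm_z, Equiv.swap_apply_of_ne_of_ne hsp.symm h.ne, sub_self]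
    · intro hp
      exact absurd (Finset.mem_Iio.2 h) hp
  have h4 := D.z_comm p q h.ne
  rw [add_mul, mul_add, mul_add, add_mul, mul_add, mul_add, h1, h2]
  have h5 : Z p * Z q - Z q * Z p + (Z p * jucysMurphy P q - jucysMurphy P q * Z p) = 0 := by
    rw [h3, h4, ← mul_add]; simp
  rw [← sub_eq_zero, ← h5]
  abel

theorem HeckeData.u_comm (D : HeckeData P Z) (p q : Fin N) :
    (Z p + jucysMurphy P p) * (Z q + jucysMurphy P q) =
      (Z q + jucysMurphy P q) * (Z p + jucysMurphy P p) := by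
  rcases lt_trichotomy p q with h | h | h
  · exact D.u_comm_of_lt h
  · rw [h]
  · exact (D.u_comm_of_lt h).symm

/-- Adjacency enters here: exchanging p and p + 1 preserves the set of indices below q when q is
neither of them, and hence the Jucys-Murphy element of q. -/
theorem HeckeData.cross_ne (D : HeckeData P Z) (p p' q : Fin N) (hp : (p' : ℕ) = p + 1)
    (hq : q ≠ p) (hq' : q ≠ p') : P (Equiv.swap p p') * (Z q + jucysMurphy P q) =
      (Z q + jucysMurphy P q) * P (Equiv.swap p p') := by
  have e : Equiv.swap p p' q = q := Equiv.swap_apply_of_ne_of_ne hq hq'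
  rw [mul_add, add_mul, D.perm_z, e, perm_mul_jucysMurphy P e]
  intro s
  have h1 : (q : ℕ) ≠ p := fun h => hq (Fin.ext h)
  have h2 : (q : ℕ) ≠ p' := fun h => hq' (Fin.ext h)
  by_cases hs : s = p
  · subst hs; rw [Equiv.swap_apply_left, Fin.lt_def, Fin.lt_def]; omega
  · by_cases hs' : s = p'
    · subst hs'; rw [Equiv.swap_apply_right, Fin.lt_def, Fin.lt_def]; omega
    · rw [Equiv.swap_apply_of_ne_of_ne hs hs']

/-- Conjugation carries the Jucys-Murphy element of p to that of p + 1 except for one missing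
transposition, σ_p itself; its square is the constant 1 in the relation. -/
theorem HeckeData.cross_eq (D : HeckeData P Z) (p p' : Fin N) (hp : (p' : ℕ) = p + 1) :
    P (Equiv.swap p p') * (Z p + jucysMurphy P p) =
      (Z p' + jucysMurphy P p') * P (Equiv.swap p p') - 1 := by
  have hI : Finset.Iio p' = insert p (Finset.Iio p) := by
    ext s
    rw [Finset.mem_insert, Finset.mem_Iio, Finset.mem_Iio, Fin.lt_def, Fin.lt_def, Fin.ext_iff]
    omega
  have h1 : P (Equiv.swap p p') * jucysMurphy P p + 1 =
      jucysMurphy P p' * P (Equiv.swap p p') := by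
    rw [jucysMurphy, jucysMurphy, hI, Finset.sum_insert (by simp), add_mul, ← map_mul,
      Equiv.swap_mul_self, map_one, add_comm, Finset.mul_sum, Finset.sum_mul]
    congr 1
    refine Finset.sum_congr rfl fun r hr => ?_
    have hr' : r < p := Finset.mem_Iio.1 hr
    have hr'' : r ≠ p' := by
      intro h
      rw [h, Fin.lt_def] at hr'
      omega
    rw [perm_mul_swap, Equiv.swap_apply_left, Equiv.swap_apply_of_ne_of_ne hr'.ne hr'']
  rw [mul_add, add_mul, D.perm_z, Equiv.swap_apply_left, ← h1]
  abel

/-- The failure of the commutation relation of the `z_p`. -/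
def zDefect (P : Equiv.Perm (Fin N) →* A) (Z : Fin N → A) (p q : Fin N) : A :=
  Z p * Z q - Z q * Z p - P (Equiv.swap p q) * (Z p - Z q)

theorem zDefect_symm (p q : Fin N) : zDefect P Z q p = -zDefect P Z p q := by
  rw [zDefect, zDefect, Equiv.swap_comm, mul_sub, mul_sub]
  abel

variable [Algebra ℂ A]

/-- The images of the generators of `H_N`. -/
def heckeGen (P : Equiv.Perm (Fin N) →* A) (Z : Fin N → A) : HGen N → A
  | HGen.perm σ => P σ
  | HGen.u p => Z p + jucysMurphy P p

theorem lift_heckeGen_zFree (p : Fin N) : FreeAlgebra.lift ℂ (heckeGen P Z) (zFree p) = Z p := by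
  rw [zFree, map_sub, map_sum, FreeAlgebra.lift_ι_apply]
  simp only [FreeAlgebra.lift_ι_apply, heckeGen, jucysMurphy, add_sub_cancel_right]

theorem HeckeData.rel (D : HeckeData P Z) {a b : FreeAlgebra ℂ (HGen N)} (h : HRel N a b) :
    FreeAlgebra.lift ℂ (heckeGen P Z) a = FreeAlgebra.lift ℂ (heckeGen P Z) b := by
  cases h with
  | perm_one => rw [FreeAlgebra.lift_ι_apply, map_one]; exact map_one P
  | perm_mul σ τ =>
    rw [map_mul]; simp only [FreeAlgebra.lift_ι_apply]; exact map_mul P σ τ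
  | u_comm p q =>
    rw [map_mul, map_mul]; simp only [FreeAlgebra.lift_ι_apply]; exact D.u_comm p q
  | cross_ne p p' q hp hq hq' =>
    rw [map_mul, map_mul]; simp only [FreeAlgebra.lift_ι_apply]; exact D.cross_ne p p' q hp hq hq'
  | cross_eq p p' hp =>
    rw [map_sub, map_one, map_mul, map_mul]; simp only [FreeAlgebra.lift_ι_apply]
    exact D.cross_eq p p' hp

/-- The homomorphism from `H_N` given by elements that satisfy its relations. -/
def HeckeData.lift (D : HeckeData P Z) : HeckeAlg N →ₐ[ℂ] A :=
  RingQuot.liftAlgHom ℂ ⟨FreeAlgebra.lift ℂ (heckeGen P Z), fun _ _ h => D.rel h⟩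

theorem HeckeData.lift_perm (D : HeckeData P Z) (σ : Equiv.Perm (Fin N)) :
    D.lift (HeckeAlg.perm σ) = P σ := by
  rw [lift, HeckeAlg.perm, RingQuot.liftAlgHom_mkAlgHom_apply, FreeAlgebra.lift_ι_apply, heckeGen]

theorem HeckeData.lift_z (D : HeckeData P Z) (p : Fin N) : D.lift (HeckeAlg.z p) = Z p := by
  rw [lift, HeckeAlg.z, RingQuot.liftAlgHom_mkAlgHom_apply, lift_heckeGen_zFree]

/-! ### Relations between the z_p and the x_q, and the defect of commutativity -/

/-- Elements of an algebra that satisfy the relations of `T_N` that involve the `x_p`. -/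
structure CrossRel (κ : ℂ) (P : Equiv.Perm (Fin N) →* A) (Z X Y : Fin N → A) : Prop where
  x_comm : ∀ p q, X p * X q = X q * X p
  x_mul_y : ∀ p, X p * Y p = 1
  y_mul_x : ∀ p, Y p * X p = 1
  perm_x : ∀ σ p, P σ * X p = X (σ p) * P σ
  z_x_ne : ∀ p q, q ≠ p → Z p * X q - X q * Z p = -(X p * P (Equiv.swap p q))
  z_x_eq : ∀ p, Z p * X p - X p * Z p =
    κ • X p + ∑ r ∈ Finset.univ.erase p, X p * P (Equiv.swap p r)

/-- Elements of an algebra that satisfy the relations of `T_N` apart from the commutation relations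
of the `z_p`. -/
structure CrossData (κ : ℂ) (P : Equiv.Perm (Fin N) →* A) (Z X Y : Fin N → A) : Prop extends
    CrossRel κ P Z X Y where
  perm_z : ∀ σ p, P σ * Z p = Z (σ p) * P σ

variable {κ : ℂ} {X Y : Fin N → A}

/-- The Jacobi identity: the commutators of z_p and z_q with x_r are −x_p σ_pr and −x_q σ_qr.
Commuting these once more and moving permutations by equivariance gives the commutator of σ_pq (z_p
− z_q) with x_r. -/
theorem CrossData.zDefect_comm_of_ne (D : CrossData κ P Z X Y) {p q r : Fin N} (hpq : p ≠ q)
    (hrp : r ≠ p) (hrq : r ≠ q) : zDefect P Z p q * X r = X r * zDefect P Z p q := by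
  have hp := D.z_x_ne p r hrp
  have hq := D.z_x_ne q r hrq
  have h1 := D.z_x_ne p q hpq.symm
  have h2 := D.z_x_ne q p hpq
  rw [Equiv.swap_comm q p] at h2
  have h3 := D.perm_z (Equiv.swap q r) p
  rw [Equiv.swap_apply_of_ne_of_ne hpq hrp.symm] at h3
  have h4 := D.perm_z (Equiv.swap p r) q
  rw [Equiv.swap_apply_of_ne_of_ne hpq.symm hrq.symm] at h4
  have h5 := D.perm_x (Equiv.swap p q) r
  rw [Equiv.swap_apply_of_ne_of_ne hrp hrq] at h5
  have h6 := D.perm_x (Equiv.swap p q) p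
  rw [Equiv.swap_apply_left] at h6
  have h7 := D.perm_x (Equiv.swap p q) q
  rw [Equiv.swap_apply_right] at h7
  rw [zDefect]
  linear_combination (norm := noncomm_ring) Z p * hq + hp * Z q - Z q * hp - hq * Z p -
    h1 * P (Equiv.swap q r) + X q * h3 + h2 * P (Equiv.swap p r) - X p * h4 -
    P (Equiv.swap p q) * hp + P (Equiv.swap p q) * hq - h5 * (Z p - Z q) +
    h6 * P (Equiv.swap p r) - h7 * P (Equiv.swap q r)

/-- The same Jacobi argument in the harder case r = p, where [z_p, x_p] involves κ and the sum S of
all transpositions moving p. The κ-terms cancel because σ_pq x_p = x_q σ_pq. -/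
theorem CrossData.zDefect_comm_left (D : CrossData κ P Z X Y) {p q : Fin N} (hpq : p ≠ q) :
    zDefect P Z p q * X p = X p * zDefect P Z p q := by
  set T := P (Equiv.swap p q) with hT
  set S := ∑ r ∈ Finset.univ.erase p, P (Equiv.swap p r) with hS
  have hp : Z p * X p - X p * Z p = κ • X p + X p * S := by
    rw [D.z_x_eq, hS, Finset.mul_sum]
  have hq : Z q * X p - X p * Z q = -(X q * T) := by
    rw [D.z_x_ne q p hpq, Equiv.swap_comm]
  have h1 : Z p * X q - X q * Z p = -(X p * T) := D.z_x_ne p q hpq.symm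
  have h2 : T * Z q = Z p * T := by rw [hT, D.perm_z, Equiv.swap_apply_right]
  -- A transposition of p with r ≠ q fixes q, so it commutes with z_q; only σ_pq is left.
  have h3 : Z q * S - S * Z q = T * Z p - T * Z q := by
    rw [hS, Finset.mul_sum, Finset.sum_mul, ← Finset.sum_sub_distrib, Finset.sum_eq_single q]
    · rw [hT, D.perm_z _ p, Equiv.swap_apply_left]
    · intro r hr hrq
      rw [D.perm_z, Equiv.swap_apply_of_ne_of_ne hpq.symm hrq.symm, sub_self]
    · intro h
      exact absurd (Finset.mem_erase.2 ⟨hpq.symm, Finset.mem_univ q⟩) h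
  have h4 : T * X p = X q * T := by rw [hT, D.perm_x, Equiv.swap_apply_left]
  have h5 : T * X q = X p * T := by rw [hT, D.perm_x, Equiv.swap_apply_right]
  have h6 : κ • (Z q * X p - X p * Z q) = κ • -(X q * T) := by rw [hq]
  have h7 : κ • (T * X p) = κ • (X q * T) := by rw [h4]
  rw [zDefect, ← hT]
  linear_combination (norm := skip) Z p * hq + hp * Z q - Z q * hp - hq * Z p - h1 * T + X q * h2 -
    h6 - hq * S - X p * h3 - T * hp + T * hq - h4 * (Z p - Z q) - h7 - h4 * S - h5 * T
  simp only [mul_add, add_mul, mul_sub, sub_mul, smul_sub, smul_neg, mul_neg, neg_mul,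
    smul_mul_assoc, mul_smul_comm, mul_assoc]
  abel

theorem CrossData.zDefect_comm (D : CrossData κ P Z X Y) {p q : Fin N} (hpq : p ≠ q) (r : Fin N) :
    Commute (zDefect P Z p q) (X r) := by
  by_cases hrp : r = p
  · subst hrp; exact D.zDefect_comm_left hpq
  · by_cases hrq : r = q
    · subst hrq
      have := D.zDefect_comm_left hpq.symm
      rw [zDefect_symm, neg_mul, mul_neg, neg_inj] at this
      exact this
    · exact D.zDefect_comm_of_ne hpq hrp hrq

theorem CrossData.zDefect_comm_y (D : CrossData κ P Z X Y) {p q : Fin N} (hpq : p ≠ q)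
    (r : Fin N) : Commute (zDefect P Z p q) (Y r) := by
  have h : zDefect P Z p q * X r = X r * zDefect P Z p q := D.zDefect_comm hpq r
  calc zDefect P Z p q * Y r = Y r * X r * zDefect P Z p q * Y r := by rw [D.y_mul_x, one_mul]
    _ = Y r * (X r * zDefect P Z p q) * Y r := by rw [mul_assoc (Y r)]
    _ = Y r * zDefect P Z p q * (X r * Y r) := by rw [← h]; simp only [mul_assoc]
    _ = Y r * zDefect P Z p q := by rw [D.x_mul_y, mul_one]

/-- The images of the generators of `T_N`. -/
def cherednikGen (P : Equiv.Perm (Fin N) →* A) (Z X Y : Fin N → A) : TGen N → A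
  | TGen.hecke g => heckeGen P Z g
  | TGen.x p => X p
  | TGen.xinv p => Y p

theorem lift_cherednikGen_heckeFree (a : FreeAlgebra ℂ (HGen N)) :
    FreeAlgebra.lift ℂ (cherednikGen P Z X Y) (heckeFree N a) =
      FreeAlgebra.lift ℂ (heckeGen P Z) a := by
  have h : (FreeAlgebra.lift ℂ (cherednikGen P Z X Y)).comp (heckeFree N) =
      FreeAlgebra.lift ℂ (heckeGen P Z) := by
    refine FreeAlgebra.hom_ext (funext fun g => ?_)
    simp only [Function.comp_apply, AlgHom.comp_apply, heckeFree, FreeAlgebra.lift_ι_apply,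
      cherednikGen]
  exact DFunLike.congr_fun h a

theorem CrossData.rel (D : CrossData κ P Z X Y) (H : HeckeData P Z)
    {a b : FreeAlgebra ℂ (TGen N)} (h : TRel N κ a b) :
    FreeAlgebra.lift ℂ (cherednikGen P Z X Y) a = FreeAlgebra.lift ℂ (cherednikGen P Z X Y) b := by
  have hx : ∀ p, FreeAlgebra.lift ℂ (cherednikGen P Z X Y) (xFree p) = X p := fun p =>
    FreeAlgebra.lift_ι_apply _ _
  have hy : ∀ p, FreeAlgebra.lift ℂ (cherednikGen P Z X Y) (xinvFree p) = Y p := fun p =>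
    FreeAlgebra.lift_ι_apply _ _
  have hσ : ∀ σ, FreeAlgebra.lift ℂ (cherednikGen P Z X Y) (permFree σ) = P σ := fun σ =>
    (lift_cherednikGen_heckeFree _).trans (FreeAlgebra.lift_ι_apply _ _)
  have hz : ∀ p, FreeAlgebra.lift ℂ (cherednikGen P Z X Y) (heckeFree N (zFree p)) = Z p :=
    fun p => (lift_cherednikGen_heckeFree _).trans (lift_heckeGen_zFree p)
  cases h with
  | hecke a b h => rw [lift_cherednikGen_heckeFree, lift_cherednikGen_heckeFree, H.rel h]
  | x_comm p q => simp only [map_mul, hx, D.x_comm p q]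
  | x_mul_xinv p => simp only [map_mul, map_one, hx, hy, D.x_mul_y]
  | xinv_mul_x p => simp only [map_mul, map_one, hx, hy, D.y_mul_x]
  | perm_x σ p => simp only [map_mul, hx, hσ, D.perm_x]
  | cross_ne p q h => simp only [map_sub, map_neg, map_mul, hx, hσ, hz, D.z_x_ne p q h]
  | cross_eq p =>
    simp only [map_sub, map_add, map_sum, map_smul, map_mul, hx, hσ, hz, D.z_x_eq p]

/-- The homomorphism from `T_N` given by elements that satisfy its relations. -/
def CrossData.lift (D : CrossData κ P Z X Y) (H : HeckeData P Z) : Cherednik N κ →ₐ[ℂ] A :=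
  RingQuot.liftAlgHom ℂ ⟨FreeAlgebra.lift ℂ (cherednikGen P Z X Y), fun _ _ h => D.rel H h⟩

theorem CrossData.lift_x (D : CrossData κ P Z X Y) (H : HeckeData P Z) (p : Fin N) :
    D.lift H (Cherednik.x κ p) = X p := by
  rw [lift, Cherednik.x, RingQuot.liftAlgHom_mkAlgHom_apply, xFree, FreeAlgebra.lift_ι_apply,
    cherednikGen]

theorem CrossData.lift_xinv (D : CrossData κ P Z X Y) (H : HeckeData P Z) (p : Fin N) :
    D.lift H (Cherednik.xinv κ p) = Y p := by
  rw [lift, Cherednik.xinv, RingQuot.liftAlgHom_mkAlgHom_apply, xinvFree,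
    FreeAlgebra.lift_ι_apply, cherednikGen]

theorem heckeToCherednik_mk (a : FreeAlgebra ℂ (HGen N)) :
    heckeToCherednik N κ (RingQuot.mkAlgHom ℂ (HRel N) a) =
      RingQuot.mkAlgHom ℂ (TRel N κ) (heckeFree N a) := by
  exact RingQuot.liftAlgHom_mkAlgHom_apply ..

theorem CrossData.lift_hecke (D : CrossData κ P Z X Y) (H : HeckeData P Z) (h : HeckeAlg N) :
    D.lift H (heckeToCherednik N κ h) = H.lift h := by
  obtain ⟨a, rfl⟩ := RingQuot.mkAlgHom_surjective ℂ (HRel N) h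
  rw [heckeToCherednik_mk, lift, HeckeData.lift, RingQuot.liftAlgHom_mkAlgHom_apply,
    RingQuot.liftAlgHom_mkAlgHom_apply, lift_cherednikGen_heckeFree]

end Lifts


/-! ### Casimir elements at tensor factors -/

theorem casimir_mul_sub_mul {m : ℕ} {A : Type*} [Ring A] [Algebra ℂ A]
    {e φ : Matrix (Fin m) (Fin m) ℂ →ₗ[ℂ] A} {a : A} (h : ∀ X, Commute (e X) a) :
    casimir e φ * a - a * casimir e φ = ∑ b, ∑ c, e (Matrix.single b c 1) *
      (φ (Matrix.single c b 1) * a - a * φ (Matrix.single c b 1)) := by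
  simp only [casimir, Finset.sum_mul, Finset.mul_sum, ← Finset.sum_sub_distrib, mul_sub]
  refine Finset.sum_congr rfl fun b _ => Finset.sum_congr rfl fun c _ => ?_
  rw [mul_assoc, ← mul_assoc a, ← (h _).eq, mul_assoc]

section Sites

variable {m N : ℕ} {A : Type*} [Ring A] [Algebra ℂ A] (b : Module.End ℂ (TPow m N) →ₐ[ℂ] A)

/-- The action of a matrix in a tensor factor, in an algebra to which the operators on the tensor
power are mapped. -/
def siteIn (p : Fin N) : Matrix (Fin m) (Fin m) ℂ →ₗ[ℂ] A := b.toLinearMap ∘ₗ site p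

theorem siteIn_apply (p : Fin N) (X : Matrix (Fin m) (Fin m) ℂ) : siteIn b p X = b (site p X) := rfl

theorem siteIn_mul (p : Fin N) (X Y : Matrix (Fin m) (Fin m) ℂ) :
    siteIn b p (X * Y) = siteIn b p X * siteIn b p Y := by
  rw [siteIn_apply, site_mul, map_mul]; rfl

theorem siteIn_comm {p q : Fin N} (h : p ≠ q) (X Y : Matrix (Fin m) (Fin m) ℂ) :
    Commute (siteIn b p X) (siteIn b q Y) := by
  change _ * _ = _ * _
  rw [siteIn_apply, siteIn_apply, ← map_mul, site_comm h, map_mul]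

theorem permT_mul_siteIn (σ : Equiv.Perm (Fin N)) (p : Fin N) (X : Matrix (Fin m) (Fin m) ℂ) :
    b (permT σ) * siteIn b p X = siteIn b (σ p) X * b (permT σ) := by
  rw [siteIn_apply, siteIn_apply, ← map_mul, permT_mul_site, map_mul]

theorem casimir_siteIn {p q : Fin N} (h : p ≠ q) :
    casimir (siteIn b p) (siteIn b q) = b (permT (Equiv.swap p q)) := by
  rw [permT_swap h, casimir]
  simp only [map_sum, map_mul, siteIn_apply]

variable {b} {φ ψ χ : Matrix (Fin m) (Fin m) ℂ →ₗ[ℂ] A}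

theorem permT_mul_casimir (hφ : ∀ g X, Commute (b g) (φ X)) (σ : Equiv.Perm (Fin N)) (p : Fin N) :
    b (permT σ) * casimir (siteIn b p) φ = casimir (siteIn b (σ p)) φ * b (permT σ) := by
  simp only [casimir, Finset.mul_sum, Finset.sum_mul, ← mul_assoc, permT_mul_siteIn]
  simp only [mul_assoc, (hφ _ _).eq]

theorem casimir_commutator_siteIn (hφ : ∀ g X, Commute (b g) (φ X))
    (hψ : ∀ g X, Commute (b g) (ψ X)) (hχ : ∀ X Y, φ X * ψ Y - ψ Y * φ X = χ (X * Y - Y * X))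
    {p q : Fin N} (h : p ≠ q) :
    casimir (siteIn b p) φ * casimir (siteIn b q) ψ -
      casimir (siteIn b q) ψ * casimir (siteIn b p) φ =
      b (permT (Equiv.swap p q)) * (casimir (siteIn b p) χ - casimir (siteIn b q) χ) := by
  rw [← casimir_siteIn b h]
  exact casimir_commutator (siteIn_mul b p) (siteIn_mul b q) (siteIn_comm b h) (fun X Y => hφ _ Y)
    (fun X Y => hψ _ Y) hχ

end Sites

/-- The representation of the symmetric group on the tensor power. -/
def permTHom (m N : ℕ) : Equiv.Perm (Fin N) →* Module.End ℂ (TPow m N) where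
  toFun := permT
  map_one' := permT_one
  map_mul' := permT_mul

/-! ### The action of the Hecke algebra on `F_N(U)` -/

section FN

variable {m : ℕ} (hm : 0 < m) (N : ℕ) (U : Type*) [AddCommGroup U] [Module ℂ U]
  [LieRingModule (sl m) U] [LieModule ℂ (sl m) U]

/-- Operators on the first factor of `F_N(U)`. -/
def fnLeft (m N : ℕ) (U : Type*) [AddCommGroup U] [Module ℂ U] :
    Module.End ℂ (TPow m N) →ₐ[ℂ] Module.End ℂ (FN m N U) := Module.End.rTensorAlgHom ℂ _ _

/-- The action of matrices on the second factor of `F_N(U)`. -/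
def fnCurrent : Matrix (Fin m) (Fin m) ℂ →ₗ[ℂ] Module.End ℂ (FN m N U) :=
  (Module.End.lTensorAlgHom ℂ U (TPow m N)).toLinearMap ∘ₗ
    (LieModule.toEnd ℂ (sl m) U : sl m →ₗ[ℂ] Module.End ℂ U) ∘ₗ slProj hm

theorem fnCurrent_comm (g : Module.End ℂ (TPow m N)) (X : Matrix (Fin m) (Fin m) ℂ) :
    Commute (fnLeft m N U g) (fnCurrent hm N U X) :=
  TensorProduct.ext' fun _ _ => rfl

theorem fnCurrent_lie (X Y : Matrix (Fin m) (Fin m) ℂ) :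
    fnCurrent hm N U X * fnCurrent hm N U Y - fnCurrent hm N U Y * fnCurrent hm N U X =
      fnCurrent hm N U (X * Y - Y * X) := by
  change (Module.End.lTensorAlgHom ℂ U (TPow m N)) (LieModule.toEnd ℂ (sl m) U (slProj hm X)) *
    (Module.End.lTensorAlgHom ℂ U (TPow m N)) (LieModule.toEnd ℂ (sl m) U (slProj hm Y)) -
    (Module.End.lTensorAlgHom ℂ U (TPow m N)) (LieModule.toEnd ℂ (sl m) U (slProj hm Y)) *
    (Module.End.lTensorAlgHom ℂ U (TPow m N)) (LieModule.toEnd ℂ (sl m) U (slProj hm X)) =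
    (Module.End.lTensorAlgHom ℂ U (TPow m N))
      (LieModule.toEnd ℂ (sl m) U (slProj hm (X * Y - Y * X)))
  rw [← slProj_lie, LieHom.map_lie, Ring.lie_def, map_sub, map_mul, map_mul]

/-- The operators of the `z_p` on `F_N(U)`. -/
def fnZ (p : Fin N) : Module.End ℂ (FN m N U) :=
  casimir (siteIn (fnLeft m N U) p) (fnCurrent hm N U)

theorem fnZ_eq (p : Fin N) : fnZ hm N U p = ∑ a, ∑ b,
    TensorProduct.map (site p (Matrix.single a b 1)) (LieModule.toEnd ℂ (sl m) U (slE b a)) := by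
  rw [fnZ, casimir]
  refine Finset.sum_congr rfl fun a _ => Finset.sum_congr rfl fun b _ => ?_
  rw [← slProj_single hm]
  exact TensorProduct.ext' fun _ _ => rfl

theorem fn_heckeData : HeckeData ((fnLeft m N U : _ →* _).comp (permTHom m N)) (fnZ hm N U) where
  perm_z σ p := permT_mul_casimir (fnCurrent_comm hm N U) σ p
  z_comm _ _ h := casimir_commutator_siteIn (fnCurrent_comm hm N U) (fnCurrent_comm hm N U)
    (fnCurrent_lie hm N U) h

theorem fn_isHeckeAction : IsHeckeAction m N U (fn_heckeData hm N U).lift where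
  perm σ := HeckeData.lift_perm _ σ
  z p := (HeckeData.lift_z _ p).trans (fnZ_eq hm N U p)

theorem fn_lie_eq (X : sl m) : LieModule.toEnd ℂ (sl m) (FN m N U) X =
    ∑ q, siteIn (fnLeft m N U) q X.1 + fnCurrent hm N U X.1 := by
  refine TensorProduct.ext' fun w u => ?_
  rw [LieModule.toEnd_apply_apply, TensorProduct.LieModule.lie_tmul_right, LinearMap.add_apply,
    LinearMap.sum_apply]
  congr 1
  · change (∑ q, site q X.1 : Module.End ℂ (TPow m N)) w ⊗ₜ[ℂ] u = _
    rw [LinearMap.sum_apply, TensorProduct.sum_tmul]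
    rfl
  · change _ = w ⊗ₜ[ℂ] ⁅slProj hm X.1, u⁆
    rw [slProj_val]

/-- Of the diagonal action, the factors q ≠ p commute with the Casimir operator separately, while
the contributions of the p-th factor and of U are opposite by `casimir_invariant`. -/
theorem fnZ_comm (p : Fin N) (X : sl m) :
    Commute (fnZ hm N U p) (LieModule.toEnd ℂ (sl m) (FN m N U) X) := by
  have h1 := casimir_invariant (siteIn_mul (fnLeft m N U) p) X.1
    (fun Y => fnCurrent_comm hm N U (site p X.1) Y)
  have h2 : fnZ hm N U p * fnCurrent hm N U X.1 - fnCurrent hm N U X.1 * fnZ hm N U p =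
      ∑ a, ∑ b, siteIn (fnLeft m N U) p (Matrix.single a b 1) *
        fnCurrent hm N U (Matrix.single b a 1 * X.1 - X.1 * Matrix.single b a 1) := by
    rw [fnZ, casimir_mul_sub_mul fun Y => fnCurrent_comm hm N U (site p Y) X.1]
    simp only [fnCurrent_lie]
  have h3 : ∀ q ≠ p, Commute (fnZ hm N U p) (siteIn (fnLeft m N U) q X.1) := fun q hq =>
    Commute.sum_left _ _ _ fun a _ => Commute.sum_left _ _ _ fun b _ =>
      (siteIn_comm _ hq.symm _ _).mul_left (fnCurrent_comm hm N U _ _).symm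
  change _ * _ = _ * _
  rw [← sub_eq_zero, fn_lie_eq hm, mul_add, add_mul, add_sub_add_comm, h2, Finset.mul_sum,
    Finset.sum_mul, ← Finset.sum_sub_distrib, Finset.sum_eq_single p]
  · rw [fnZ, h1, neg_add_cancel]
  · intro q _ hq
    exact sub_eq_zero.2 (h3 q hq)
  · intro h
    exact absurd (Finset.mem_univ p) h

theorem fn_perm_comm (hm : 0 < m) (σ : Equiv.Perm (Fin N)) (X : sl m) :
    Commute (fnLeft m N U (permT σ)) (LieModule.toEnd ℂ (sl m) (FN m N U) X) := by
  change _ * _ = _ * _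
  rw [fn_lie_eq hm, mul_add, add_mul, (fnCurrent_comm hm N U _ _).eq, Finset.mul_sum,
    Finset.sum_mul]
  congr 1
  simp only [permT_mul_siteIn]
  exact Equiv.sum_comp σ fun q => siteIn (fnLeft m N U) q X.1 * fnLeft m N U (permT σ)

theorem u_eq_z_add (p : Fin N) :
    RingQuot.mkAlgHom ℂ (HRel N) (FreeAlgebra.ι ℂ (HGen.u p)) =
      HeckeAlg.z p + ∑ r ∈ Finset.Iio p, HeckeAlg.perm (Equiv.swap r p) := by
  simp only [HeckeAlg.z, HeckeAlg.perm, zFree, map_sub, map_sum, sub_add_cancel]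

/-- The Hecke algebra is generated by the permutations and the `z_p`. -/
theorem adjoin_hecke (N : ℕ) : Algebra.adjoin ℂ (Set.range HeckeAlg.perm ∪ Set.range HeckeAlg.z) =
    (⊤ : Subalgebra ℂ (HeckeAlg N)) := by
  rw [eq_top_iff, ← adjoin_mkAlgHom_ι (HRel N)]
  refine Algebra.adjoin_le ?_
  rintro _ ⟨g | p, rfl⟩
  · exact Algebra.subset_adjoin (Or.inl ⟨g, rfl⟩)
  · change RingQuot.mkAlgHom ℂ (HRel N) (FreeAlgebra.ι ℂ (HGen.u p)) ∈ _
    rw [u_eq_z_add]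
    exact add_mem (Algebra.subset_adjoin (Or.inr ⟨p, rfl⟩))
      (sum_mem fun r _ => Algebra.subset_adjoin (Or.inl ⟨_, rfl⟩))

theorem fn_comm (X : sl m) (h : HeckeAlg N) :
    Commute ((fn_heckeData hm N U).lift h) (LieModule.toEnd ℂ (sl m) (FN m N U) X) := by
  refine commute_of_adjoin_eq_top (adjoin_hecke N) _ _ ?_ h
  rintro _ (⟨σ, rfl⟩ | ⟨p, rfl⟩)
  · rw [HeckeData.lift_perm]; exact fn_perm_comm N U hm σ X
  · rw [HeckeData.lift_z]; exact fnZ_comm hm N U p X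

end FN

/-- The Cherednik algebra is generated by the `x_p`, their inverses, the permutations and
the `z_p`. -/
theorem adjoin_cherednik (N : ℕ) (κ : ℂ) : Algebra.adjoin ℂ
    (Set.range (Cherednik.x κ) ∪ Set.range (Cherednik.xinv κ) ∪
      Set.range (fun σ => heckeToCherednik N κ (HeckeAlg.perm σ)) ∪
      Set.range (fun p => heckeToCherednik N κ (HeckeAlg.z p))) = ⊤ := by
  rw [eq_top_iff, ← adjoin_mkAlgHom_ι (TRel N κ)]
  refine Algebra.adjoin_le ?_
  have hu : ∀ g : HGen N, RingQuot.mkAlgHom ℂ (TRel N κ) (FreeAlgebra.ι ℂ (TGen.hecke g)) =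
      heckeToCherednik N κ (RingQuot.mkAlgHom ℂ (HRel N) (FreeAlgebra.ι ℂ g)) := fun g => by
    rw [heckeToCherednik_mk, heckeFree, FreeAlgebra.lift_ι_apply]
  rintro _ ⟨(g | p) | p | p, rfl⟩
  · change RingQuot.mkAlgHom ℂ (TRel N κ) (FreeAlgebra.ι ℂ (TGen.hecke (HGen.perm g))) ∈ _
    rw [hu]
    exact Algebra.subset_adjoin (Or.inl (Or.inr ⟨g, rfl⟩))
  · change RingQuot.mkAlgHom ℂ (TRel N κ) (FreeAlgebra.ι ℂ (TGen.hecke (HGen.u p))) ∈ _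
    rw [hu, u_eq_z_add, map_add, map_sum]
    exact add_mem (Algebra.subset_adjoin (Or.inr ⟨p, rfl⟩))
      (sum_mem fun r _ => Algebra.subset_adjoin (Or.inl (Or.inr ⟨_, rfl⟩)))
  · exact Algebra.subset_adjoin (Or.inl (Or.inl (Or.inl ⟨p, rfl⟩)))
  · exact Algebra.subset_adjoin (Or.inl (Or.inl (Or.inr ⟨p, rfl⟩)))


/-! ### Operators on `A_N(V)` -/

theorem adjoin_xpow (N : ℕ) : Algebra.adjoin ℂ (Set.range (fun p : Fin N => xpow p 1) ∪
    Set.range (fun p : Fin N => xpow p (-1))) = (⊤ : Subalgebra ℂ (Laurent N)) := by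
  set S := Algebra.adjoin ℂ (Set.range (fun p : Fin N => xpow p 1) ∪
    Set.range (fun p : Fin N => xpow p (-1)))
  have h1 : ∀ p : Fin N, xpow p 1 ∈ S := fun p => Algebra.subset_adjoin (Or.inl ⟨p, rfl⟩)
  have h2 : ∀ p : Fin N, xpow p (-1) ∈ S := fun p => Algebra.subset_adjoin (Or.inr ⟨p, rfl⟩)
  have h3 : ∀ (p : Fin N) (i : ℤ), xpow p i ∈ S := fun p i => by
    induction i using Int.induction_on with
    | zero => rw [xpow_zero]; exact one_mem S
    | succ i hi => rw [xpow_add]; exact mul_mem hi (h1 p)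
    | pred i hi => rw [sub_eq_add_neg, xpow_add]; exact mul_mem hi (h2 p)
  have h4 : ∀ (s : Finset (Fin N)) (l : Fin N → ℤ),
      mono (∑ p ∈ s, Pi.single p (l p)) ∈ S := fun s l => by
    induction s using Finset.induction_on with
    | empty => rw [Finset.sum_empty, mono_zero]; exact one_mem S
    | insert p s hp ih =>
      rw [Finset.sum_insert hp, ← mono_mul_mono]
      exact mul_mem (h3 p _) ih
  have h5 : Subalgebra.toSubmodule S = ⊤ := by
    rw [eq_top_iff, ← (AddMonoidAlgebra.basis (Fin N → ℤ) ℂ).span_eq, Submodule.span_le]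
    rintro _ ⟨l, rfl⟩
    rw [AddMonoidAlgebra.basis_apply]
    have := h4 Finset.univ l
    rwa [Finset.univ_sum_single] at this
  exact Algebra.toSubmodule_eq_top.1 h5

theorem opLT_one (m N : ℕ) : opLT 1 1 = (1 : Module.End ℂ (LT m N)) := TensorProduct.map_one

section AN

variable (m N : ℕ) (V : Type*) [AddCommGroup V] [Module ℂ V]

/-- Operators on the Laurent polynomials in `A_N(V)`. -/
def anL : Module.End ℂ (Laurent N) →ₐ[ℂ] Module.End ℂ (AN m N V) :=
  (Module.End.rTensorAlgHom ℂ (LT m N) V).comp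
    (AlgHom.ofLinearMap (opLT.flip 1) (opLT_one m N)
      (fun f g => by simp only [LinearMap.flip_apply]; rw [opLT_mul, one_mul]))

/-- Operators on the tensor power in `A_N(V)`. -/
def anT : Module.End ℂ (TPow m N) →ₐ[ℂ] Module.End ℂ (AN m N V) :=
  (Module.End.rTensorAlgHom ℂ (LT m N) V).comp
    (AlgHom.ofLinearMap (opLT 1) (opLT_one m N)
      (fun f g => by rw [opLT_mul, one_mul]))

/-- Operators on the module `V` in `A_N(V)`. -/
def anV : Module.End ℂ V →ₐ[ℂ] Module.End ℂ (AN m N V) :=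
  Module.End.lTensorAlgHom ℂ V (LT m N)

/-- Multiplication by Laurent polynomials in `A_N(V)`. -/
def anX : Laurent N →ₐ[ℂ] Module.End ℂ (AN m N V) := (anL m N V).comp (Algebra.lmul ℂ (Laurent N))

variable {m N V}

theorem anL_apply (f : Module.End ℂ (Laurent N)) : anL m N V f = (opLT f 1).rTensor V := rfl

theorem anT_apply (g : Module.End ℂ (TPow m N)) : anT m N V g = (opLT 1 g).rTensor V := rfl

theorem anX_apply (f : Laurent N) : anX m N V f = anL m N V (LinearMap.mulLeft ℂ f) := rfl

theorem anL_mul_anT (f : Module.End ℂ (Laurent N)) (g : Module.End ℂ (TPow m N)) :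
    anL m N V f * anT m N V g = (opLT f g).rTensor V := by
  rw [anL_apply, anT_apply, ← LinearMap.rTensor_mul, opLT_mul, mul_one, one_mul]

theorem anL_anT_comm (f : Module.End ℂ (Laurent N)) (g : Module.End ℂ (TPow m N)) :
    Commute (anL m N V f) (anT m N V g) := by
  change _ * _ = _ * _
  rw [anL_mul_anT, anL_apply, anT_apply, ← LinearMap.rTensor_mul, opLT_mul, mul_one, one_mul]

theorem anL_anV_comm (f : Module.End ℂ (Laurent N)) (h : Module.End ℂ V) :
    Commute (anL m N V f) (anV m N V h) := TensorProduct.ext' fun _ _ => rfl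

theorem anT_anV_comm (g : Module.End ℂ (TPow m N)) (h : Module.End ℂ V) :
    Commute (anT m N V g) (anV m N V h) := TensorProduct.ext' fun _ _ => rfl

theorem anX_anX_comm (f g : Laurent N) : Commute (anX m N V f) (anX m N V g) := by
  change _ * _ = _ * _
  rw [← map_mul, ← map_mul, mul_comm]

/-- The diagonal action of the symmetric group on `A_N(V)`. -/
def anPerm (m N : ℕ) (V : Type*) [AddCommGroup V] [Module ℂ V] :
    Equiv.Perm (Fin N) →* Module.End ℂ (AN m N V) where
  toFun σ := anL m N V (permL σ).toLinearMap * anT m N V (permT σ)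
  map_one' := by rw [permL_one, permT_one, map_one, map_one, mul_one]
  map_mul' σ τ := by
    rw [permL_mul, permT_mul, map_mul, map_mul, mul_assoc, mul_assoc,
      ← mul_assoc (anL m N V (permL τ).toLinearMap), (anL_anT_comm _ _).eq, mul_assoc]

theorem anPerm_apply (σ : Equiv.Perm (Fin N)) :
    anPerm m N V σ = anL m N V (permL σ).toLinearMap * anT m N V (permT σ) := rfl

theorem anPerm_mul_anX (σ : Equiv.Perm (Fin N)) (f : Laurent N) :
    anPerm m N V σ * anX m N V f = anX m N V (permL σ f) * anPerm m N V σ := by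
  rw [anPerm_apply, anX_apply, anX_apply, mul_assoc, ← (anL_anT_comm _ _).eq, ← mul_assoc,
    ← map_mul, permL_mul_mulLeft, map_mul, mul_assoc]

theorem anPerm_anV_comm (σ : Equiv.Perm (Fin N)) (h : Module.End ℂ V) :
    Commute (anPerm m N V σ) (anV m N V h) := (anL_anV_comm _ _).mul_left (anT_anV_comm _ _)

/-- The part of the operator of `z_p` that does not involve `V`. -/
def anD (m N : ℕ) (κ : ℂ) (V : Type*) [AddCommGroup V] [Module ℂ V] (p : Fin N) :
    Module.End ℂ (AN m N V) :=
  κ • anL m N V (euler p) + ∑ r ∈ Finset.univ.erase p,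
    anL m N V (dunkl p r) * anT m N V (permT (Equiv.swap p r))

theorem anPerm_mul_anD (κ : ℂ) (σ : Equiv.Perm (Fin N)) (p : Fin N) :
    anPerm m N V σ * anD m N κ V p = anD m N κ V (σ p) * anPerm m N V σ := by
  have h1 : anPerm m N V σ * anL m N V (euler p) = anL m N V (euler (σ p)) * anPerm m N V σ := by
    rw [anPerm_apply, mul_assoc, ← (anL_anT_comm _ _).eq, ← mul_assoc, ← map_mul,
      permL_mul_euler, map_mul, mul_assoc]
  have h2 : ∀ r ≠ p, anPerm m N V σ * (anL m N V (dunkl p r) * anT m N V (permT (Equiv.swap p r))) =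
      anL m N V (dunkl (σ p) (σ r)) * anT m N V (permT (Equiv.swap (σ p) (σ r))) *
        anPerm m N V σ := fun r hr => by
    have e : permT (Equiv.swap (σ p) (σ r)) * permT σ =
        (permT σ * permT (Equiv.swap p r) : Module.End ℂ (TPow m N)) := by
      rw [← permT_mul, ← permT_mul, Equiv.swap_apply_apply, inv_mul_cancel_right]
    rw [anPerm_apply, mul_assoc, ← mul_assoc (anT m N V (permT σ)), ← (anL_anT_comm _ _).eq,
      mul_assoc (anL m N V (dunkl p r)), ← mul_assoc, ← map_mul, ← map_mul,
      permL_mul_dunkl σ hr.symm, ← e, map_mul, map_mul, mul_assoc, mul_assoc,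
      ← mul_assoc (anL m N V (permL σ).toLinearMap), (anL_anT_comm _ _).eq, mul_assoc]
  rw [anD, anD, mul_add, add_mul, mul_smul_comm, smul_mul_assoc, h1, Finset.mul_sum,
    Finset.sum_mul]
  congr 1
  refine Finset.sum_equiv σ (fun r => ?_) (fun r hr => h2 r (Finset.ne_of_mem_erase hr))
  simp

theorem anL_euler_mul_anX (p q : Fin N) : anL m N V (euler p) * anX m N V (xpow q 1) -
    anX m N V (xpow q 1) * anL m N V (euler p) = if q = p then anX m N V (xpow p 1) else 0 := by
  rw [anX_apply, ← map_mul, ← map_mul, xpow, euler_mul_mulLeft, map_add, map_smul,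
    add_sub_cancel_left, Pi.single_apply]
  by_cases h : q = p
  · subst h; simp [anX_apply, xpow]
  · rw [if_neg (Ne.symm h), if_neg h]; simp

/-- The permutation of variables produced by the twisted Leibniz rule joins the permutation of
tensor factors already present, so the correction term contains the diagonal σ_pr. -/
theorem anL_dunkl_mul_anX {p r : Fin N} (h : p ≠ r) (f : Laurent N) :
    anL m N V (dunkl p r) * anT m N V (permT (Equiv.swap p r)) * anX m N V f =
      anX m N V f * (anL m N V (dunkl p r) * anT m N V (permT (Equiv.swap p r))) +
      anX m N V (dunkl p r f) * anPerm m N V (Equiv.swap p r) := by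
  rw [anX_apply, anX_apply, mul_assoc, ← (anL_anT_comm _ _).eq, ← mul_assoc, ← map_mul,
    dunkl_mul_mulLeft h, map_add, map_mul, map_mul, add_mul, mul_assoc, mul_assoc, anPerm_apply]

/-- Both x_p ∂_p and the divided differences with r ≠ q annihilate x_q; the one with r = q sends it
to −x_p. -/
theorem anD_mul_anX_ne (κ : ℂ) {p q : Fin N} (h : q ≠ p) :
    anD m N κ V p * anX m N V (xpow q 1) - anX m N V (xpow q 1) * anD m N κ V p =
      -(anX m N V (xpow p 1) * anPerm m N V (Equiv.swap p q)) := by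
  have h1 := anL_euler_mul_anX (m := m) (V := V) p q
  rw [if_neg h, sub_eq_zero] at h1
  rw [anD, add_mul, mul_add, smul_mul_assoc, mul_smul_comm, h1, add_sub_add_left_eq_sub,
    Finset.sum_mul, Finset.mul_sum, ← Finset.sum_sub_distrib, Finset.sum_eq_single q]
  · rw [anL_dunkl_mul_anX h.symm, dunkl_xpow_right h.symm, map_neg, add_sub_cancel_left]
    exact neg_mul (anX m N V (xpow p 1)) (anPerm m N V (Equiv.swap p q))
  · intro r hr hrq
    have hr' := (Finset.ne_of_mem_erase hr).symm
    rw [anL_dunkl_mul_anX hr', dunkl_xpow_of_ne hr' h hrq.symm, map_zero, zero_mul, add_zero,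
      sub_self]
  · intro hq
    exact absurd (Finset.mem_erase.2 ⟨h, Finset.mem_univ q⟩) hq

theorem anD_mul_anX_eq (κ : ℂ) (p : Fin N) :
    anD m N κ V p * anX m N V (xpow p 1) - anX m N V (xpow p 1) * anD m N κ V p =
      κ • anX m N V (xpow p 1) + ∑ r ∈ Finset.univ.erase p,
        anX m N V (xpow p 1) * anPerm m N V (Equiv.swap p r) := by
  have h1 := anL_euler_mul_anX (m := m) (V := V) p p
  rw [if_pos rfl] at h1
  rw [anD, add_mul, mul_add, smul_mul_assoc, mul_smul_comm, add_sub_add_comm, Finset.sum_mul,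
    Finset.mul_sum, ← Finset.sum_sub_distrib]
  congr 1
  · exact (smul_sub κ _ _).symm.trans (congrArg _ h1)
  refine Finset.sum_congr rfl fun r hr => ?_
  have hr' := (Finset.ne_of_mem_erase hr).symm
  rw [anL_dunkl_mul_anX hr', dunkl_xpow_left hr', add_sub_cancel_left]

/-! ### The currents -/

variable [LieRingModule (Affine m) V] [LieModule ℂ (Affine m) V]

/-- The action of the traceless parts of matrices at `t^i` on the factor `V` of `A_N(V)`. -/
def anCurrent (hm : 0 < m) (N : ℕ) (V : Type*) [AddCommGroup V] [Module ℂ V]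
    [LieRingModule (Affine m) V] [LieModule ℂ (Affine m) V] (i : ℤ) :
    Matrix (Fin m) (Fin m) ℂ →ₗ[ℂ] Module.End ℂ (AN m N V) :=
  (anV m N V).toLinearMap ∘ₗ (LieModule.toEnd ℂ (Affine m) V : Affine m →ₗ[ℂ] Module.End ℂ V) ∘ₗ
    current i ∘ₗ slProj hm

variable (hm : 0 < m)

theorem anCurrent_apply (i : ℤ) (X : Matrix (Fin m) (Fin m) ℂ) : anCurrent hm N V i X =
    anV m N V (LieModule.toEnd ℂ (Affine m) V (current i (slProj hm X))) := rfl

theorem anL_anCurrent_comm (f : Module.End ℂ (Laurent N)) (i : ℤ) (X : Matrix (Fin m) (Fin m) ℂ) :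
    Commute (anL m N V f) (anCurrent hm N V i X) := anL_anV_comm _ _

theorem anT_anCurrent_comm (i : ℤ) (g : Module.End ℂ (TPow m N)) (X : Matrix (Fin m) (Fin m) ℂ) :
    Commute (anT m N V g) (anCurrent hm N V i X) := anT_anV_comm _ _

theorem anCurrent_lie (i j : ℤ) (X Y : Matrix (Fin m) (Fin m) ℂ) :
    anCurrent hm N V i X * anCurrent hm N V j Y - anCurrent hm N V j Y * anCurrent hm N V i X =
      anCurrent hm N V (i + j) (X * Y - Y * X) +
      (if i = -j then (i : ℂ) * Matrix.trace ((slProj hm X).1 * (slProj hm Y).1) else 0) •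
        anV m N V (LieModule.toEnd ℂ (Affine m) V (central m)) := by
  simp only [anCurrent_apply]
  rw [← map_mul (anV m N V), ← map_mul (anV m N V), ← map_sub, ← Ring.lie_def, ← LieHom.map_lie, current_lie_current,
    slProj_lie, map_add, map_add, map_smul, map_smul]

/-- Two nonnegative powers of t pair to a central term only if both are zero, and then its
coefficient i vanishes. So sl_m[t] acts without central charge, and the Yang-Baxter argument applies
to currents on a module of any level. -/
theorem anCurrent_lie_nonneg {i j : ℤ} (hi : 0 ≤ i) (hj : 0 ≤ j)
    (X Y : Matrix (Fin m) (Fin m) ℂ) :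
    anCurrent hm N V i X * anCurrent hm N V j Y - anCurrent hm N V j Y * anCurrent hm N V i X =
      anCurrent hm N V (i + j) (X * Y - Y * X) := by
  rw [anCurrent_lie]
  split_ifs with h
  · have : i = 0 := by omega
    rw [this]; simp
  · simp

/-- The operator `∑_{a,b} E_ab^{(p)} ⊗ (E_ba - (δ_ab/m) I) t^i` on `A_N(V)`. -/
def anCas (N : ℕ) (V : Type*) [AddCommGroup V] [Module ℂ V]
    [LieRingModule (Affine m) V] [LieModule ℂ (Affine m) V] (p : Fin N) (i : ℤ) :
    Module.End ℂ (AN m N V) :=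
  casimir (siteIn (anT m N V) p) (anCurrent hm N V i)

theorem anL_anCas_comm (f : Module.End ℂ (Laurent N)) (p : Fin N) (i : ℤ) :
    Commute (anL m N V f) (anCas hm N V p i) :=
  Commute.sum_right _ _ _ fun _ _ => Commute.sum_right _ _ _ fun _ _ =>
    (anL_anT_comm _ _).mul_right (anL_anCurrent_comm hm _ _ _)

theorem currentTerm_eq (p : Fin N) (i : ℕ) :
    currentTerm m N V p i = anX m N V (xpow p (-(i : ℤ))) * anCas hm N V p i := by
  simp only [currentTerm, anCas, casimir, Finset.mul_sum]
  refine Finset.sum_congr rfl fun a _ => Finset.sum_congr rfl fun b _ => ?_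
  rw [← mul_assoc, anX_apply, siteIn_apply, anL_mul_anT, anCurrent_apply, slProj_single]
  exact TensorProduct.ext' fun _ _ => rfl

theorem exists_current_bound (hV : IsSmooth m V) (w : AN m N V) : ∃ n : ℕ, 0 < n ∧
    ∀ (j : ℤ), n ≤ j → ∀ X, anCurrent hm N V j X w = 0 := by
  induction w using TensorProduct.induction_on with
  | zero => exact ⟨1, one_pos, fun j _ X => map_zero _⟩
  | add w w' h h' =>
    obtain ⟨n, hn, h⟩ := h
    obtain ⟨n', hn', h'⟩ := h'
    refine ⟨max n n', lt_max_of_lt_left hn, fun j hj X => ?_⟩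
    rw [map_add, h j (by omega), h' j (by omega), add_zero]
  | tmul y v =>
    obtain ⟨i, hi⟩ := hV v
    refine ⟨i.toNat + 1, Nat.succ_pos _, fun j hj X => ?_⟩
    change y ⊗ₜ[ℂ] ⁅current j (slProj hm X), v⁆ = 0
    rw [hi j (by omega), TensorProduct.tmul_zero]

theorem anCas_eq_zero {i : ℤ} {w : AN m N V} (h : ∀ X, anCurrent hm N V i X w = 0) (p : Fin N) :
    anCas hm N V p i w = 0 := by
  simp only [anCas, casimir, LinearMap.sum_apply, Module.End.mul_apply, h, map_zero,
    Finset.sum_const_zero]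

theorem currentTerm_eq_zero {i : ℕ} {w : AN m N V} (h : ∀ X, anCurrent hm N V i X w = 0)
    (p : Fin N) : currentTerm m N V p i w = 0 := by
  rw [currentTerm_eq hm, Module.End.mul_apply, anCas_eq_zero hm h, map_zero]

/-- The sum of the currents in the operator of `z_p`. -/
def curSum (hV : IsSmooth m V) (p : Fin N) : Module.End ℂ (AN m N V) where
  toFun w := ∑ᶠ i : ℕ, currentTerm m N V p i w
  map_add' w w' := by
    simp only [map_add]
    exact finsum_add_distrib (currentTerm_finite hV p w) (currentTerm_finite hV p w')
  map_smul' c w := by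
    simp only [map_smul]
    exact (smul_finsum' c (currentTerm_finite hV p w)).symm

variable (hV : IsSmooth m V)

theorem curSum_apply (p : Fin N) (w : AN m N V) :
    curSum hV p w = ∑ᶠ i : ℕ, currentTerm m N V p i w := rfl

theorem curSum_eq_sum {n : ℕ} {w : AN m N V} (h : ∀ j : ℤ, n ≤ j → ∀ X, anCurrent hm N V j X w = 0)
    (p : Fin N) : curSum hV p w =
      ∑ i ∈ Finset.range n, (anX m N V (xpow p (-(i : ℤ))) * anCas hm N V p i) w := by
  simp only [← currentTerm_eq]
  refine finsum_eq_sum_of_support_subset _ fun i hi => ?_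
  rw [Finset.coe_range, Set.mem_Iio]
  by_contra hc
  exact hi (currentTerm_eq_zero hm (h i (by omega)) p)

/-- On each vector only finitely many currents act nontrivially, so an operator may be moved through
the infinite sum term by term. -/
theorem mul_curSum (T : Module.End ℂ (AN m N V)) (p q : Fin N)
    (h : ∀ i, T * currentTerm m N V p i = currentTerm m N V q i * T) :
    T * curSum hV p = curSum hV q * T := by
  refine LinearMap.ext fun w => ?_
  rw [Module.End.mul_apply, Module.End.mul_apply, curSum_apply, curSum_apply]
  rw [map_finsum T (currentTerm_finite hV p w)]
  exact finsum_congr fun i => LinearMap.congr_fun (h i) w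

theorem anX_curSum_comm (f : Laurent N) (p : Fin N) : Commute (anX m N V f) (curSum hV p) := by
  by_cases hm : 0 < m
  · refine mul_curSum hV _ p p fun i => ?_
    rw [currentTerm_eq hm]
    exact (anX_anX_comm _ _).mul_right (anL_anCas_comm hm _ _ _)
  -- For m = 0 there are no matrix units, and each summand is an empty sum.
  · refine mul_curSum hV _ p p fun i => ?_
    have : IsEmpty (Fin m) := ⟨fun a => hm a.pos⟩
    simp [currentTerm]

theorem anPerm_mul_curSum (σ : Equiv.Perm (Fin N)) (p : Fin N) :
    anPerm m N V σ * curSum hV p = curSum hV (σ p) * anPerm m N V σ := by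
  by_cases hm : 0 < m
  · refine mul_curSum hV _ _ _ fun i => ?_
    rw [currentTerm_eq hm, currentTerm_eq hm, ← mul_assoc, anPerm_mul_anX, permL_xpow, mul_assoc,
      mul_assoc]
    congr 1
    rw [anPerm_apply, mul_assoc, anCas, permT_mul_casimir (anT_anCurrent_comm hm _), ← mul_assoc,
      ← mul_assoc]
    congr 1
    exact anL_anCas_comm hm _ _ _
  · refine mul_curSum hV _ _ _ fun i => ?_
    have : IsEmpty (Fin m) := ⟨fun a => hm a.pos⟩
    simp [currentTerm]

/-- The operator of `z_p` on `A_N(V)`. -/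
def anZ (κ : ℂ) (p : Fin N) : Module.End ℂ (AN m N V) := anD m N κ V p + curSum hV p

theorem anZ_apply (κ : ℂ) (p : Fin N) (w : AN m N V) :
    anZ hV κ p w = cherednikOp m N κ V p w := by
  have h : anD m N κ V p = (κ • opLT (euler p) 1 + ∑ r ∈ Finset.univ.erase p,
      opLT (dunkl p r) (permT (Equiv.swap p r)) : Module.End ℂ (LT m N)).rTensor V := by
    rw [anD, LinearMap.rTensor_add, LinearMap.rTensor_smul, anL_apply]
    congr 1
    simp only [anL_mul_anT]
    exact (map_sum (LinearMap.rTensorHom V) _ _).symm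
  rw [anZ, LinearMap.add_apply, h]
  rfl

/-- The sum of currents acts on variables only by multiplication, so it drops out of all commutators
with x_q, and these are the commutators of the differential-difference part. -/
theorem an_crossData (κ : ℂ) : CrossData κ (anPerm m N V) (anZ hV κ)
    (fun p => anX m N V (xpow p 1)) (fun p => anX m N V (xpow p (-1))) where
  perm_z σ p := by
    rw [anZ, anZ, mul_add, add_mul, anPerm_mul_anD, anPerm_mul_curSum]
  x_comm p q := anX_anX_comm _ _
  x_mul_y p := by rw [← map_mul, xpow_mul_neg, map_one]
  y_mul_x p := by rw [← map_mul, mul_comm, xpow_mul_neg, map_one]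
  perm_x σ p := by rw [anPerm_mul_anX, permL_xpow]
  z_x_ne p q h := by
    rw [anZ, add_mul, mul_add, (anX_curSum_comm hV _ p).eq, add_sub_add_right_eq_sub,
      anD_mul_anX_ne κ h]
  z_x_eq p := by
    rw [anZ, add_mul, mul_add, (anX_curSum_comm hV _ p).eq, add_sub_add_right_eq_sub,
      anD_mul_anX_eq]

end AN


/-! ### Commutation relations of the `z_p` on `A_N(V)` -/

/-- The left side runs over the pairs (a', b) with a' ≥ 1 and a' + b = k < n, grouped by k. Since τ
vanishes for a' + b ≥ n, the triangle may be completed to a square, from which the row a' = 0 is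
removed. -/
theorem sum_range_sum_range_triangle {M : Type*} [AddCommGroup M] (n : ℕ) (τ : ℕ → ℕ → M)
    (h : ∀ a b, n ≤ a + b → τ a b = 0) :
    ∑ k ∈ Finset.range n, ∑ a ∈ Finset.range k, τ (a + 1) (k - 1 - a) =
      ∑ a ∈ Finset.range n, ∑ b ∈ Finset.range n, τ a b - ∑ b ∈ Finset.range n, τ 0 b := by
  have h1 : ∑ a ∈ Finset.range n, ∑ b ∈ Finset.range n, τ a b - ∑ b ∈ Finset.range n, τ 0 b =
      ∑ a ∈ Finset.range n, ∑ b ∈ Finset.range n, τ (a + 1) b := by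
    have e := Finset.sum_range_succ (fun a => ∑ b ∈ Finset.range n, τ a b) n
    rw [Finset.sum_range_succ', Finset.sum_eq_zero (f := fun b => τ n b)
      fun b _ => h n b (by omega), add_zero] at e
    rw [← e, add_sub_cancel_right]
  rw [h1, Finset.sum_comm' (t' := Finset.range n) (s' := fun a => Finset.Ico (a + 1) n)
    (by intro x y; simp only [Finset.mem_range, Finset.mem_Ico]; omega)]
  refine Finset.sum_congr rfl fun a _ => ?_
  rw [Finset.sum_Ico_eq_sum_range]
  refine Finset.sum_congr_of_eq_on_inter ?_ ?_ ?_
  · intro b hb hb'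
    simp only [Finset.mem_range] at hb hb'
    omega
  · intro b _ hb
    simp only [Finset.mem_range] at hb
    exact h _ _ (by omega)
  · intro b _ _
    congr 1
    omega

section AN

variable {m N : ℕ} {V : Type*} [AddCommGroup V] [Module ℂ V]

/-- The elements `1 ⊗ w` of `A_N(V)`. -/
def IsConstant (w : AN m N V) : Prop :=
  ∀ (D : Module.End ℂ (Laurent N)) (f : Laurent N), anL m N V D (anX m N V f w) = anX m N V (D f) w

theorem isConstant_tmul (t : TPow m N) (v : V) :
    IsConstant (((1 : Laurent N) ⊗ₜ[ℂ] t : LT m N) ⊗ₜ[ℂ] v : AN m N V) := by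
  intro D f
  change ((D (f * 1)) ⊗ₜ[ℂ] t : LT m N) ⊗ₜ[ℂ] v = ((D f * 1) ⊗ₜ[ℂ] t : LT m N) ⊗ₜ[ℂ] v
  rw [mul_one, mul_one]

theorem IsConstant.anL_apply {w : AN m N V} (h : IsConstant w) (D : Module.End ℂ (Laurent N)) :
    anL m N V D w = anX m N V (D 1) w := by
  have := h D 1
  rwa [map_one, Module.End.one_apply] at this

theorem IsConstant.map {w : AN m N V} (h : IsConstant w) {T : Module.End ℂ (AN m N V)}
    (hT : ∀ D, Commute (anL m N V D) T) : IsConstant (T w) := by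
  intro D f
  have h1 : ∀ D w, anL m N V D (T w) = T (anL m N V D w) := fun D => LinearMap.congr_fun (hT D)
  rw [anX_apply, anX_apply, h1, h1, h1, ← anX_apply, ← anX_apply, h D f]

theorem IsConstant.anPerm_apply {w : AN m N V} (h : IsConstant w) (σ : Equiv.Perm (Fin N)) :
    anPerm m N V σ w = anT m N V (permT σ) w := by
  rw [AST.anPerm_apply, (anL_anT_comm _ _).eq, Module.End.mul_apply, h.anL_apply,
    AlgHom.toLinearMap_apply, map_one, map_one, Module.End.one_apply]

theorem IsConstant.anD_anX {w : AN m N V} (h : IsConstant w) (κ : ℂ) (p : Fin N) (f : Laurent N) :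
    anD m N κ V p (anX m N V f w) = κ • anX m N V (euler p f) w + ∑ r ∈ Finset.univ.erase p,
      anX m N V (dunkl p r f) (anT m N V (permT (Equiv.swap p r)) w) := by
  have hT : ∀ g f, anT m N V g (anX m N V f w) = anX m N V f (anT m N V g w) := fun g f =>
    (LinearMap.congr_fun (anL_anT_comm (m := m) (V := V) (LinearMap.mulLeft ℂ f) g) w).symm
  rw [anD, LinearMap.add_apply, LinearMap.smul_apply, h, LinearMap.sum_apply]
  congr 1
  refine Finset.sum_congr rfl fun r _ => ?_
  rw [Module.End.mul_apply, hT]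
  exact (h.map fun D => anL_anT_comm D _) _ _

/-- Both x_p ∂_p and all divided differences kill the constant 1. -/
theorem IsConstant.anD_eq_zero {w : AN m N V} (h : IsConstant w) (κ : ℂ) (p : Fin N) :
    anD m N κ V p w = 0 := by
  have h1 := h.anD_anX κ p 1
  rw [map_one, Module.End.one_apply, euler_one, map_zero, LinearMap.zero_apply, smul_zero,
    zero_add] at h1
  rw [h1]
  refine Finset.sum_eq_zero fun r hr => ?_
  rw [dunkl_one (Finset.ne_of_mem_erase hr).symm, map_zero, LinearMap.zero_apply]

/-- The monomial x_q^{-k} does not involve x_p, and it is fixed by σ_pr unless r = q; so a single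
divided difference remains, and it is the finite geometric sum `negSum`. -/
theorem IsConstant.anD_xpow {w : AN m N V} (h : IsConstant w) (κ : ℂ) {p q : Fin N} (hpq : p ≠ q)
    (k : ℕ) : anD m N κ V p (anX m N V (xpow q (-k)) w) =
      anX m N V (negSum p q k) (anT m N V (permT (Equiv.swap p q)) w) := by
  rw [h.anD_anX, euler_xpow, if_neg hpq, zero_smul, map_zero, LinearMap.zero_apply, smul_zero,
    zero_add, Finset.sum_eq_single q]
  · rw [dunkl_xpow_right_neg hpq]
  · intro r hr hrq
    rw [dunkl_xpow_of_ne (Finset.ne_of_mem_erase hr).symm hpq.symm hrq.symm, map_zero,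
      LinearMap.zero_apply]
  · intro hq
    exact absurd (Finset.mem_erase.2 ⟨hpq.symm, Finset.mem_univ q⟩) hq

/-- An operator that commutes with Laurent polynomials is determined by its values on `1 ⊗ w`. -/
theorem anX_linear_eq_zero {T : Module.End ℂ (AN m N V)} (hT : ∀ f, Commute T (anX m N V f))
    (h : ∀ (t : TPow m N) (v : V), T (((1 : Laurent N) ⊗ₜ[ℂ] t : LT m N) ⊗ₜ[ℂ] v) = 0) : T = 0 := by
  refine TensorProduct.ext' fun y v => ?_
  have h1 : T ∘ₗ (TensorProduct.mk ℂ (LT m N) V).flip v = 0 := by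
    refine TensorProduct.ext' (M := Laurent N) (N := TPow m N) fun f t => ?_
    have h2 : anX m N V f (((1 : Laurent N) ⊗ₜ[ℂ] t : LT m N) ⊗ₜ[ℂ] v) =
        ((f ⊗ₜ[ℂ] t : LT m N) ⊗ₜ[ℂ] v : AN m N V) := by
      change ((f * 1) ⊗ₜ[ℂ] t : LT m N) ⊗ₜ[ℂ] v = _
      rw [mul_one]
      rfl
    change T ((f ⊗ₜ[ℂ] t : LT m N) ⊗ₜ[ℂ] v) = 0
    rw [← h2, ← Module.End.mul_apply, (hT f).eq, Module.End.mul_apply, h, map_zero]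
  exact LinearMap.congr_fun h1 y

variable [LieRingModule (Affine m) V] [LieModule ℂ (Affine m) V] (hm : 0 < m)

theorem anCas_commutator {p q : Fin N} (h : p ≠ q) {i j : ℤ} (hi : 0 ≤ i) (hj : 0 ≤ j) :
    anCas hm N V p i * anCas hm N V q j - anCas hm N V q j * anCas hm N V p i =
      anT m N V (permT (Equiv.swap p q)) * (anCas hm N V p (i + j) - anCas hm N V q (i + j)) :=
  casimir_commutator_siteIn (anT_anCurrent_comm hm i) (anT_anCurrent_comm hm j)
    (anCurrent_lie_nonneg hm hi hj) h

/-- Applying Ω_q^(k) with k ≥ 0 does not spoil the bound: commuting t^j past t^k yields t^{j+k} with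
j + k ≥ n, and no central term. One truncation therefore serves both applications of the z's. -/
theorem anCurrent_anCas_eq_zero {n : ℕ} (hn : 0 < n) {w : AN m N V}
    (hw : ∀ j : ℤ, n ≤ j → ∀ X, anCurrent hm N V j X w = 0) (q : Fin N) (k : ℕ) {j : ℤ}
    (hj : n ≤ j) (X : Matrix (Fin m) (Fin m) ℂ) : anCurrent hm N V j X (anCas hm N V q k w) = 0 := by
  have h1 : ∀ Y, anCurrent hm N V j X (anCurrent hm N V k Y w) = 0 := fun Y => by
    have := LinearMap.congr_fun (anCurrent_lie_nonneg (V := V) (N := N) hm (by omega : 0 ≤ j)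
      (by omega : (0 : ℤ) ≤ k) X Y) w
    rw [LinearMap.sub_apply, Module.End.mul_apply, Module.End.mul_apply, hw j hj, map_zero,
      sub_zero, hw (j + k) (by omega)] at this
    exact this
  simp only [anCas, casimir, LinearMap.sum_apply, map_sum, Module.End.mul_apply]
  refine Finset.sum_eq_zero fun a _ => Finset.sum_eq_zero fun b _ => ?_
  have h2 := LinearMap.congr_fun (anT_anCurrent_comm (V := V) hm j (site q (Matrix.single a b 1)) X).eq
    (anCurrent hm N V k (Matrix.single b a 1) w)
  rw [Module.End.mul_apply, Module.End.mul_apply, h1, map_zero] at h2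
  exact h2.symm

variable (hV : IsSmooth m V)

theorem IsConstant.anZ_apply {w : AN m N V} (h : IsConstant w) {n : ℕ}
    (hw : ∀ j : ℤ, n ≤ j → ∀ X, anCurrent hm N V j X w = 0) (κ : ℂ) (p : Fin N) :
    anZ hV κ p w = ∑ k ∈ Finset.range n, anX m N V (xpow p (-(k : ℤ))) (anCas hm N V p k w) := by
  rw [anZ, LinearMap.add_apply, h.anD_eq_zero, zero_add, curSum_eq_sum hm hV hw]
  rfl

/-- The inner z_q gives ∑ x_q^{-k} Ω_q^(k) w. Its divided differences, regrouped by
`sum_range_sum_range_triangle`, give a full double sum of x_q^{-a} x_p^{-b} σ_pq Ω_q^(a+b) w minus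
its row a = 0; the currents of z_p give the products Ω_p^(b) Ω_q^(a). -/
theorem IsConstant.anZ_anZ_apply {w : AN m N V} (h : IsConstant w) {n : ℕ} (hn : 0 < n)
    (hw : ∀ j : ℤ, n ≤ j → ∀ X, anCurrent hm N V j X w = 0) (κ : ℂ) {p q : Fin N} (hpq : p ≠ q) :
    anZ hV κ p (anZ hV κ q w) =
      ∑ a ∈ Finset.range n, ∑ b ∈ Finset.range n, anX m N V (xpow q (-(a : ℤ)) * xpow p (-(b : ℤ)))
        (anT m N V (permT (Equiv.swap p q)) (anCas hm N V q (a + b : ℕ) w)) -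
      ∑ b ∈ Finset.range n, anX m N V (xpow p (-(b : ℤ)))
        (anT m N V (permT (Equiv.swap p q)) (anCas hm N V q b w)) +
      ∑ a ∈ Finset.range n, ∑ b ∈ Finset.range n, anX m N V (xpow q (-(a : ℤ)) * xpow p (-(b : ℤ)))
        (anCas hm N V p b (anCas hm N V q a w)) := by
  have h1 := sum_range_sum_range_triangle n (fun a b => anX m N V
    (xpow q (-(a : ℤ)) * xpow p (-(b : ℤ))) (anT m N V (permT (Equiv.swap p q))
      (anCas hm N V q (a + b : ℕ) w))) (fun a b hab => by
        rw [anCas_eq_zero hm (hw _ (by exact_mod_cast hab)), map_zero, map_zero])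
  have h2 : ∀ k, IsConstant (anCas hm N V q k w) := fun k =>
    h.map fun D => anL_anCas_comm hm D q k
  have h3 : ∀ k : ℕ, curSum hV p (anX m N V (xpow q (-(k : ℤ))) (anCas hm N V q k w)) =
      ∑ b ∈ Finset.range n, anX m N V (xpow q (-(k : ℤ)) * xpow p (-(b : ℤ)))
        (anCas hm N V p b (anCas hm N V q k w)) := fun k => by
    rw [← Module.End.mul_apply, ← (anX_curSum_comm hV _ p).eq, Module.End.mul_apply,
      curSum_eq_sum hm hV fun j hj X => anCurrent_anCas_eq_zero hm hn hw q k hj X, map_sum]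
    simp only [map_mul, Module.End.mul_apply]
  have h4 : ∀ k : ℕ, anX m N V (negSum p q k) (anT m N V (permT (Equiv.swap p q))
      (anCas hm N V q k w)) = ∑ a ∈ Finset.range k, anX m N V
      (xpow q (-((a + 1 : ℕ) : ℤ)) * xpow p (-((k - 1 - a : ℕ) : ℤ)))
      (anT m N V (permT (Equiv.swap p q)) (anCas hm N V q (a + 1 + (k - 1 - a) : ℕ) w)) :=
    fun k => by
      rw [negSum, map_sum, LinearMap.sum_apply]
      refine Finset.sum_congr rfl fun a ha => ?_
      have ha' := Finset.mem_range.1 ha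
      have e1 : (a + 1 + (k - 1 - a) : ℕ) = k := by omega
      have e2 : ((k - 1 - a : ℕ) : ℤ) = k - 1 - a := by omega
      rw [e1, e2, Nat.cast_add, Nat.cast_one]
  rw [h.anZ_apply hm hV hw, map_sum]
  simp only [anZ, LinearMap.add_apply, (h2 _).anD_xpow κ hpq, h3, h4]
  rw [Finset.sum_add_distrib, h1]
  simp only [Nat.cast_zero, neg_zero, xpow_zero, one_mul, zero_add]

/-- The defect is linear over Laurent polynomials, so it is evaluated on w = 1 ⊗ t ⊗ v. In the
difference of the two double applications the products of Casimir operators cancel against the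
double sums by Yang-Baxter. The two rows that were split off are left, and they add up to σ_pq (z_p
− z_q) w. -/
theorem an_zDefect (hm : 0 < m) (κ : ℂ) {p q : Fin N} (hpq : p ≠ q) :
    zDefect (anPerm m N V) (anZ hV κ) p q = 0 := by
  refine anX_linear_eq_zero (fun f => ?_) fun t v => ?_
  · refine (commute_of_adjoin_eq_top (adjoin_xpow N) (anX m N V) _ ?_ f).symm
    rintro _ (⟨r, rfl⟩ | ⟨r, rfl⟩)
    · exact ((an_crossData hV κ).zDefect_comm hpq r).symm
    · exact ((an_crossData hV κ).zDefect_comm_y hpq r).symm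
  · set w : AN m N V := ((1 : Laurent N) ⊗ₜ[ℂ] t : LT m N) ⊗ₜ[ℂ] v
    have h : IsConstant w := isConstant_tmul t v
    obtain ⟨n, hn, hw⟩ := exists_current_bound hm hV w
    have hs : ∀ (r : Fin N) (k : ℕ), anPerm m N V (Equiv.swap p q)
        (anX m N V (xpow r (-(k : ℤ))) (anCas hm N V r k w)) =
        anX m N V (xpow (Equiv.swap p q r) (-(k : ℤ))) (anT m N V (permT (Equiv.swap p q))
          (anCas hm N V r k w)) := fun r k => by
      rw [← Module.End.mul_apply, anPerm_mul_anX, permL_xpow, Module.End.mul_apply,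
        (h.map fun D => anL_anCas_comm hm D r k).anPerm_apply]
    -- Yang-Baxter for the pair of currents t^b, t^a puts all products in the order Ω_q Ω_p, at the
    -- cost of terms at t^{a+b}.
    have hc : ∀ a b : ℕ, anCas hm N V p b (anCas hm N V q a w) =
        anCas hm N V q a (anCas hm N V p b w) + anT m N V (permT (Equiv.swap p q))
          (anCas hm N V p (a + b : ℕ) w) - anT m N V (permT (Equiv.swap p q))
          (anCas hm N V q (a + b : ℕ) w) := fun a b => by
      have := LinearMap.congr_fun (anCas_commutator (V := V) hm hpq (by omega : (0 : ℤ) ≤ b)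
        (by omega : (0 : ℤ) ≤ a)) w
      rw [mul_sub] at this
      simp only [LinearMap.sub_apply, Module.End.mul_apply] at this
      rw [sub_eq_iff_eq_add'] at this
      rw [this, add_sub_assoc, Nat.cast_add, add_comm (b : ℤ)]
    rw [zDefect, LinearMap.sub_apply, LinearMap.sub_apply, Module.End.mul_apply,
      Module.End.mul_apply, Module.End.mul_apply, LinearMap.sub_apply, map_sub,
      h.anZ_anZ_apply hm hV hn hw κ hpq, h.anZ_anZ_apply hm hV hn hw κ hpq.symm,
      h.anZ_apply hm hV hw, h.anZ_apply hm hV hw, map_sum, map_sum, Equiv.swap_comm q p]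
    simp only [hs, hc, Equiv.swap_apply_left, Equiv.swap_apply_right, map_add, map_sub,
      Finset.sum_add_distrib, Finset.sum_sub_distrib]
    have e1 : ∀ F : ℕ → ℕ → AN m N V, (∑ a ∈ Finset.range n, ∑ b ∈ Finset.range n,
        anX m N V (xpow p (-(a : ℤ)) * xpow q (-(b : ℤ))) (F a b)) =
        ∑ a ∈ Finset.range n, ∑ b ∈ Finset.range n,
          anX m N V (xpow q (-(a : ℤ)) * xpow p (-(b : ℤ))) (F b a) := fun F => by
      rw [Finset.sum_comm]
      simp only [mul_comm]
    rw [e1, e1]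
    have e2 : ∀ a b : ℕ, b + a = a + b := fun a b => add_comm b a
    simp only [e2]
    abel

theorem an_heckeData (hm : 0 < m) (κ : ℂ) : HeckeData (anPerm m N V) (anZ hV κ) where
  perm_z := (an_crossData hV κ).perm_z
  z_comm _ _ h := sub_eq_zero.1 (an_zDefect hV hm κ h)

/-- The action of the Cherednik algebra on `A_N(V)`. -/
def anRep (κ : ℂ) : Cherednik N κ →ₐ[ℂ] Module.End ℂ (AN m N V) :=
  (an_crossData hV κ).lift (an_heckeData hV hm κ)

theorem anRep_perm (κ : ℂ) (σ : Equiv.Perm (Fin N)) :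
    anRep hm hV κ (heckeToCherednik N κ (HeckeAlg.perm σ)) = anPerm m N V σ :=
  ((an_crossData hV κ).lift_hecke _ _).trans (HeckeData.lift_perm _ σ)

theorem anRep_z (κ : ℂ) (p : Fin N) :
    anRep hm hV κ (heckeToCherednik N κ (HeckeAlg.z p)) = anZ hV κ p :=
  ((an_crossData hV κ).lift_hecke _ _).trans (HeckeData.lift_z _ p)

theorem anRep_x (κ : ℂ) (p : Fin N) : anRep hm hV κ (Cherednik.x κ p) = anX m N V (xpow p 1) :=
  (an_crossData hV κ).lift_x _ p

theorem anRep_xinv (κ : ℂ) (p : Fin N) :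
    anRep hm hV κ (Cherednik.xinv κ p) = anX m N V (xpow p (-1)) :=
  (an_crossData hV κ).lift_xinv _ p

theorem anRep_isCherednikAction (κ : ℂ) : IsCherednikAction m N κ V (anRep hm hV κ) where
  x p := anRep_x hm hV κ p
  xinv p := anRep_xinv hm hV κ p
  perm σ := (anRep_perm hm hV κ σ).trans (anL_mul_anT _ _)
  z p w := by rw [anRep_z, anZ_apply]

end AN


/-! ### Commutators of the `z_p` with negative currents -/

section Matrices

variable {m : ℕ}

theorem sum_single_mul_mul_single (X : Matrix (Fin m) (Fin m) ℂ) :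
    ∑ a, ∑ b, Matrix.single b a 1 * X * Matrix.single a b 1 = X.trace • 1 := by
  have h : ∀ a b, Matrix.single b a 1 * X * Matrix.single a b 1 = X a a • Matrix.single b b (1 : ℂ) :=
    fun a b => by
      rw [single_mul_eq_sum, Finset.sum_mul, Finset.sum_eq_single a]
      · rw [smul_mul_assoc, Matrix.single_mul_single_same, mul_one]
      · intro c _ hc
        rw [smul_mul_assoc, Matrix.single_mul_single_of_ne _ _ _ _ hc, smul_zero]
      · intro h
        exact absurd (Finset.mem_univ a) h
  simp only [h, ← Finset.smul_sum, ← Finset.sum_smul]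
  congr 1
  ext i j
  by_cases hij : i = j
  · subst hij; simp [Matrix.sum_apply, Matrix.single_apply]
  · rw [Matrix.one_apply_ne hij, Matrix.sum_apply]
    refine Finset.sum_eq_zero fun b _ => Matrix.single_apply_of_ne _ _ _ _ _ fun h => ?_
    exact hij (h.1.symm.trans h.2)

/-- Here ∑ E_ba X E_ab = tr X and ∑ E_ba E_ab = m. The factor −m on traceless matrices is the shift
in the level κ − m. -/
theorem sum_commutator_mul_single (X : Matrix (Fin m) (Fin m) ℂ) :
    ∑ a, ∑ b, (Matrix.single b a 1 * X - X * Matrix.single b a 1) * Matrix.single a b 1 =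
      X.trace • 1 - (m : ℂ) • X := by
  have h1 := sum_single_mul_mul_single X
  have h2 := sum_single_mul_mul_single (1 : Matrix (Fin m) (Fin m) ℂ)
  rw [Matrix.trace_one, Fintype.card_fin] at h2
  simp only [sub_mul, Finset.sum_sub_distrib, h1]
  simp only [mul_one] at h2
  simp only [mul_assoc, ← Finset.mul_sum, h2, mul_smul_comm, mul_one]

/-- The reproducing property of the trace form, which reassembles X from the central terms of the
currents. -/
theorem sum_trace_smul_single (X : Matrix (Fin m) (Fin m) ℂ) :
    ∑ a, ∑ b, Matrix.trace (Matrix.single b a 1 * X) • Matrix.single a b (1 : ℂ) = X := by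
  conv_rhs => rw [Matrix.matrix_eq_sum_single X]
  refine Finset.sum_congr rfl fun a _ => Finset.sum_congr rfl fun b _ => ?_
  rw [Matrix.trace_single_mul, Matrix.smul_single]
  simp

end Matrices

/-- The twisted Leibniz rule with the transposition on the multiplier. This form suits diagonal sums
∑ x_q^j X^(q), which are invariant under simultaneous permutation of variables and factors. -/
theorem dunkl_mul_mulLeft' {p r : Fin N} (h : p ≠ r) (f : Laurent N) :
    dunkl p r * LinearMap.mulLeft ℂ f = LinearMap.mulLeft ℂ (permL (Equiv.swap p r) f) * dunkl p r +
      LinearMap.mulLeft ℂ (dunkl p r f) :=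
  LinearMap.ext fun g => by
    change dunkl p r (f * g) = permL (Equiv.swap p r) f * dunkl p r g + dunkl p r f * g
    rw [mul_comm f g, dunkl_mul h]
    ring


/-! ### Commutators with negative currents, for commuting families of operators in an abstract
algebra -/

section Operators

variable {m N : ℕ} {A : Type*} [Ring A] [Algebra ℂ A] (L : Module.End ℂ (Laurent N) →ₐ[ℂ] A)
  (T : Module.End ℂ (TPow m N) →ₐ[ℂ] A)

/-- Multiplication by Laurent polynomials, in an algebra to which the operators on Laurent
polynomials are mapped. -/
def multIn : Laurent N →ₐ[ℂ] A := L.comp (Algebra.lmul ℂ (Laurent N))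

theorem multIn_apply (f : Laurent N) : multIn L f = L (LinearMap.mulLeft ℂ f) := rfl

/-- The operator `∑_q x_q^j ⊗ X^{(q)}`. -/
def loopIn (j : ℤ) (X : Matrix (Fin m) (Fin m) ℂ) : A :=
  ∑ q, multIn L (xpow q j) * siteIn T q X

variable {L T} 
theorem perm_loopIn_comm (hLT : ∀ f g, Commute (L f) (T g)) (σ : Equiv.Perm (Fin N)) (j : ℤ) (X : Matrix (Fin m) (Fin m) ℂ) :
    Commute (L (permL σ).toLinearMap * T (permT σ)) (loopIn L T j X) := by
  change _ * _ = _ * _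
  have h : ∀ q, L (permL σ).toLinearMap * T (permT σ) * (multIn L (xpow q j) * siteIn T q X) =
      multIn L (xpow (σ q) j) * siteIn T (σ q) X * (L (permL σ).toLinearMap * T (permT σ)) :=
    fun q => by
    have e1 : L (permL σ).toLinearMap * multIn L (xpow q j) =
        multIn L (xpow (σ q) j) * L (permL σ).toLinearMap := by
      rw [multIn_apply, multIn_apply, ← map_mul, permL_mul_mulLeft, map_mul, permL_xpow]
    have e2 : T (permT σ) * multIn L (xpow q j) = multIn L (xpow q j) * T (permT σ) :=
      (hLT _ _).eq.symm
    have e3 : L (permL σ).toLinearMap * siteIn T (σ q) X =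
      siteIn T (σ q) X * L (permL σ).toLinearMap := hLT _ _
    rw [mul_assoc, ← mul_assoc (T _), e2, mul_assoc _ (T _), permT_mul_siteIn, ← mul_assoc, e1,
      mul_assoc, ← mul_assoc (L _), e3]
    simp only [mul_assoc]
  rw [loopIn, Finset.mul_sum, Finset.sum_mul]
  simp only [h]
  exact Equiv.sum_comp σ fun q =>
    multIn L (xpow q j) * siteIn T q X * (L (permL σ).toLinearMap * T (permT σ))

theorem multIn_loopIn_comm (hLT : ∀ f g, Commute (L f) (T g)) (f : Laurent N) (j : ℤ) (X : Matrix (Fin m) (Fin m) ℂ) :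
    Commute (multIn L f) (loopIn L T j X) :=
  Commute.sum_right _ _ _ fun _ _ => ((Commute.all f _).map (multIn L)).mul_right (hLT _ _)

/-- The twisted part of the Leibniz rule only permutes the summands of the loop operator. The
derivative part sees q = p and q = r alone, where x_p^{-n} and x_r^{-n} have opposite divided
differences while the permutation exchanges X^(p) and X^(r). -/
theorem dunkl_loopIn (hLT : ∀ f g, Commute (L f) (T g)) {p r : Fin N} (h : p ≠ r) (n : ℕ) (X : Matrix (Fin m) (Fin m) ℂ) :
    L (dunkl p r) * T (permT (Equiv.swap p r)) * loopIn L T (-n) X -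
      loopIn L T (-n) X * (L (dunkl p r) * T (permT (Equiv.swap p r))) =
    multIn L (negSum p r n) * ((siteIn T p X - siteIn T r X) * T (permT (Equiv.swap p r))) := by
  set P := T (permT (Equiv.swap p r))
  set σ := Equiv.swap p r
  have h1 : ∀ q, L (dunkl p r) * P * (multIn L (xpow q (-n)) * siteIn T q X) =
      multIn L (xpow (σ q) (-n)) * siteIn T (σ q) X * (L (dunkl p r) * P) +
      multIn L (dunkl p r (xpow q (-n))) * siteIn T (σ q) X * P := fun q => by
    have e1 : L (dunkl p r) * multIn L (xpow q (-n)) =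
        multIn L (xpow (σ q) (-n)) * L (dunkl p r) + multIn L (dunkl p r (xpow q (-n))) := by
      rw [multIn_apply, ← map_mul, dunkl_mul_mulLeft' h, map_add, map_mul, permL_xpow]
      rfl
    have e2 : P * multIn L (xpow q (-n)) = multIn L (xpow q (-n)) * P := (hLT _ _).eq.symm
    have e3 : P * siteIn T q X = siteIn T (σ q) X * P := permT_mul_siteIn _ _ _ _
    have e4 : L (dunkl p r) * siteIn T (σ q) X = siteIn T (σ q) X * L (dunkl p r) := hLT _ _
    rw [mul_assoc, ← mul_assoc P, e2, mul_assoc _ P, e3, ← mul_assoc, e1, add_mul]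
    congr 1
    · rw [mul_assoc, ← mul_assoc (L _), e4]
      simp only [mul_assoc]
    · rw [mul_assoc]
  have h2 : ∑ q, multIn L (xpow (σ q) (-n)) * siteIn T (σ q) X = loopIn L T (-n) X :=
    Equiv.sum_comp σ fun q => multIn L (xpow q (-n)) * siteIn T q X
  have h3 : ∑ q, multIn L (dunkl p r (xpow q (-n))) * siteIn T (σ q) X =
      multIn L (negSum p r n) * (siteIn T p X - siteIn T r X) := by
    rw [← Finset.sum_subset (Finset.subset_univ {p, r}), Finset.sum_pair h, dunkl_xpow_left_neg h,
      dunkl_xpow_right_neg h, Equiv.swap_apply_left, Equiv.swap_apply_right, map_neg, mul_sub,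
      neg_mul, neg_add_eq_sub]
    intro q _ hq
    rw [Finset.mem_insert, Finset.mem_singleton, not_or] at hq
    rw [dunkl_xpow_of_ne h hq.1 hq.2, map_zero, zero_mul]
  have h4 : L (dunkl p r) * P * loopIn L T (-n) X = loopIn L T (-n) X * (L (dunkl p r) * P) +
      multIn L (negSum p r n) * ((siteIn T p X - siteIn T r X) * P) := by
    rw [← mul_assoc (multIn L _), ← h3, ← h2, Finset.sum_mul, Finset.sum_mul,
      ← Finset.sum_add_distrib, h2, loopIn, Finset.mul_sum]
    exact Finset.sum_congr rfl fun q _ => h1 q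
  rw [h4, add_sub_cancel_left]

theorem euler_loopIn (hLT : ∀ f g, Commute (L f) (T g)) (p : Fin N) (n : ℕ) (X : Matrix (Fin m) (Fin m) ℂ) :
    L (euler p) * loopIn L T (-n) X - loopIn L T (-n) X * L (euler p) =
      (-(n : ℂ)) • (multIn L (xpow p (-n)) * siteIn T p X) := by
  have h1 : ∀ q, L (euler p) * (multIn L (xpow q (-n)) * siteIn T q X) -
      multIn L (xpow q (-n)) * siteIn T q X * L (euler p) =
      ((Pi.single q (-(n : ℤ)) : Fin N → ℤ) p : ℂ) •
        (multIn L (xpow q (-n)) * siteIn T q X) := fun q => by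
    have e : L (euler p) * siteIn T q X = siteIn T q X * L (euler p) := hLT _ _
    rw [mul_assoc, ← e, ← mul_assoc, ← mul_assoc, ← sub_mul, xpow,
      multIn_apply, ← map_mul, ← map_mul, euler_mul_mulLeft, ← map_sub, add_sub_cancel_left,
      map_smul, smul_mul_assoc]
  rw [loopIn, Finset.mul_sum, Finset.sum_mul, ← Finset.sum_sub_distrib]
  simp only [h1]
  rw [Finset.sum_eq_single p]
  · rw [Pi.single_eq_same]; push_cast; rfl
  · intro q _ hq
    rw [Pi.single_eq_of_ne hq.symm, Int.cast_zero, zero_smul]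
  · intro h
    exact absurd (Finset.mem_univ p) h

theorem siteIn_trace_zero_sum (p : Fin N) (X : Matrix (Fin m) (Fin m) ℂ) (hX : X.trace = 0) :
    ∑ a, ∑ b, siteIn T p (Matrix.single b a 1 * X - X * Matrix.single b a 1) *
      siteIn T p (Matrix.single a b 1) = -((m : ℂ) • siteIn T p X) := by
  simp only [← siteIn_mul, ← map_sum]
  rw [sum_commutator_mul_single, hX, zero_smul, zero_sub, map_neg, map_smul]

/-- As σ_pr is the Casimir operator of the two factors, the sum is σ_pr X^(r) − X^(r) σ_pr, and σ_pr
X^(r) = X^(p) σ_pr. -/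
theorem siteIn_ne_sum {p r : Fin N} (h : p ≠ r) (X : Matrix (Fin m) (Fin m) ℂ) :
    ∑ a, ∑ b, siteIn T r (Matrix.single b a 1 * X - X * Matrix.single b a 1) *
      siteIn T p (Matrix.single a b 1) =
    (siteIn T p X - siteIn T r X) * T (permT (Equiv.swap p r)) := by
  have h1 : siteIn T p X * T (permT (Equiv.swap p r)) =
      T (permT (Equiv.swap p r)) * siteIn T r X := by
    rw [permT_mul_siteIn, Equiv.swap_apply_right]
  rw [sub_mul, h1, ← casimir_siteIn _ h, casimir, Finset.sum_mul, Finset.mul_sum,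
    ← Finset.sum_sub_distrib]
  refine Finset.sum_congr rfl fun a _ => ?_
  rw [Finset.sum_mul, Finset.mul_sum, ← Finset.sum_sub_distrib]
  refine Finset.sum_congr rfl fun b _ => ?_
  have h2 : ∀ Y, siteIn T r Y * siteIn T p (Matrix.single a b 1) =
    siteIn T p (Matrix.single a b 1) * siteIn T r Y := fun Y => (siteIn_comm T h _ _).symm
  rw [map_sub, sub_mul, h2 (Matrix.single b a 1 * X), siteIn_mul, siteIn_mul,
    mul_assoc (siteIn T r X), h2 (Matrix.single b a 1)]
  congr 1
  rw [← mul_assoc]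

theorem negSum_eq (p r : Fin N) (n : ℕ) :
    negSum p r n = ∑ i ∈ Finset.range n, xpow r ((i : ℤ) - n) * xpow p (-(i : ℤ)) := by
  rw [negSum, ← Finset.sum_range_reflect]
  refine Finset.sum_congr rfl fun i hi => ?_
  have := Finset.mem_range.1 hi
  congr 2 <;> omega

/-- This is the loop part of the expected commutator. In the factor q = p all powers of x_p combine
to x_p^{-n}, each of the n values of i contributing −m X^(p); in a factor r ≠ p the monomials
x_r^{i-n} x_p^{-i} add up to `negSum`, matching the divided differences. -/
theorem sum_loopIn (hLT : ∀ f g, Commute (L f) (T g)) (p : Fin N) (n : ℕ) (X : Matrix (Fin m) (Fin m) ℂ) (hX : X.trace = 0) :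
    ∑ i ∈ Finset.range n, ∑ a, ∑ b,
      loopIn L T ((i : ℤ) - n) (Matrix.single b a 1 * X - X * Matrix.single b a 1) *
        (multIn L (xpow p (-(i : ℤ))) * siteIn T p (Matrix.single a b 1)) =
    -(((n : ℂ) * m) • (multIn L (xpow p (-n)) * siteIn T p X)) +
      ∑ r ∈ Finset.univ.erase p, multIn L (negSum p r n) *
        ((siteIn T p X - siteIn T r X) * T (permT (Equiv.swap p r))) := by
  have h1 : ∀ i : ℕ, ∑ a, ∑ b,
      loopIn L T ((i : ℤ) - n) (Matrix.single b a 1 * X - X * Matrix.single b a 1) *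
        (multIn L (xpow p (-(i : ℤ))) * siteIn T p (Matrix.single a b 1)) =
      ∑ q, multIn L (xpow q ((i : ℤ) - n) * xpow p (-(i : ℤ))) * ∑ a, ∑ b,
        siteIn T q (Matrix.single b a 1 * X - X * Matrix.single b a 1) *
          siteIn T p (Matrix.single a b 1) := fun i => by
    simp only [loopIn, Finset.sum_mul, Finset.mul_sum]
    conv_rhs => rw [Finset.sum_comm]
    refine Finset.sum_congr rfl fun a _ => ?_
    conv_rhs => rw [Finset.sum_comm]
    refine Finset.sum_congr rfl fun b _ => Finset.sum_congr rfl fun q _ => ?_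
    have e : siteIn T q (Matrix.single b a 1 * X - X * Matrix.single b a 1) *
        multIn L (xpow p (-(i : ℤ))) = multIn L (xpow p (-(i : ℤ))) *
          siteIn T q (Matrix.single b a 1 * X - X * Matrix.single b a 1) := (hLT _ _).eq.symm
    rw [map_mul, mul_assoc, ← mul_assoc (siteIn T q _), e]
    simp only [mul_assoc]
  simp only [h1]
  rw [Finset.sum_comm, ← Finset.add_sum_erase _ _ (Finset.mem_univ p)]
  congr 1
  · have h2 : ∀ i : ℕ, xpow p ((i : ℤ) - n) * xpow p (-(i : ℤ)) = xpow p (-n) := fun i => by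
      rw [← xpow_add]; congr 1; ring
    simp only [h2, siteIn_trace_zero_sum p X hX]
    rw [Finset.sum_const, Finset.card_range, mul_neg, mul_smul_comm, smul_neg, ← Nat.cast_smul_eq_nsmul ℂ,
      smul_smul]
  · refine Finset.sum_congr rfl fun r hr => ?_
    rw [siteIn_ne_sum (Finset.ne_of_mem_erase hr).symm, negSum_eq, map_sum, Finset.sum_mul]

/-! #### Currents -/

variable {φ : ℤ → Matrix (Fin m) (Fin m) ℂ →ₗ[ℂ] A}

/-- The operator `∑_{a,b} E_ab^{(p)} ⊗ [E_ba, X] t^k`. -/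
def adIn (T : Module.End ℂ (TPow m N) →ₐ[ℂ] A) (φ : ℤ → Matrix (Fin m) (Fin m) ℂ →ₗ[ℂ] A)
    (p : Fin N) (k : ℤ) (X : Matrix (Fin m) (Fin m) ℂ) : A :=
  ∑ a, ∑ b, siteIn T p (Matrix.single a b 1) *
    φ k (Matrix.single b a 1 * X - X * Matrix.single b a 1)

/-- Only the factor q = p fails to commute with the Casimir operator, and there `casimir_invariant`
turns the commutator into one in the current slot. -/
theorem casimir_loopIn (hLT : ∀ f g, Commute (L f) (T g)) (hLφ : ∀ f i X, Commute (L f) (φ i X))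
    (hTφ : ∀ g i X, Commute (T g) (φ i X)) (p : Fin N) (i j : ℤ)
    (X : Matrix (Fin m) (Fin m) ℂ) :
    casimir (siteIn T p) (φ i) * loopIn L T j X - loopIn L T j X * casimir (siteIn T p) (φ i) =
      -(multIn L (xpow p j) * adIn T φ p i X) := by
  have h1 : ∀ f, multIn L f * casimir (siteIn T p) (φ i) =
      casimir (siteIn T p) (φ i) * multIn L f := fun f =>
    Commute.sum_right _ _ _ fun _ _ => Commute.sum_right _ _ _ fun _ _ =>
      (hLT _ _).mul_right (hLφ _ _ _)
  have h2 : ∀ q, q ≠ p → casimir (siteIn T p) (φ i) * siteIn T q X =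
      siteIn T q X * casimir (siteIn T p) (φ i) := fun q hq =>
    Commute.sum_left _ _ _ fun _ _ => Commute.sum_left _ _ _ fun _ _ =>
      (siteIn_comm _ hq.symm _ _).mul_left (hTφ _ _ _).symm
  have h3 : casimir (siteIn T p) (φ i) * siteIn T p X - siteIn T p X * casimir (siteIn T p) (φ i) =
      -adIn T φ p i X := casimir_invariant (siteIn_mul _ p) X fun Y => hTφ _ _ Y
  have h4 : ∀ q, casimir (siteIn T p) (φ i) * (multIn L (xpow q j) * siteIn T q X) -
      multIn L (xpow q j) * siteIn T q X * casimir (siteIn T p) (φ i) = multIn L (xpow q j) *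
        (casimir (siteIn T p) (φ i) * siteIn T q X - siteIn T q X * casimir (siteIn T p) (φ i)) :=
    fun q => by rw [← mul_assoc, ← h1, mul_sub, mul_assoc, mul_assoc]
  rw [loopIn, Finset.mul_sum, Finset.sum_mul, ← Finset.sum_sub_distrib, Finset.sum_eq_single p]
  · rw [h4, h3, mul_neg]
  · intro q _ hq
    rw [h4, h2 q hq, sub_self, mul_zero]
  · intro h
    exact absurd (Finset.mem_univ p) h

/-- The bracket of currents contributes [E_ba, X] t^{i-n}, and the central terms tr(E_ba X) E_ab^(p)
add up to X^(p). -/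
theorem casimir_current {ℓ : ℂ} (hTφ : ∀ g i X, Commute (T g) (φ i X)) (i n : ℕ)
    (X : Matrix (Fin m) (Fin m) ℂ) (hφ : ∀ Y, φ i Y * φ (-n) X - φ (-n) X * φ i Y =
      φ (i - n) (Y * X - X * Y) + (if i = n then (n : ℂ) * ℓ else 0) • (Matrix.trace (Y * X) • 1))
    (p : Fin N) :
    casimir (siteIn T p) (φ i) * φ (-n) X - φ (-n) X * casimir (siteIn T p) (φ i) =
      adIn T φ p (i - n) X + (if i = n then (n : ℂ) * ℓ else 0) • siteIn T p X := by
  rw [casimir_mul_sub_mul fun Y => hTφ (site p Y) _ X]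
  simp only [hφ, mul_add, Finset.sum_add_distrib]
  congr 1
  conv_rhs => rw [← sum_trace_smul_single X]
  simp only [map_sum, Finset.smul_sum]
  refine Finset.sum_congr rfl fun a _ => Finset.sum_congr rfl fun b _ => ?_
  rw [mul_smul_comm, mul_smul_comm, mul_one, map_smul]

/-- The commutator of a summand of `z_p` with `X t^{-n}`. -/
theorem casimir_commutator_total {ℓ : ℂ} (hLT : ∀ f g, Commute (L f) (T g))
    (hLφ : ∀ f i X, Commute (L f) (φ i X)) (hTφ : ∀ g i X, Commute (T g) (φ i X)) (i n : ℕ)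
    (X : Matrix (Fin m) (Fin m) ℂ) (hφ : ∀ Y, φ i Y * φ (-n) X - φ (-n) X * φ i Y =
      φ (i - n) (Y * X - X * Y) + (if i = n then (n : ℂ) * ℓ else 0) • (Matrix.trace (Y * X) • 1))
    (p : Fin N) :
    multIn L (xpow p (-(i : ℤ))) * casimir (siteIn T p) (φ i) * (loopIn L T (-n) X + φ (-n) X) -
      (loopIn L T (-n) X + φ (-n) X) *
        (multIn L (xpow p (-(i : ℤ))) * casimir (siteIn T p) (φ i)) =
      multIn L (xpow p (-(i : ℤ))) * adIn T φ p (i - n) X -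
        multIn L (xpow p (-((n + i : ℕ) : ℤ))) * adIn T φ p ((n + i : ℕ) - n) X +
        (if i = n then (n : ℂ) * ℓ else 0) • (multIn L (xpow p (-n)) * siteIn T p X) := by
  have e2 : multIn L (xpow p (-(i : ℤ))) * (loopIn L T (-n) X + φ (-n) X) =
      (loopIn L T (-n) X + φ (-n) X) * multIn L (xpow p (-(i : ℤ))) :=
    (multIn_loopIn_comm hLT _ _ _).add_right (hLφ _ _ _)
  have e3 : casimir (siteIn T p) (φ i) * (loopIn L T (-n) X + φ (-n) X) -
      (loopIn L T (-n) X + φ (-n) X) * casimir (siteIn T p) (φ i) =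
      -(multIn L (xpow p (-n)) * adIn T φ p i X) + (adIn T φ p (i - n) X +
        (if i = n then (n : ℂ) * ℓ else 0) • siteIn T p X) := by
    rw [← casimir_loopIn hLT hLφ hTφ p i (-n) X, ← casimir_current hTφ i n X hφ p, mul_add, add_mul]
    abel
  -- The loop contribution of the i-th summand, x_p^{-i-n} with current t^i, is rewritten as the
  -- current contribution of the summand n + i. This prepares the telescoping over i.
  have e4 : multIn L (xpow p (-(i : ℤ))) * (multIn L (xpow p (-n)) * adIn T φ p i X) =
      multIn L (xpow p (-((n + i : ℕ) : ℤ))) * adIn T φ p ((n + i : ℕ) - n) X := by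
    rw [← mul_assoc, ← map_mul, ← xpow_add]
    congr 3
    · push_cast; ring
    · push_cast; ring
  have e5 : multIn L (xpow p (-(i : ℤ))) * ((if i = n then (n : ℂ) * ℓ else 0) • siteIn T p X) =
      (if i = n then (n : ℂ) * ℓ else 0) • (multIn L (xpow p (-n)) * siteIn T p X) := by
    rw [mul_smul_comm]
    by_cases h : i = n
    · rw [h]
    · rw [if_neg h, zero_smul, zero_smul]
  rw [mul_assoc, ← mul_assoc (loopIn L T (-n) X + φ (-n) X), ← e2, mul_assoc, ← mul_sub, e3,
    mul_add, mul_neg, e4, mul_add, e5]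
  abel

/-- The commutator of the part of `z_p` without currents with `X t^{-n}`. -/
theorem dunkl_commutator_total (hLT : ∀ f g, Commute (L f) (T g))
    (hLφ : ∀ f i X, Commute (L f) (φ i X)) (hTφ : ∀ g i X, Commute (T g) (φ i X)) (κ : ℂ)
    (p : Fin N) (n : ℕ) (X : Matrix (Fin m) (Fin m) ℂ) :
    (κ • L (euler p) + ∑ r ∈ Finset.univ.erase p,
      L (dunkl p r) * T (permT (Equiv.swap p r))) * (loopIn L T (-n) X + φ (-n) X) -
      (loopIn L T (-n) X + φ (-n) X) * (κ • L (euler p) + ∑ r ∈ Finset.univ.erase p,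
        L (dunkl p r) * T (permT (Equiv.swap p r))) =
    (-(κ * n)) • (multIn L (xpow p (-n)) * siteIn T p X) +
      ∑ r ∈ Finset.univ.erase p, multIn L (negSum p r n) *
        ((siteIn T p X - siteIn T r X) * T (permT (Equiv.swap p r))) := by
  set D := κ • L (euler p) + ∑ r ∈ Finset.univ.erase p, L (dunkl p r) * T (permT (Equiv.swap p r))
    with hD
  have h1 : D * φ (-n) X = φ (-n) X * D :=
    (((hLφ _ _ _).smul_left κ).add_left (Commute.sum_left _ _ _ fun r _ =>
      (hLφ _ _ _).mul_left (hTφ _ _ _)))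
  have h2 : κ • (L (euler p) * loopIn L T (-n) X - loopIn L T (-n) X * L (euler p)) =
      (-(κ * n)) • (multIn L (xpow p (-n)) * siteIn T p X) := by
    rw [euler_loopIn hLT, smul_smul, mul_neg]
  rw [mul_add, add_mul (loopIn L T _ X), h1, add_sub_add_right_eq_sub, hD, add_mul, mul_add, add_sub_add_comm,
    Finset.sum_mul, Finset.mul_sum, ← Finset.sum_sub_distrib, smul_mul_assoc, mul_smul_comm,
    ← smul_sub, h2]
  congr 1
  exact Finset.sum_congr rfl fun r hr => dunkl_loopIn hLT (Finset.ne_of_mem_erase hr).symm n X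

/-- The terms of the commutator of `z_p` with `X t^{-n}` add up to a combination of the operators
of the `Y t^{i - n}` with `i < n`. -/
theorem commutator_terms (hLT : ∀ f g, Commute (L f) (T g)) (hTφ : ∀ g i X, Commute (T g) (φ i X))
    (hLφ : ∀ f i X, Commute (L f) (φ i X)) {κ ℓ : ℂ} (hℓ : ℓ = κ - m) (p : Fin N) (n : ℕ)
    (X : Matrix (Fin m) (Fin m) ℂ) (hX : X.trace = 0) :
    (-(κ * n)) • (multIn L (xpow p (-n)) * siteIn T p X) +
      ∑ r ∈ Finset.univ.erase p, multIn L (negSum p r n) *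
        ((siteIn T p X - siteIn T r X) * T (permT (Equiv.swap p r))) +
      (∑ i ∈ Finset.range n, multIn L (xpow p (-(i : ℤ))) * adIn T φ p (i - n) X +
        ((n : ℂ) * ℓ) • (multIn L (xpow p (-n)) * siteIn T p X)) =
    ∑ i ∈ Finset.range n, ∑ a, ∑ b,
      (loopIn L T ((i : ℤ) - n) (Matrix.single b a 1 * X - X * Matrix.single b a 1) +
        φ ((i : ℤ) - n) (Matrix.single b a 1 * X - X * Matrix.single b a 1)) *
        (multIn L (xpow p (-(i : ℤ))) * siteIn T p (Matrix.single a b 1)) := by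
  simp only [add_mul, Finset.sum_add_distrib]
  rw [sum_loopIn hLT p n X hX]
  have h1 : ∀ (i : ℕ) (a b : Fin m),
      φ ((i : ℤ) - n) (Matrix.single b a 1 * X - X * Matrix.single b a 1) *
        (multIn L (xpow p (-(i : ℤ))) * siteIn T p (Matrix.single a b 1)) =
      multIn L (xpow p (-(i : ℤ))) * (siteIn T p (Matrix.single a b 1) *
        φ ((i : ℤ) - n) (Matrix.single b a 1 * X - X * Matrix.single b a 1)) := fun i a b => by
    rw [← mul_assoc (multIn L _)]
    exact ((hLφ _ _ _).mul_left (hTφ _ _ _)).eq.symm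
  simp only [h1, ← Finset.mul_sum]
  simp only [← adIn.eq_1]
  -- The level condition enters here: −κn from the derivation and nℓ from the central charge must
  -- combine to the −nm found in `sum_loopIn`.
  have h2 : (-(κ * n)) • (multIn L (xpow p (-n)) * siteIn T p X) +
      ((n : ℂ) * ℓ) • (multIn L (xpow p (-n)) * siteIn T p X) =
      -(((n : ℂ) * m) • (multIn L (xpow p (-n)) * siteIn T p X)) := by
    rw [← add_smul, ← neg_smul, hℓ]
    congr 1
    ring
  rw [← h2]
  abel

end Operators


/-! ### Descent to the coinvariants -/

section AN

variable {m N : ℕ} {V : Type*} [AddCommGroup V] [Module ℂ V] [LieRingModule (Affine m) V]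
  [LieModule ℂ (Affine m) V] (hm : 0 < m)

/-- Rewrites the Lie action through the operators of the abstract computation. Tracelessness is
needed because the tensor factors see X itself, while the current sees its projection to sl_m. -/
theorem an_lie_eq (j : ℤ) (X : Matrix (Fin m) (Fin m) ℂ) (hX : X.trace = 0) :
    LieModule.toEnd ℂ (Affine m) (AN m N V) (current j (slProj hm X)) =
      loopIn (anL m N V) (anT m N V) j X + anCurrent hm N V j X := by
  have hX' : (slProj hm X).1 = X := by
    rw [slProj_coe, hX, mul_zero, zero_smul, sub_zero]
  refine TensorProduct.ext' fun y v => ?_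
  rw [LieModule.toEnd_apply_apply, TensorProduct.LieModule.lie_tmul_right, LinearMap.add_apply,
    loopIn, LinearMap.sum_apply]
  congr 1
  have h1 : ⁅(current j (slProj hm X) : Affine m), y⁆ =
      ∑ q, opLT (LinearMap.mulLeft ℂ (xpow q j)) (site q X) y := by
    change (∑ q, loopSite q : Loop m →ₗ[ℂ] Module.End ℂ (LT m N))
      (AddMonoidAlgebra.single j 1 ⊗ₜ[ℂ] slProj hm X) y = _
    rw [LinearMap.sum_apply, LinearMap.sum_apply]
    refine Finset.sum_congr rfl fun q _ => ?_
    rw [loopSite_tmul, evalAt_single, hX']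
  rw [h1, TensorProduct.sum_tmul]
  refine Finset.sum_congr rfl fun q _ => ?_
  rw [multIn_apply, siteIn_apply, anL_mul_anT]
  rfl

theorem anX_lie_comm (f : Laurent N) (j : ℤ) (X : sl m) (hm : 0 < m) : Commute (anX m N V f)
    (LieModule.toEnd ℂ (Affine m) (AN m N V) (current j X)) := by
  rw [← slProj_val hm X, an_lie_eq hm j X.1 (sl_trace X)]
  exact (multIn_loopIn_comm anL_anT_comm _ _ _).add_right (anL_anCurrent_comm hm _ _ _)

theorem anPerm_lie_comm (σ : Equiv.Perm (Fin N)) (j : ℤ) (X : sl m) (hm : 0 < m) :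
    Commute (anPerm m N V σ) (LieModule.toEnd ℂ (Affine m) (AN m N V) (current j X)) := by
  rw [← slProj_val hm X, an_lie_eq hm j X.1 (sl_trace X)]
  exact (perm_loopIn_comm anL_anT_comm _ _ _).add_right (anPerm_anV_comm _ _)

/-- Since X is traceless, removing the trace part of Y does not change tr(YX); so the central term
is stated for arbitrary matrices Y, in particular for matrix units. -/
theorem anCurrent_bracket {ℓ : ℂ} (hC : ∀ v : V, ⁅central m, v⁆ = ℓ • v) (i n : ℕ)
    (X : Matrix (Fin m) (Fin m) ℂ) (hX : X.trace = 0) (Y : Matrix (Fin m) (Fin m) ℂ) :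
    anCurrent hm N V i Y * anCurrent hm N V (-n) X - anCurrent hm N V (-n) X * anCurrent hm N V i Y =
      anCurrent hm N V (i - n) (Y * X - X * Y) +
        (if i = n then (n : ℂ) * ℓ else 0) • (Matrix.trace (Y * X) • 1) := by
  have hX' : Matrix.trace ((slProj hm Y).1 * (slProj hm X).1) = Matrix.trace (Y * X) := by
    rw [slProj_coe, slProj_coe, hX, mul_zero, zero_smul, sub_zero, sub_mul, smul_mul_assoc,
      one_mul, Matrix.trace_sub, Matrix.trace_smul, hX, smul_zero, sub_zero]
  have hc : anV m N V (LieModule.toEnd ℂ (Affine m) V (central m)) = ℓ • 1 := by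
    rw [← map_one (anV m N V), ← map_smul]
    congr 1
    exact LinearMap.ext hC
  rw [anCurrent_lie, hX', hc, neg_neg, ← sub_eq_add_neg]
  congr 1
  by_cases h : i = n
  · subst h
    rw [if_pos rfl, if_pos rfl, smul_smul, smul_smul]
    congr 1
    push_cast
    ring
  · rw [if_neg (by exact_mod_cast h), if_neg h, zero_smul, zero_smul]

/-- Each summand contributes G_i − G_{n+i}, plus a central term at i = n only. As G_i kills w for
large i, the sum telescopes to the n terms with i < n. -/
theorem curSum_lie (hV : IsSmooth m V) {ℓ : ℂ} (hC : ∀ v : V, ⁅central m, v⁆ = ℓ • v) (p : Fin N)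
    (n : ℕ) (X : Matrix (Fin m) (Fin m) ℂ) (hX : X.trace = 0) (w : AN m N V) :
    curSum hV p (LieModule.toEnd ℂ (Affine m) (AN m N V) (current (-n) (slProj hm X)) w) -
      LieModule.toEnd ℂ (Affine m) (AN m N V) (current (-n) (slProj hm X)) (curSum hV p w) =
    (∑ i ∈ Finset.range n, anX m N V (xpow p (-(i : ℤ))) *
        adIn (anT m N V) (anCurrent hm N V) p (i - n) X +
      ((n : ℂ) * ℓ) • (anX m N V (xpow p (-n)) * siteIn (anT m N V) p X)) w := by
  set Y := LieModule.toEnd ℂ (Affine m) (AN m N V) (current (-n) (slProj hm X)) with hY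
  let G : ℕ → Module.End ℂ (AN m N V) := fun i =>
    anX m N V (xpow p (-(i : ℤ))) * adIn (anT m N V) (anCurrent hm N V) p (i - n) X
  have hF : ∀ i : ℕ, anX m N V (xpow p (-(i : ℤ))) * anCas hm N V p i * Y -
      Y * (anX m N V (xpow p (-(i : ℤ))) * anCas hm N V p i) = G i - G (n + i) +
        (if i = n then (n : ℂ) * ℓ else 0) •
          (anX m N V (xpow p (-n)) * siteIn (anT m N V) p X) := fun i => by
    rw [hY, an_lie_eq hm _ X hX]
    exact casimir_commutator_total anL_anT_comm (anL_anCurrent_comm hm)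
      (fun g i X => anT_anCurrent_comm hm i g X) i n X (anCurrent_bracket hm hC i n X hX) p
  obtain ⟨K₁, _, h1⟩ := exists_current_bound hm hV w
  obtain ⟨K₂, _, h2⟩ := exists_current_bound hm hV (Y w)
  -- A common truncation: it bounds the currents on w and on Y w, leaves room for the shift by n in
  -- G, and exceeds n so that the central term is included.
  set K := K₁ + K₂ + n + 1
  have hG : ∀ i, G (K + i) w = 0 := fun i => by
    change anX m N V _ (adIn (anT m N V) (anCurrent hm N V) p (((K + i : ℕ) : ℤ) - n) X w) = 0
    simp only [adIn, LinearMap.sum_apply, Module.End.mul_apply]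
    rw [Finset.sum_eq_zero, map_zero]
    intro a _
    refine Finset.sum_eq_zero fun b _ => ?_
    rw [h1 _ (by omega), map_zero]
  have hsum : ∑ i ∈ Finset.range K, (G i w - G (n + i) w) = ∑ i ∈ Finset.range n, G i w := by
    have s1 := Finset.sum_range_add (fun i => G i w) K n
    have s2 := Finset.sum_range_add (fun i => G i w) n K
    rw [add_comm n K, s1] at s2
    rw [Finset.sum_eq_zero (f := fun i => G (K + i) w) fun i _ => hG i, add_zero] at s2
    rw [Finset.sum_sub_distrib, s2, add_sub_cancel_right]
  rw [curSum_eq_sum hm hV (n := K) fun j hj => h1 j (by omega),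
    curSum_eq_sum hm hV (n := K) fun j hj => h2 j (by omega), map_sum, ← Finset.sum_sub_distrib]
  have hF' : ∀ i : ℕ, (anX m N V (xpow p (-(i : ℤ))) * anCas hm N V p i) (Y w) -
      Y ((anX m N V (xpow p (-(i : ℤ))) * anCas hm N V p i) w) = G i w - G (n + i) w +
        (if i = n then (n : ℂ) * ℓ else 0) •
          (anX m N V (xpow p (-n)) * siteIn (anT m N V) p X) w := fun i =>
    LinearMap.congr_fun (hF i) w
  simp only [hF']
  rw [Finset.sum_add_distrib, hsum, ← Finset.sum_smul, Finset.sum_ite_eq',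
    if_pos (Finset.mem_range.2 (by omega)), LinearMap.add_apply, LinearMap.sum_apply]
  rfl

/-- The commutator of `z_p` with `X t^{-n}` on `A_N(V)`, for a module `V` of level `κ - m`. -/
theorem anZ_lie (hV : IsSmooth m V) {κ : ℂ} (hC : ∀ v : V, ⁅central m, v⁆ = (κ - m) • v)
    (p : Fin N) (n : ℕ) (X : Matrix (Fin m) (Fin m) ℂ) (hX : X.trace = 0) (w : AN m N V) :
    anZ hV κ p ⁅(current (-n) (slProj hm X) : Affine m), w⁆ -
      ⁅(current (-n) (slProj hm X) : Affine m), anZ hV κ p w⁆ =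
    ∑ i ∈ Finset.range n, ∑ a, ∑ b, ⁅(current ((i : ℤ) - n)
        (slProj hm (Matrix.single b a 1 * X - X * Matrix.single b a 1)) : Affine m),
      anX m N V (xpow p (-(i : ℤ))) (siteIn (anT m N V) p (Matrix.single a b 1) w)⁆ := by
  have h1 := curSum_lie hm hV hC p n X hX w
  set Y := LieModule.toEnd ℂ (Affine m) (AN m N V) (current (-n) (slProj hm X)) with hY
  have h2 : anD m N κ V p * Y - Y * anD m N κ V p =
      (-(κ * n)) • (anX m N V (xpow p (-n)) * siteIn (anT m N V) p X) +
        ∑ r ∈ Finset.univ.erase p, anX m N V (negSum p r n) *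
          ((siteIn (anT m N V) p X - siteIn (anT m N V) r X) *
            anT m N V (permT (Equiv.swap p r))) := by
    rw [hY, an_lie_eq hm _ X hX]
    exact dunkl_commutator_total anL_anT_comm (anL_anCurrent_comm hm)
      (fun g i X => anT_anCurrent_comm hm i g X) κ p n X
  have h3 : ∀ Z : Matrix (Fin m) (Fin m) ℂ, Matrix.trace (Z * X - X * Z) = 0 := fun Z => by
    rw [Matrix.trace_sub, Matrix.trace_mul_comm, sub_self]
  have h4 := LinearMap.congr_fun (commutator_terms (L := anL m N V) (T := anT m N V)
    anL_anT_comm (fun g i X => anT_anCurrent_comm hm i g X) (anL_anCurrent_comm hm) (κ := κ) rfl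
    p n X hX) w
  have h5 : anD m N κ V p (Y w) - Y (anD m N κ V p w) = _ := LinearMap.congr_fun h2 w
  change anD m N κ V p (Y w) + curSum hV p (Y w) - Y (anD m N κ V p w + curSum hV p w) = _
  rw [map_add, add_sub_add_comm, h5, h1]
  refine h4.trans ?_
  simp only [LinearMap.sum_apply]
  refine Finset.sum_congr rfl fun i _ => Finset.sum_congr rfl fun a _ =>
    Finset.sum_congr rfl fun b _ => ?_
  rw [← an_lie_eq hm _ _ (h3 _)]
  rfl

theorem lie_mem_qImage {n : ℤ} (hn : n < 0) (X : sl m) (W : Type*) [AddCommGroup W] [Module ℂ W]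
    [LieRingModule (Affine m) W] [LieModule ℂ (Affine m) W] (w : W) :
    ⁅(current n X : Affine m), w⁆ ∈ qImage m W :=
  Submodule.subset_span ⟨_, current_mem_qSub hn X, w, rfl⟩

/-- Every current on the right of `anZ_lie` has degree i − n < 0. For n = 0 the sum is empty, so the
constant currents are covered as well. -/
theorem anZ_lie_mem (hV : IsSmooth m V) {κ : ℂ} (hC : ∀ v : V, ⁅central m, v⁆ = (κ - m) • v)
    (p : Fin N) (n : ℕ) (X : sl m) (w : AN m N V) (hm : 0 < m) :
    anZ hV κ p ⁅(current (-n) X : Affine m), w⁆ - ⁅(current (-n) X : Affine m), anZ hV κ p w⁆ ∈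
      qImage m (AN m N V) := by
  rw [← slProj_val hm X, anZ_lie hm hV hC p n X.1 (sl_trace X) w]
  refine Submodule.sum_mem _ fun i hi => Submodule.sum_mem _ fun a _ =>
    Submodule.sum_mem _ fun b _ => lie_mem_qImage ?_ _ _ _
  have := Finset.mem_range.1 hi
  omega

/-- An operator that commutes with the negative currents modulo `𝔮 W` preserves `𝔮 W`. -/
theorem mem_qImage_of_commutator {W : Type*} [AddCommGroup W] [Module ℂ W]
    [LieRingModule (Affine m) W] [LieModule ℂ (Affine m) W] (f : Module.End ℂ W)
    (h : ∀ (i : ℤ), i < 0 → ∀ (X : sl m) (w : W),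
      f ⁅(current i X : Affine m), w⁆ - ⁅(current i X : Affine m), f w⁆ ∈ qImage m W) :
    ∀ w ∈ qImage m W, f w ∈ qImage m W := by
  change qImage m W ≤ (qImage m W).comap f
  refine Submodule.span_le.2 ?_
  rintro _ ⟨ξ, hξ, w, rfl⟩
  change f ⁅ξ, w⁆ ∈ qImage m W
  induction hξ using Submodule.span_induction with
  | mem ξ hξ =>
    obtain ⟨i, X, hi, rfl⟩ := hξ
    exact (Submodule.sub_mem_iff_left _ (lie_mem_qImage hi X W _)).1 (h i hi X w)
  | zero => rw [zero_lie, map_zero]; exact zero_mem _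
  | add x y _ _ hx hy => rw [add_lie, map_add]; exact add_mem hx hy
  | smul c x _ hx => rw [smul_lie, map_smul]; exact Submodule.smul_mem _ _ hx

variable (hV : IsSmooth m V) {κ : ℂ} (hC : ∀ v : V, ⁅central m, v⁆ = (κ - m) • v)

/-- The generators of the Cherednik algebra commute with the nonpositive currents
modulo `𝔮 A_N(V)`. -/
theorem anRep_commutator_mem (hC : ∀ v : V, ⁅central m, v⁆ = (κ - m) • v) {t : Cherednik N κ}
    (ht : t ∈ Set.range (Cherednik.x κ) ∪ Set.range (Cherednik.xinv κ) ∪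
      Set.range (fun σ => heckeToCherednik N κ (HeckeAlg.perm σ)) ∪
      Set.range (fun p => heckeToCherednik N κ (HeckeAlg.z p))) {i : ℤ} (hi : i ≤ 0) (X : sl m)
    (w : AN m N V) : anRep hm hV κ t ⁅(current i X : Affine m), w⁆ -
      ⁅(current i X : Affine m), anRep hm hV κ t w⁆ ∈ qImage m (AN m N V) := by
  have key : ∀ T : Module.End ℂ (AN m N V),
      Commute T (LieModule.toEnd ℂ (Affine m) (AN m N V) (current i X)) →
      T ⁅(current i X : Affine m), w⁆ - ⁅(current i X : Affine m), T w⁆ ∈ qImage m (AN m N V) :=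
    fun T hT => by
      have : T ⁅(current i X : Affine m), w⁆ = ⁅(current i X : Affine m), T w⁆ :=
        LinearMap.congr_fun hT.eq w
      rw [this, sub_self]
      exact zero_mem _
  rcases ht with ((⟨p, rfl⟩ | ⟨p, rfl⟩) | ⟨σ, rfl⟩) | ⟨p, rfl⟩
  · rw [anRep_x]; exact key _ (anX_lie_comm _ i X hm)
  · rw [anRep_xinv]; exact key _ (anX_lie_comm _ i X hm)
  · simp only [anRep_perm]; exact key _ (anPerm_lie_comm _ i X hm)
  · simp only [anRep_z]
    have := anZ_lie_mem hV hC p i.natAbs X w hm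
    rwa [show (-(i.natAbs : ℤ)) = i by omega] at this

theorem anRep_qImage (hC : ∀ v : V, ⁅central m, v⁆ = (κ - m) • v) (t : Cherednik N κ) :
    ∀ w ∈ qImage m (AN m N V), anRep hm hV κ t w ∈ qImage m (AN m N V) :=
  stable_of_adjoin_eq_top (adjoin_cherednik N κ) _ _ (fun _ hs =>
    mem_qImage_of_commutator _ fun _ hi X w => anRep_commutator_mem hm hV hC hs hi.le X w) t

/-- The action of an algebra on a quotient. -/
def quotRep {A M : Type*} [Ring A] [Algebra ℂ A] [AddCommGroup M] [Module ℂ M]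
    (F : A →ₐ[ℂ] Module.End ℂ M) (S : Submodule ℂ M) (h : ∀ a, ∀ v ∈ S, F a v ∈ S) :
    A →ₐ[ℂ] Module.End ℂ (M ⧸ S) :=
  AlgHom.ofLinearMap
    { toFun := fun a => S.mapQ S (F a) (h a)
      map_add' := fun a b => Submodule.linearMap_qext _ (LinearMap.ext fun v => by
        change S.mkQ (F (a + b) v) = S.mkQ (F a v) + S.mkQ (F b v)
        rw [map_add, LinearMap.add_apply, map_add])
      map_smul' := fun c a => Submodule.linearMap_qext _ (LinearMap.ext fun v => by
        change S.mkQ (F (c • a) v) = c • S.mkQ (F a v)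
        rw [map_smul, LinearMap.smul_apply, map_smul]) }
    (Submodule.linearMap_qext _ (LinearMap.ext fun v => by
      change S.mkQ (F 1 v) = S.mkQ v
      rw [map_one, Module.End.one_apply]))
    (fun a b => Submodule.linearMap_qext _ (LinearMap.ext fun v => by
      change S.mkQ (F (a * b) v) = S.mkQ (F a (F b v))
      rw [map_mul, Module.End.mul_apply]))

/-- The action of the Cherednik algebra on the coinvariants of `A_N(V)`. -/
def coinvCherednik (hC : ∀ v : V, ⁅central m, v⁆ = (κ - m) • v) :
    Cherednik N κ →ₐ[ℂ] Module.End ℂ (Coinv m (AN m N V)) :=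
  quotRep (anRep hm hV κ) (qImage m (AN m N V)) (anRep_qImage hm hV hC)

theorem coinvCherednik_comm (X : sl m) (t : Cherednik N κ) :
    Commute (coinvCherednik hm hV hC t) (coinvRep m (AN m N V) X) := by
  refine commute_of_adjoin_eq_top (adjoin_cherednik N κ) _ _ (fun s hs => ?_) t
  refine Submodule.linearMap_qext _ (LinearMap.ext fun w => ?_)
  change (qImage m (AN m N V)).mkQ (anRep hm hV κ s ⁅slEmb m X, w⁆) =
    (qImage m (AN m N V)).mkQ ⁅slEmb m X, anRep hm hV κ s w⁆
  rw [← sub_eq_zero, ← map_sub]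
  exact (Submodule.Quotient.mk_eq_zero _).2 (anRep_commutator_mem hm hV hC hs le_rfl X w)

end AN


/-! ### The Cherednik algebra is spanned by products of Laurent polynomials and `H_N` -/

theorem zpowersHom_commute {N : ℕ} {A : Type*} [Monoid A] (x : Fin N → Aˣ) (hx : ∀ p q, Commute (x p) (x q)) :
    Pairwise fun p q => ∀ i j, Commute (zpowersHom Aˣ (x p) i) (zpowersHom Aˣ (x q) j) :=
  fun p q _ i j => by
    simp only [zpowersHom_apply]
    exact ((hx p q).zpow_left _).zpow_right _

section LaurentLift

variable {N : ℕ} {A : Type*} [Ring A] [Algebra ℂ A]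

/-- The homomorphism from Laurent polynomials given by commuting units. -/
def laurentLift (x : Fin N → Aˣ) (hx : ∀ p q, Commute (x p) (x q)) : Laurent N →ₐ[ℂ] A :=
  AddMonoidAlgebra.lift ℂ A (Fin N → ℤ) ((Units.coeHom A).comp
    ((MonoidHom.noncommPiCoprod (fun p => zpowersHom Aˣ (x p))
      (zpowersHom_commute x hx)).comp
      (MulEquiv.piMultiplicative (fun _ : Fin N => ℤ)).toMonoidHom))

theorem laurentLift_xpow (x : Fin N → Aˣ) (hx : ∀ p q, Commute (x p) (x q)) (p : Fin N) (i : ℤ) :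
    laurentLift x hx (xpow p i) = (x p ^ i : Aˣ) := by
  have h : MulEquiv.piMultiplicative (fun _ : Fin N => ℤ) (Multiplicative.ofAdd (Pi.single p i)) =
      Pi.mulSingle p (Multiplicative.ofAdd i) := by
    funext q
    change Multiplicative.ofAdd ((Pi.single p i : Fin N → ℤ) q) = _
    by_cases hq : q = p
    · subst hq
      rw [Pi.mulSingle_eq_same, Pi.single_eq_same]
    · rw [Pi.mulSingle_eq_of_ne hq, Pi.single_eq_of_ne hq, ofAdd_zero]
  have h' : MonoidHom.noncommPiCoprod (fun p => zpowersHom Aˣ (x p)) (zpowersHom_commute x hx)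
      (MulEquiv.piMultiplicative (fun _ : Fin N => ℤ) (Multiplicative.ofAdd (Pi.single p i))) =
      x p ^ i := by
    rw [h, MonoidHom.noncommPiCoprod_mulSingle, zpowersHom_apply, toAdd_ofAdd]
  rw [laurentLift, xpow, mono, AddMonoidAlgebra.lift_single, one_smul]
  exact congrArg Units.val h'

theorem laurent_hom_ext {F G : Laurent N →ₐ[ℂ] A} (h : ∀ p, F (xpow p 1) = G (xpow p 1))
    (h' : ∀ p, F (xpow p (-1)) = G (xpow p (-1))) : F = G := by
  refine AlgHom.ext_of_adjoin_eq_top (adjoin_xpow N) ?_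
  rintro _ (⟨p, rfl⟩ | ⟨p, rfl⟩)
  · exact h p
  · exact h' p

end LaurentLift

/-! ### Moving Laurent polynomials past permutations and past the z_p -/

section Cross

variable {N : ℕ} {A : Type*} [Ring A] [Algebra ℂ A] {κ : ℂ} {P : Equiv.Perm (Fin N) →* A}
  {Z X Y : Fin N → A} {ι : Laurent N →ₐ[ℂ] A}

theorem CrossRel.perm_laurent (D : CrossRel κ P Z X Y) (hX : ∀ p, ι (xpow p 1) = X p)
    (hY : ∀ p, ι (xpow p (-1)) = Y p) (σ : Equiv.Perm (Fin N)) (f : Laurent N) :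
    P σ * ι f = ι (permL σ f) * P σ := by
  have hy : ∀ p, P σ * Y p = Y (σ p) * P σ := fun p => by
    calc P σ * Y p = Y (σ p) * (X (σ p) * P σ) * Y p := by
          rw [← mul_assoc (Y (σ p)), D.y_mul_x, one_mul]
      _ = Y (σ p) * P σ * (X p * Y p) := by rw [← D.perm_x]; simp only [mul_assoc]
      _ = Y (σ p) * P σ := by rw [D.x_mul_y, mul_one]
  have hf : f ∈ Algebra.adjoin ℂ (Set.range (fun p : Fin N => xpow p 1) ∪
      Set.range (fun p : Fin N => xpow p (-1))) := by rw [adjoin_xpow]; trivial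
  induction hf using Algebra.adjoin_induction with
  | mem f hf =>
    rcases hf with ⟨p, rfl⟩ | ⟨p, rfl⟩
    · simp only [permL_xpow, hX, D.perm_x]
    · simp only [permL_xpow, hY, hy]
  | algebraMap r => simp only [AlgHom.commutes, Algebra.commutes]
  | add f g _ _ hf hg => rw [map_add, map_add, map_add, mul_add, add_mul, hf, hg]
  | mul f g _ _ hf hg =>
    rw [map_mul, map_mul, map_mul, ← mul_assoc, hf, mul_assoc, hg, mul_assoc]

/-- The span of the products of Laurent polynomials and permutations. -/
def permSpan (P : Equiv.Perm (Fin N) →* A) (ι : Laurent N →ₐ[ℂ] A) : Submodule ℂ A :=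
  Submodule.span ℂ {a | ∃ f σ, a = ι f * P σ}

theorem mul_mem_permSpan (g : Laurent N) {a : A} (ha : a ∈ permSpan P ι) :
    ι g * a ∈ permSpan P ι := by
  induction ha using Submodule.span_induction with
  | mem a ha =>
    obtain ⟨f, σ, rfl⟩ := ha
    exact Submodule.subset_span ⟨g * f, σ, by rw [map_mul, mul_assoc]⟩
  | zero => rw [mul_zero]; exact zero_mem _
  | add a b _ _ ha hb => rw [mul_add]; exact add_mem ha hb
  | smul c a _ ha => rw [mul_smul_comm]; exact Submodule.smul_mem _ _ ha

theorem CrossRel.mem_permSpan_mul (D : CrossRel κ P Z X Y) (hX : ∀ p, ι (xpow p 1) = X p)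
    (hY : ∀ p, ι (xpow p (-1)) = Y p) (g : Laurent N) {a : A} (ha : a ∈ permSpan P ι) :
    a * ι g ∈ permSpan P ι := by
  induction ha using Submodule.span_induction with
  | mem a ha =>
    obtain ⟨f, σ, rfl⟩ := ha
    refine Submodule.subset_span ⟨f * permL σ g, σ, ?_⟩
    rw [mul_assoc, D.perm_laurent hX hY, map_mul, mul_assoc]
  | zero => rw [zero_mul]; exact zero_mem _
  | add a b _ _ ha hb => rw [add_mul]; exact add_mem ha hb
  | smul c a _ ha => rw [smul_mul_assoc]; exact Submodule.smul_mem _ _ ha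

/-- Commutation with z_p is a derivation, and the span of products of Laurent polynomials and
permutations is stable under multiplication by Laurent polynomials on both sides. So it suffices to
treat the x_q and their inverses. -/
theorem CrossRel.commutator_mem_permSpan (D : CrossRel κ P Z X Y) (hX : ∀ p, ι (xpow p 1) = X p)
    (hY : ∀ p, ι (xpow p (-1)) = Y p) (p : Fin N) (f : Laurent N) :
    Z p * ι f - ι f * Z p ∈ permSpan P ι := by
  have hx : ∀ q, Z p * X q - X q * Z p ∈ permSpan P ι := fun q => by
    have hm : ∀ r, X p * P (Equiv.swap p r) ∈ permSpan P ι := fun r =>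
      Submodule.subset_span ⟨xpow p 1, _, by rw [hX]⟩
    by_cases h : q = p
    · subst h
      rw [D.z_x_eq]
      exact add_mem (Submodule.smul_mem _ _ (Submodule.subset_span ⟨xpow q 1, 1, by
        rw [hX, map_one, mul_one]⟩)) (Submodule.sum_mem _ fun r _ => hm r)
    · rw [D.z_x_ne p q h]
      exact neg_mem (hm q)
  have hf : f ∈ Algebra.adjoin ℂ (Set.range (fun p : Fin N => xpow p 1) ∪
      Set.range (fun p : Fin N => xpow p (-1))) := by rw [adjoin_xpow]; trivial
  induction hf using Algebra.adjoin_induction with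
  | mem f hf =>
    rcases hf with ⟨q, rfl⟩ | ⟨q, rfl⟩
    · simp only [hX]; exact hx q
    · simp only [hY]
      -- The derivative of an inverse: [z, x⁻¹] = −x⁻¹ [z, x] x⁻¹.
      have e : Z p * Y q - Y q * Z p = -(Y q * (Z p * X q - X q * Z p) * Y q) := by
        have e1 : Y q * (Z p * X q) * Y q = Y q * Z p := by
          rw [mul_assoc, mul_assoc, D.x_mul_y, mul_one]
        have e2 : Y q * (X q * Z p) * Y q = Z p * Y q := by
          rw [← mul_assoc, D.y_mul_x, one_mul]
        rw [mul_sub, sub_mul, e1, e2, neg_sub]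
      rw [e, ← hY]
      exact neg_mem (D.mem_permSpan_mul hX hY _ (mul_mem_permSpan _ (hx q)))
  | algebraMap r => rw [AlgHom.commutes, Algebra.commutes, sub_self]; exact zero_mem _
  | add f g _ _ hf hg =>
    rw [map_add, mul_add, add_mul, add_sub_add_comm]
    exact add_mem hf hg
  | mul f g _ _ hf hg =>
    have e : Z p * ι (f * g) - ι (f * g) * Z p =
        (Z p * ι f - ι f * Z p) * ι g + ι f * (Z p * ι g - ι g * Z p) := by
      rw [map_mul]; noncomm_ring
    rw [e]
    exact add_mem (D.mem_permSpan_mul hX hY _ hf) (mul_mem_permSpan _ hg)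

end Cross

/-! ### Relations and spanning set of the trigonometric Cherednik algebra -/

section Cherednik

variable (N : ℕ) (κ : ℂ)

/-- The symmetric group in the Hecke algebra. -/
def heckePerm : Equiv.Perm (Fin N) →* HeckeAlg N where
  toFun := HeckeAlg.perm
  map_one' := (RingQuot.mkAlgHom_rel ℂ HRel.perm_one).trans (map_one _)
  map_mul' σ τ := (RingQuot.mkAlgHom_rel ℂ (HRel.perm_mul σ τ)).trans (map_mul _ _ _)

/-- The symmetric group in the Cherednik algebra. -/
def cherednikPerm : Equiv.Perm (Fin N) →* Cherednik N κ :=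
  (heckeToCherednik N κ : HeckeAlg N →* Cherednik N κ).comp (heckePerm N)

variable {N}

theorem cherednik_rel {a b : FreeAlgebra ℂ (TGen N)} (h : TRel N κ a b) :
    RingQuot.mkAlgHom ℂ (TRel N κ) a = RingQuot.mkAlgHom ℂ (TRel N κ) b :=
  RingQuot.mkAlgHom_rel ℂ h

theorem cherednik_x_comm (p q : Fin N) :
    Cherednik.x κ p * Cherednik.x κ q = Cherednik.x κ q * Cherednik.x κ p := by
  have := cherednik_rel κ (TRel.x_comm p q)
  simp only [map_mul] at this
  exact this

theorem cherednik_x_mul_xinv (p : Fin N) : Cherednik.x κ p * Cherednik.xinv κ p = 1 := by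
  have := cherednik_rel κ (TRel.x_mul_xinv p)
  simp only [map_mul, map_one] at this
  exact this

theorem cherednik_xinv_mul_x (p : Fin N) : Cherednik.xinv κ p * Cherednik.x κ p = 1 := by
  have := cherednik_rel κ (TRel.xinv_mul_x p)
  simp only [map_mul, map_one] at this
  exact this

theorem cherednikPerm_apply (σ : Equiv.Perm (Fin N)) :
    cherednikPerm N κ σ = RingQuot.mkAlgHom ℂ (TRel N κ) (permFree σ) := heckeToCherednik_mk _

theorem cherednik_perm_mul_x (σ : Equiv.Perm (Fin N)) (p : Fin N) :
    cherednikPerm N κ σ * Cherednik.x κ p = Cherednik.x κ (σ p) * cherednikPerm N κ σ := by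
  have := cherednik_rel κ (TRel.perm_x σ p)
  rw [cherednikPerm_apply]
  simp only [map_mul] at this
  exact this

theorem cherednik_z_mul_x_ne {p q : Fin N} (h : q ≠ p) :
    heckeToCherednik N κ (HeckeAlg.z p) * Cherednik.x κ q -
      Cherednik.x κ q * heckeToCherednik N κ (HeckeAlg.z p) =
      -(Cherednik.x κ p * cherednikPerm N κ (Equiv.swap p q)) := by
  have := cherednik_rel κ (TRel.cross_ne p q h)
  rw [cherednikPerm_apply, HeckeAlg.z, heckeToCherednik_mk]
  simp only [map_sub, map_neg, map_mul] at this
  exact this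

theorem cherednik_z_mul_x_eq (p : Fin N) :
    heckeToCherednik N κ (HeckeAlg.z p) * Cherednik.x κ p -
      Cherednik.x κ p * heckeToCherednik N κ (HeckeAlg.z p) =
      κ • Cherednik.x κ p + ∑ r ∈ Finset.univ.erase p,
        Cherednik.x κ p * cherednikPerm N κ (Equiv.swap p r) := by
  have := cherednik_rel κ (TRel.cross_eq p)
  simp only [cherednikPerm_apply]
  rw [HeckeAlg.z, heckeToCherednik_mk]
  simp only [map_sub, map_add, map_sum, map_smul, map_mul] at this
  exact this

/-- The element `x_p` as a unit of the Cherednik algebra. -/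
def cherednikUnit (p : Fin N) : (Cherednik N κ)ˣ :=
  ⟨Cherednik.x κ p, Cherednik.xinv κ p, cherednik_x_mul_xinv κ p, cherednik_xinv_mul_x κ p⟩

theorem cherednikUnit_comm (p q : Fin N) : Commute (cherednikUnit κ p) (cherednikUnit κ q) :=
  Units.ext (cherednik_x_comm κ p q)

/-- The homomorphism from Laurent polynomials to the Cherednik algebra. -/
def laurentHom : Laurent N →ₐ[ℂ] Cherednik N κ :=
  laurentLift (cherednikUnit κ) (cherednikUnit_comm κ)

theorem laurentHom_x (p : Fin N) : laurentHom κ (xpow p 1) = Cherednik.x κ p := by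
  rw [laurentHom, laurentLift_xpow, zpow_one]; rfl

theorem laurentHom_xinv (p : Fin N) : laurentHom κ (xpow p (-1)) = Cherednik.xinv κ p := by
  rw [laurentHom, laurentLift_xpow, zpow_neg_one]; rfl

theorem cherednik_crossRel (N : ℕ) (κ : ℂ) : CrossRel κ (cherednikPerm N κ)
    (fun p => heckeToCherednik N κ (HeckeAlg.z p)) (Cherednik.x κ) (Cherednik.xinv κ) where
  x_comm := cherednik_x_comm κ
  x_mul_y := cherednik_x_mul_xinv κ
  y_mul_x := cherednik_xinv_mul_x κ
  perm_x := cherednik_perm_mul_x κ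
  z_x_ne _ _ h := cherednik_z_mul_x_ne κ h
  z_x_eq := cherednik_z_mul_x_eq κ

/-- The Cherednik algebra is spanned by the products of Laurent polynomials and elements
of `H_N`. -/
theorem cherednik_span (N : ℕ) (κ : ℂ) : Submodule.span ℂ {a : Cherednik N κ |
    ∃ f h, a = laurentHom κ f * heckeToCherednik N κ h} = ⊤ := by
  set S := Submodule.span ℂ {a : Cherednik N κ |
    ∃ f h, a = laurentHom κ f * heckeToCherednik N κ h}
  have hP : permSpan (cherednikPerm N κ) (laurentHom κ) ≤ S := Submodule.span_mono (by
    rintro _ ⟨f, σ, rfl⟩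
    exact ⟨f, HeckeAlg.perm σ, rfl⟩)
  have hS : ∀ h, ∀ a ∈ S, a * heckeToCherednik N κ h ∈ S := fun h a ha => by
    induction ha using Submodule.span_induction with
    | mem a ha =>
      obtain ⟨f, h', rfl⟩ := ha
      exact Submodule.subset_span ⟨f, h' * h, by rw [map_mul, mul_assoc]⟩
    | zero => rw [zero_mul]; exact zero_mem _
    | add a b _ _ ha hb => rw [add_mul]; exact add_mem ha hb
    | smul c a _ ha => rw [smul_mul_assoc]; exact Submodule.smul_mem _ _ ha
  refine eq_top_of_mul_mem (adjoin_cherednik N κ) S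
    (Submodule.subset_span ⟨1, 1, by rw [map_one, map_one, mul_one]⟩) fun s hs b hb => ?_
  induction hb using Submodule.span_induction with
  | mem b hb =>
    obtain ⟨f, h, rfl⟩ := hb
    rw [← mul_assoc]
    -- The span is stable under right multiplication by H_N, so only the product of a generator with
    -- a Laurent polynomial has to be reordered.
    refine hS h _ ?_
    rcases hs with ((⟨p, rfl⟩ | ⟨p, rfl⟩) | ⟨σ, rfl⟩) | ⟨p, rfl⟩
    · exact Submodule.subset_span ⟨xpow p 1 * f, 1, by
        rw [map_mul, laurentHom_x, map_one, mul_one]⟩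
    · exact Submodule.subset_span ⟨xpow p (-1) * f, 1, by
        rw [map_mul, laurentHom_xinv, map_one, mul_one]⟩
    · exact Submodule.subset_span ⟨permL σ f, HeckeAlg.perm σ,
        (cherednik_crossRel N κ).perm_laurent (laurentHom_x κ) (laurentHom_xinv κ) σ f⟩
    -- Here z_p f is f z_p plus a commutator, and the commutator involves only Laurent polynomials
    -- and permutations.
    · have h1 := hP ((cherednik_crossRel N κ).commutator_mem_permSpan (laurentHom_x κ)
        (laurentHom_xinv κ) p f)
      have h2 : laurentHom κ f * heckeToCherednik N κ (HeckeAlg.z p) ∈ S :=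
        Submodule.subset_span ⟨f, HeckeAlg.z p, rfl⟩
      exact (Submodule.sub_mem_iff_left _ h2).1 h1
  | zero => rw [mul_zero]; exact zero_mem _
  | add a b _ _ ha hb => rw [mul_add]; exact add_mem ha hb
  | smul c a _ ha => rw [mul_smul_comm]; exact Submodule.smul_mem _ _ ha

end Cherednik


/-! ### Homomorphisms from induced modules -/

section IndLift

variable {A B M P : Type*} [Ring A] [Algebra ℂ A] [Ring B] [Algebra ℂ B] [AddCommGroup M]
  [Module ℂ M] [AddCommGroup P] [Module ℂ P]

/-- A map that is equivariant for generators of an algebra is equivariant. -/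
theorem equivariant_of_adjoin_eq_top {s : Set A} (hs : Algebra.adjoin ℂ s = ⊤)
    (F : A →ₐ[ℂ] Module.End ℂ M) (G : A →ₐ[ℂ] Module.End ℂ P) (j : M →ₗ[ℂ] P)
    (h : ∀ a ∈ s, ∀ v, G a (j v) = j (F a v)) (a : A) : ∀ v, G a (j v) = j (F a v) := by
  have ha : a ∈ Algebra.adjoin ℂ s := hs ▸ Algebra.mem_top
  induction ha using Algebra.adjoin_induction with
  | mem a ha => exact h a ha
  | algebraMap r =>
    intro v
    rw [AlgHom.commutes, AlgHom.commutes, Module.algebraMap_end_apply, Module.algebraMap_end_apply,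
      map_smul]
  | add a b _ _ ha hb =>
    intro v
    rw [map_add, map_add, LinearMap.add_apply, LinearMap.add_apply, ha, hb, map_add]
  | mul a b _ _ ha hb =>
    intro v
    rw [map_mul, map_mul, Module.End.mul_apply, Module.End.mul_apply, hb, ha]

variable {f : A →ₐ[ℂ] B} {ρ : A →ₐ[ℂ] Module.End ℂ M} (G : B →ₐ[ℂ] Module.End ℂ P)
  (j : M →ₗ[ℂ] P) (hj : ∀ a v, G (f a) (j v) = j (ρ a v))

/-- The universal property of induced modules. -/
def indLift (hj : ∀ a v, G (f a) (j v) = j (ρ a v)) : Ind f ρ →ₗ[ℂ] P :=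
  (indRel f ρ).liftQ (TensorProduct.lift (G.toLinearMap.compl₂ j)) (by
    refine Submodule.span_le.2 ?_
    rintro _ ⟨b, a, v, rfl⟩
    rw [SetLike.mem_coe, LinearMap.mem_ker, map_sub, sub_eq_zero]
    change G (b * f a) (j v) = G b (j (ρ a v))
    rw [map_mul, Module.End.mul_apply, hj])

theorem indLift_action (b : B) (y : Ind f ρ) :
    indLift G j hj (Ind.action f ρ b y) = G b (indLift G j hj y) := by
  suffices H : indLift G j hj ∘ₗ Ind.action f ρ b = G b ∘ₗ indLift G j hj from
    LinearMap.congr_fun H y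
  refine Ind.hom_ext fun c v => ?_
  change G (b * c) (j v) = G b (G c (j v))
  rw [map_mul, Module.End.mul_apply]

theorem indLift_map (g : Module.End ℂ M) (hg : ∀ a, Commute (ρ a) g) (k : Module.End ℂ P)
    (hk : ∀ b, Commute (G b) k) (hjk : ∀ v, j (g v) = k (j v)) (y : Ind f ρ) :
    indLift G j hj (Ind.map f ρ g hg y) = k (indLift G j hj y) := by
  suffices H : indLift G j hj ∘ₗ Ind.map f ρ g hg = k ∘ₗ indLift G j hj from
    LinearMap.congr_fun H y
  refine Ind.hom_ext fun c v => ?_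
  change G c (j (g v)) = k (G c (j v))
  rw [hjk]
  exact LinearMap.congr_fun (hk c).eq (j v)

end IndLift

/-! ### The antipode, and coinvariants of `M ⊗ U(𝔮) ⊗ U` -/

section Antipode

variable {K M U : Type*} [LieRing K] [LieAlgebra ℂ K] [AddCommGroup M] [Module ℂ M]
  [AddCommGroup U] [Module ℂ U] (ρ : K →ₗ⁅ℂ⁆ Module.End ℂ M)

/-- The right action of `U(𝔮)` on a `𝔮`-module by the antipode. -/
def antiRep : UniversalEnvelopingAlgebra ℂ K →ₐ[ℂ] (Module.End ℂ M)ᵐᵒᵖ :=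
  UniversalEnvelopingAlgebra.lift ℂ
    { toFun := fun x => MulOpposite.op (-ρ x)
      map_add' := fun x y => by rw [map_add, neg_add, MulOpposite.op_add]
      map_smul' := fun c x => by rw [map_smul, ← smul_neg, MulOpposite.op_smul]; rfl
      map_lie' := fun {x y} => by
        rw [LieHom.map_lie, Ring.lie_def, Ring.lie_def, ← MulOpposite.op_mul, ← MulOpposite.op_mul,
          ← MulOpposite.op_sub, neg_mul_neg, neg_mul_neg, neg_sub] }

theorem antiRep_one : antiRep ρ 1 = 1 := map_one _

theorem antiRep_ι_mul (x : K) (b : UniversalEnvelopingAlgebra ℂ K) (w : M) :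
    (antiRep ρ (UniversalEnvelopingAlgebra.ι ℂ x * b)).unop w =
      -(antiRep ρ b).unop (ρ x w) := by
  rw [map_mul, antiRep, UniversalEnvelopingAlgebra.lift_ι_apply, ← antiRep, MulOpposite.unop_mul,
    Module.End.mul_apply, ← map_neg]
  rfl

/-- The map `w ⊗ b ⊗ u ↦ S(b) w ⊗ u`, for the antipode `S`. -/
def antiMap (U : Type*) [AddCommGroup U] [Module ℂ U] :
    M ⊗[ℂ] (UniversalEnvelopingAlgebra ℂ K ⊗[ℂ] U) →ₗ[ℂ] M ⊗[ℂ] U :=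
  LinearMap.rTensor U (TensorProduct.lift (((MulOpposite.opLinearEquiv ℂ).symm.toLinearMap ∘ₗ
    (antiRep ρ).toLinearMap).flip)) ∘ₗ
    (TensorProduct.assoc ℂ M (UniversalEnvelopingAlgebra ℂ K) U).symm.toLinearMap

theorem antiMap_tmul (w : M) (b : UniversalEnvelopingAlgebra ℂ K) (u : U) :
    antiMap ρ U (w ⊗ₜ (b ⊗ₜ u)) = (antiRep ρ b).unop w ⊗ₜ u := rfl

/-- The antipode reverses products and sends x to −x, so S(xb)w = −S(b)(xw). This is exactly what
makes the map vanish on the diagonal action of x on M ⊗ U(𝔮) ⊗ U. -/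
theorem antiMap_ι_mul (x : K) (w : M) (y : UniversalEnvelopingAlgebra ℂ K ⊗[ℂ] U) :
    antiMap ρ U (w ⊗ₜ ((LinearMap.mulLeft ℂ (UniversalEnvelopingAlgebra.ι ℂ x)).rTensor U y)) =
      -antiMap ρ U (ρ x w ⊗ₜ y) := by
  induction y using TensorProduct.induction_on with
  | zero => simp
  | add y y' h h' => rw [map_add, TensorProduct.tmul_add, map_add, h, h', TensorProduct.tmul_add, map_add, neg_add]
  | tmul b u =>
    rw [LinearMap.rTensor_tmul, LinearMap.mulLeft_apply, antiMap_tmul, antiMap_tmul,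
      antiRep_ι_mul, TensorProduct.neg_tmul]

end Antipode

/-! ### The isomorphism of the coinvariants with the induced module -/

section Iso

variable {m : ℕ} (hm : 0 < m) (N : ℕ) (ℓ : ℂ) (U : Type*) [AddCommGroup U] [Module ℂ U]
  [LieRingModule (sl m) U] [LieModule ℂ (sl m) U]

/-- The embedding `t ⊗ u ↦ 1 ⊗ t ⊗ u` of `F_N(U)` into `A_N(V)`. -/
def fnEmb (m N : ℕ) (ℓ : ℂ) (U : Type*) [AddCommGroup U] [Module ℂ U]
    [LieRingModule (sl m) U] [LieModule ℂ (sl m) U] : FN m N U →ₗ[ℂ] AN m N (ParInd m ℓ U) :=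
  TensorProduct.map (TensorProduct.mk ℂ (Laurent N) (TPow m N) 1 : TPow m N →ₗ[ℂ] LT m N)
    (vac m ℓ U)

theorem fnEmb_isConstant (w : FN m N U) : IsConstant (fnEmb m N ℓ U w) := by
  induction w using TensorProduct.induction_on with
  | zero => intro D f; simp only [map_zero]
  | add w w' h h' => intro D f; simp only [map_add, h D f, h' D f]
  | tmul t u => exact isConstant_tmul t _

theorem anT_fnEmb (g : Module.End ℂ (TPow m N)) (w : FN m N U) :
    anT m N (ParInd m ℓ U) g (fnEmb m N ℓ U w) = fnEmb m N ℓ U (fnLeft m N U g w) := by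
  suffices H : anT m N (ParInd m ℓ U) g ∘ₗ fnEmb m N ℓ U = fnEmb m N ℓ U ∘ₗ fnLeft m N U g from
    LinearMap.congr_fun H w
  exact TensorProduct.ext' fun t u => rfl

theorem anCurrent_fnEmb (X : Matrix (Fin m) (Fin m) ℂ) (w : FN m N U) :
    anCurrent hm N (ParInd m ℓ U) 0 X (fnEmb m N ℓ U w) =
      fnEmb m N ℓ U (fnCurrent hm N U X w) := by
  suffices H : anCurrent hm N (ParInd m ℓ U) 0 X ∘ₗ fnEmb m N ℓ U =
    fnEmb m N ℓ U ∘ₗ fnCurrent hm N U X from LinearMap.congr_fun H w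
  refine TensorProduct.ext' fun t u => ?_
  change ((1 : Laurent N) ⊗ₜ[ℂ] t : LT m N) ⊗ₜ[ℂ] ⁅(current 0 (slProj hm X) : Affine m), vac m ℓ U u⁆ =
    ((1 : Laurent N) ⊗ₜ[ℂ] t : LT m N) ⊗ₜ[ℂ] vac m ℓ U ⁅slProj hm X, u⁆
  rw [current_zero_lie_vac]

theorem anCurrent_fnEmb_pos {j : ℤ} (hj : 0 < j) (X : Matrix (Fin m) (Fin m) ℂ) (w : FN m N U) :
    anCurrent hm N (ParInd m ℓ U) j X (fnEmb m N ℓ U w) = 0 := by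
  suffices H : anCurrent hm N (ParInd m ℓ U) j X ∘ₗ fnEmb m N ℓ U = 0 from LinearMap.congr_fun H w
  refine TensorProduct.ext' fun t u => ?_
  change ((1 : Laurent N) ⊗ₜ[ℂ] t : LT m N) ⊗ₜ[ℂ] ⁅(current j (slProj hm X) : Affine m), vac m ℓ U u⁆ = 0
  rw [current_lie_vac_pos hj, TensorProduct.tmul_zero]

theorem fnEmb_lie (hm : 0 < m) (X : sl m) (w : FN m N U) :
    fnEmb m N ℓ U ⁅X, w⁆ = ⁅slEmb m X, fnEmb m N ℓ U w⁆ := by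
  have h1 := LinearMap.congr_fun (fn_lie_eq hm N U X) w
  have h2 := LinearMap.congr_fun (an_lie_eq (N := N) (V := ParInd m ℓ U) hm 0 X.1 (sl_trace X))
    (fnEmb m N ℓ U w)
  rw [slProj_val] at h2
  refine Eq.trans ?_ h2.symm
  rw [LieModule.toEnd_apply_apply] at h1
  rw [h1, LinearMap.add_apply, LinearMap.add_apply, map_add, anCurrent_fnEmb, loopIn,
    LinearMap.sum_apply, LinearMap.sum_apply, map_sum]
  congr 1
  refine Finset.sum_congr rfl fun q _ => ?_
  rw [xpow_zero, map_one, one_mul]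
  exact (anT_fnEmb N ℓ U _ w).symm

theorem anCas_fnEmb (p : Fin N) (w : FN m N U) :
    anCas hm N (ParInd m ℓ U) p 0 (fnEmb m N ℓ U w) = fnEmb m N ℓ U (fnZ hm N U p w) := by
  simp only [anCas, fnZ, casimir, LinearMap.sum_apply, Module.End.mul_apply, map_sum,
    anCurrent_fnEmb]
  exact Finset.sum_congr rfl fun a _ => Finset.sum_congr rfl fun b _ => anT_fnEmb N ℓ U _ _

/-- On 1 ⊗ t ⊗ u the differential-difference part vanishes, and positive currents kill U; so the
truncation n = 1 is allowed, and z_p acts by Ω_p^(0), its operator on F_N(U). -/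
theorem anRep_fnEmb (κ : ℂ) (h : HeckeAlg N) (w : FN m N U) :
    anRep hm parInd_isSmooth κ (heckeToCherednik N κ h) (fnEmb m N ℓ U w) =
      fnEmb m N ℓ U ((fn_heckeData hm N U).lift h w) := by
  refine equivariant_of_adjoin_eq_top (adjoin_hecke N) (fn_heckeData hm N U).lift
    ((anRep hm parInd_isSmooth κ).comp (heckeToCherednik N κ)) (fnEmb m N ℓ U) ?_ h w
  rintro _ (⟨σ, rfl⟩ | ⟨p, rfl⟩) w
  · rw [HeckeData.lift_perm, AlgHom.comp_apply, anRep_perm,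
      (fnEmb_isConstant N ℓ U w).anPerm_apply]
    exact anT_fnEmb N ℓ U _ w
  · rw [HeckeData.lift_z, AlgHom.comp_apply, anRep_z, (fnEmb_isConstant N ℓ U w).anZ_apply hm _
      (n := 1) (fun j hj X => anCurrent_fnEmb_pos hm N ℓ U (by exact_mod_cast hj) X w),
      Finset.sum_range_one]
    simp only [Nat.cast_zero, neg_zero, xpow_zero, map_one, Module.End.one_apply]
    exact anCas_fnEmb hm N ℓ U p w

theorem anRep_laurentHom {V : Type*} [AddCommGroup V] [Module ℂ V] [LieRingModule (Affine m) V]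
    [LieModule ℂ (Affine m) V] (hV : IsSmooth m V) (κ : ℂ) (f : Laurent N) :
    anRep hm hV κ (laurentHom κ f) = anX m N V f := by
  refine DFunLike.congr_fun (laurent_hom_ext (F := (anRep hm hV κ).comp (laurentHom κ))
    (G := anX m N V) (fun p => ?_) (fun p => ?_)) f
  · rw [AlgHom.comp_apply, laurentHom_x, anRep_x]
  · rw [AlgHom.comp_apply, laurentHom_xinv, anRep_xinv]

/-- The action of `𝔮` on the space `ℂ[x_1, x_1⁻¹, …, x_N, x_N⁻¹] ⊗ (ℂ^m)^{⊗ N}`. -/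
def ltRep (m N : ℕ) : qSub m →ₗ⁅ℂ⁆ Module.End ℂ (LT m N) :=
  (LieModule.toEnd ℂ (Affine m) (LT m N)).comp (qSub m).incl

/-- The projection of `A_N(V)` to `ℂ[x_1, x_1⁻¹, …, x_N, x_N⁻¹] ⊗ (ℂ^m)^{⊗ N} ⊗ U`. -/
def anProj (m N : ℕ) (ℓ : ℂ) (U : Type*) [AddCommGroup U] [Module ℂ U]
    [LieRingModule (sl m) U] [LieModule ℂ (sl m) U] :
    AN m N (ParInd m ℓ U) →ₗ[ℂ] LT m N ⊗[ℂ] U :=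
  antiMap (ltRep m N) U ∘ₗ (triOfParInd m ℓ U).lTensor (LT m N)

theorem anProj_vac (y : LT m N) (u : U) : anProj m N ℓ U (y ⊗ₜ vac m ℓ U u) = y ⊗ₜ u := by
  rw [anProj, LinearMap.comp_apply, LinearMap.lTensor_tmul, triOfParInd_vac, antiMap_tmul,
    antiRep_one]
  rfl

/-- The map from V to U(𝔮) ⊗ U turns ξ into left multiplication, and the antipode then makes the
actions of ξ on the two tensor factors cancel. -/
theorem anProj_lie {ξ : Affine m} (hξ : ξ ∈ qSub m) (w : AN m N (ParInd m ℓ U)) :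
    anProj m N ℓ U ⁅ξ, w⁆ = 0 := by
  induction w using TensorProduct.induction_on with
  | zero => rw [lie_zero, map_zero]
  | add w w' h h' => rw [lie_add, map_add, h, h', add_zero]
  | tmul y v =>
    rw [TensorProduct.LieModule.lie_tmul_right, map_add]
    have h1 : anProj m N ℓ U (y ⊗ₜ ⁅ξ, v⁆) =
        antiMap (ltRep m N) U (y ⊗ₜ triLeft (qSub m) U ⟨ξ, hξ⟩ (triOfParInd m ℓ U v)) :=
      congrArg (fun z => antiMap (ltRep m N) U (y ⊗ₜ z)) (triOfParInd_lie m ℓ U ⟨ξ, hξ⟩ v)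
    rw [h1]
    exact add_eq_zero_iff_eq_neg.2 (neg_eq_iff_eq_neg.1
      (antiMap_ι_mul (ltRep m N) ⟨ξ, hξ⟩ y (triOfParInd m ℓ U v)).symm)

end Iso


/-! ### The map from the induced module to the coinvariants and its left inverse -/

section Iso

variable {m : ℕ} (hm : 0 < m) (N : ℕ) (κ : ℂ) (U : Type*) [AddCommGroup U] [Module ℂ U]
  [LieRingModule (sl m) U] [LieModule ℂ (sl m) U]

/-- The space of coinvariants of `A_N(V)` for the module `V` of level `κ - m` induced from `U`. -/
abbrev CoinvInd (m N : ℕ) (κ : ℂ) (U : Type*) [AddCommGroup U] [Module ℂ U]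
    [LieRingModule (sl m) U] [LieModule ℂ (sl m) U] :=
  Coinv m (AN m N (ParInd m (κ - m) U))

/-- The action of the Cherednik algebra on the coinvariants of `A_N(V)` for an induced
module `V`. -/
def coinvIndRep : Cherednik N κ →ₐ[ℂ] Module.End ℂ (CoinvInd m N κ U) :=
  coinvCherednik hm parInd_isSmooth central_lie_parInd

/-- The map from `F_N(U)` to the coinvariants of `A_N(V)`. -/
def fnToCoinv (m N : ℕ) (κ : ℂ) (U : Type*) [AddCommGroup U] [Module ℂ U]
    [LieRingModule (sl m) U] [LieModule ℂ (sl m) U] : FN m N U →ₗ[ℂ] CoinvInd m N κ U :=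
  (qImage m (AN m N (ParInd m (κ - m) U))).mkQ ∘ₗ fnEmb m N (κ - m) U

theorem coinvIndRep_fnToCoinv (h : HeckeAlg N) (w : FN m N U) :
    coinvIndRep hm N κ U (heckeToCherednik N κ h) (fnToCoinv m N κ U w) =
      fnToCoinv m N κ U ((fn_heckeData hm N U).lift h w) :=
  congrArg (qImage m (AN m N (ParInd m (κ - m) U))).mkQ (anRep_fnEmb hm N (κ - m) U κ h w)

/-- The homomorphism from the induced module to the coinvariants. -/
def indToCoinv : Ind (heckeToCherednik N κ) (fn_heckeData hm N U).lift →ₗ[ℂ] CoinvInd m N κ U :=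
  indLift (coinvIndRep hm N κ U) (fnToCoinv m N κ U) (coinvIndRep_fnToCoinv hm N κ U)

theorem indToCoinv_laurentHom (f : Laurent N) (w : FN m N U) :
    indToCoinv hm N κ U ((indRel _ _).mkQ (laurentHom κ f ⊗ₜ[ℂ] w)) =
      (qImage m (AN m N (ParInd m (κ - m) U))).mkQ
        (anX m N (ParInd m (κ - m) U) f (fnEmb m N (κ - m) U w)) := by
  change (qImage m (AN m N (ParInd m (κ - m) U))).mkQ
    (anRep hm parInd_isSmooth κ (laurentHom κ f) (fnEmb m N (κ - m) U w)) = _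
  rw [anRep_laurentHom]

theorem anX_fnEmb (f : Laurent N) (t : TPow m N) (u : U) (ℓ : ℂ) :
    anX m N (ParInd m ℓ U) f (fnEmb m N ℓ U (t ⊗ₜ u)) =
      ((f ⊗ₜ[ℂ] t : LT m N) ⊗ₜ[ℂ] vac m ℓ U u) := by
  change (((f * 1) ⊗ₜ[ℂ] t : LT m N) ⊗ₜ[ℂ] vac m ℓ U u) = _
  rw [mul_one]

/-- Modulo 𝔮 A_N(V) one has y ⊗ ξv = −ξy ⊗ v for ξ in 𝔮. As V is generated by U under 𝔮, induction
on v, for all y simultaneously, reduces every class to classes of f ⊗ t ⊗ u, which are images of f ⊗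
(t ⊗ u). -/
theorem indToCoinv_surjective : Function.Surjective (indToCoinv hm N κ U) := by
  set R := (LinearMap.range (indToCoinv hm N κ U)).comap
    (qImage m (AN m N (ParInd m (κ - m) U))).mkQ with hR
  have hvac : ∀ (y : LT m N) (u : U), (y ⊗ₜ[ℂ] vac m (κ - m) U u) ∈ R := fun y u => by
    change y ∈ R.comap ((TensorProduct.mk ℂ (LT m N) (ParInd m (κ - m) U)).flip
      (vac m (κ - m) U u))
    refine TensorProduct.induction_on (R := ℂ) (M := Laurent N) (N := TPow m N) (motive := fun y =>
      y ∈ R.comap ((TensorProduct.mk ℂ (LT m N) (ParInd m (κ - m) U)).flip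
        (vac m (κ - m) U u))) y (zero_mem _) (fun f t => ?_) (fun _ _ => add_mem)
    refine ⟨(indRel _ _).mkQ (laurentHom κ f ⊗ₜ[ℂ] (t ⊗ₜ[ℂ] u)), ?_⟩
    rw [indToCoinv_laurentHom, anX_fnEmb]
    rfl
  have hq : ∀ ξ ∈ qSub m, ∀ w : AN m N (ParInd m (κ - m) U), ⁅ξ, w⁆ ∈ R := fun ξ hξ w => by
    have h0 : (qImage m (AN m N (ParInd m (κ - m) U))).mkQ ⁅ξ, w⁆ = 0 :=
      (Submodule.Quotient.mk_eq_zero _).2 (Submodule.subset_span ⟨ξ, hξ, w, rfl⟩)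
    rw [hR, Submodule.mem_comap, h0]
    exact zero_mem _
  have htop : ∀ (v : ParInd m (κ - m) U) (y : LT m N), (y ⊗ₜ[ℂ] v) ∈ R := by
    let S : Submodule ℂ (ParInd m (κ - m) U) :=
      ⨅ y : LT m N, R.comap (TensorProduct.mk ℂ (LT m N) (ParInd m (κ - m) U) y)
    have hS : ∀ v, v ∈ S ↔ ∀ y : LT m N, (y ⊗ₜ[ℂ] v) ∈ R := fun v => Submodule.mem_iInf _
    refine fun v => (hS v).1 (parInd_induction_q (fun u => (hS _).2 fun y => hvac y u)
      (fun ξ hξ v hv => (hS _).2 fun y => ?_) v)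
    have h1 := hq ξ hξ (y ⊗ₜ v)
    rw [TensorProduct.LieModule.lie_tmul_right] at h1
    exact (Submodule.add_mem_iff_right R ((hS v).1 hv _)).1 h1
  intro c
  obtain ⟨w, rfl⟩ := Submodule.mkQ_surjective _ c
  change w ∈ R
  induction w using TensorProduct.induction_on with
  | zero => exact zero_mem R
  | add w w' h h' => exact add_mem h h'
  | tmul y v => exact htop v y

/-- The map `f ⊗ t ⊗ u ↦ f ⊗ (t ⊗ u)` to the induced module. -/
def ltToInd : LT m N ⊗[ℂ] U →ₗ[ℂ] Ind (heckeToCherednik N κ) (fn_heckeData hm N U).lift :=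
  (indRel (heckeToCherednik N κ) (fn_heckeData hm N U).lift).mkQ ∘ₗ
    (laurentHom κ).toLinearMap.rTensor (FN m N U) ∘ₗ
      (TensorProduct.assoc ℂ (Laurent N) (TPow m N) U).toLinearMap

/-- The map from the coinvariants to the induced module. -/
def coinvToInd : CoinvInd m N κ U →ₗ[ℂ]
    Ind (heckeToCherednik N κ) (fn_heckeData hm N U).lift :=
  (qImage m (AN m N (ParInd m (κ - m) U))).liftQ (ltToInd hm N κ U ∘ₗ anProj m N (κ - m) U) (by
    refine Submodule.span_le.2 ?_
    rintro _ ⟨ξ, hξ, w, rfl⟩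
    rw [SetLike.mem_coe, LinearMap.mem_ker, LinearMap.comp_apply, anProj_lie _ _ _ hξ, map_zero])

/-- By the spanning of T_N and the relations of the tensor product over H_N, it suffices to take b a
Laurent polynomial. There the image is the class of f ⊗ t ⊗ u, on which the antipode projection is
the identity. This left inverse gives injectivity. -/
theorem coinvToInd_indToCoinv (y : Ind (heckeToCherednik N κ) (fn_heckeData hm N U).lift) :
    coinvToInd hm N κ U (indToCoinv hm N κ U y) = y := by
  have h1 : ∀ (f : Laurent N) (w : FN m N U), coinvToInd hm N κ U (indToCoinv hm N κ U
      ((indRel _ _).mkQ (laurentHom κ f ⊗ₜ[ℂ] w))) =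
        (indRel _ _).mkQ (laurentHom κ f ⊗ₜ[ℂ] w) := fun f w => by
    induction w using TensorProduct.induction_on with
    | zero => rw [TensorProduct.tmul_zero, map_zero, map_zero, map_zero]
    | add w w' h h' =>
      rw [TensorProduct.tmul_add, map_add, map_add, map_add, h, h']
    | tmul t u =>
      rw [indToCoinv_laurentHom, anX_fnEmb]
      exact congrArg (ltToInd hm N κ U) (anProj_vac N (κ - m) U (f ⊗ₜ[ℂ] t : LT m N) u)
  suffices H : coinvToInd hm N κ U ∘ₗ indToCoinv hm N κ U = LinearMap.id from
    LinearMap.congr_fun H y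
  refine Ind.hom_ext fun b w => ?_
  have key : (⊤ : Submodule ℂ (Cherednik N κ)) ≤ LinearMap.eqLocus
      (coinvToInd hm N κ U ∘ₗ indToCoinv hm N κ U ∘ₗ (indRel _ _).mkQ ∘ₗ
        (TensorProduct.mk ℂ (Cherednik N κ) (FN m N U)).flip w)
      ((indRel _ _).mkQ ∘ₗ (TensorProduct.mk ℂ (Cherednik N κ) (FN m N U)).flip w) := by
    rw [← cherednik_span, Submodule.span_le]
    rintro _ ⟨f, h, rfl⟩
    have h2 : (indRel (heckeToCherednik N κ) (fn_heckeData hm N U).lift).mkQ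
        ((laurentHom κ f * heckeToCherednik N κ h) ⊗ₜ[ℂ] w) = (indRel _ _).mkQ
          (laurentHom κ f ⊗ₜ[ℂ] ((fn_heckeData hm N U).lift h w)) :=
      (Submodule.Quotient.eq _).2 (Submodule.subset_span ⟨_, _, _, rfl⟩)
    change coinvToInd hm N κ U (indToCoinv hm N κ U ((indRel _ _).mkQ
      ((laurentHom κ f * heckeToCherednik N κ h) ⊗ₜ[ℂ] w))) = (indRel _ _).mkQ
        ((laurentHom κ f * heckeToCherednik N κ h) ⊗ₜ[ℂ] w)
    rw [h2, h1]
  exact key (Submodule.mem_top (x := b))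

/-- The isomorphism of the induced module with the coinvariants. -/
def indEquivCoinv :
    Ind (heckeToCherednik N κ) (fn_heckeData hm N U).lift ≃ₗ[ℂ] CoinvInd m N κ U :=
  LinearEquiv.ofBijective (indToCoinv hm N κ U)
    ⟨Function.LeftInverse.injective (coinvToInd_indToCoinv hm N κ U),
      indToCoinv_surjective hm N κ U⟩

theorem fnToCoinv_lie (hm : 0 < m) (X : sl m) (w : FN m N U) :
    fnToCoinv m N κ U (LieModule.toEnd ℂ (sl m) (FN m N U) X w) =
      coinvRep m (AN m N (ParInd m (κ - m) U)) X (fnToCoinv m N κ U w) :=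
  congrArg (qImage m (AN m N (ParInd m (κ - m) U))).mkQ (fnEmb_lie N (κ - m) U hm X w)

end Iso

end AST

end

open AST in
theorem theorem1p7 (m N : ℕ) (hm : 0 < m) (hN : 0 < N) (κ : ℂ)
    (U : Type*) [AddCommGroup U] [Module ℂ U] [LieRingModule (sl m) U] [LieModule ℂ (sl m) U] :
    IsSmooth m (ParInd m (κ - m) U) ∧
    ∃ ρF : HeckeAlg N →ₐ[ℂ] Module.End ℂ (FN m N U),
      IsHeckeAction m N U ρF ∧
    ∃ hF : ∀ (X : sl m) (h : HeckeAlg N), Commute (ρF h) (LieModule.toEnd ℂ (sl m) (FN m N U) X),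
    ∃ ρA : Cherednik N κ →ₐ[ℂ] Module.End ℂ (AN m N (ParInd m (κ - m) U)),
      IsCherednikAction m N κ (ParInd m (κ - m) U) ρA ∧
    ∃ ρQ : Cherednik N κ →ₐ[ℂ] Module.End ℂ (Coinv m (AN m N (ParInd m (κ - m) U))),
      (∀ (t : Cherednik N κ) (w : AN m N (ParInd m (κ - m) U)),
        ρQ t ((qImage m (AN m N (ParInd m (κ - m) U))).mkQ w) =
          (qImage m (AN m N (ParInd m (κ - m) U))).mkQ (ρA t w)) ∧
      (∀ (X : sl m) (t : Cherednik N κ),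
        Commute (ρQ t) (coinvRep m (AN m N (ParInd m (κ - m) U)) X)) ∧
    ∃ e : Ind (heckeToCherednik N κ) ρF ≃ₗ[ℂ] Coinv m (AN m N (ParInd m (κ - m) U)),
      (∀ (t : Cherednik N κ) (y : Ind (heckeToCherednik N κ) ρF),
        e (Ind.action (heckeToCherednik N κ) ρF t y) = ρQ t (e y)) ∧
      (∀ (X : sl m) (y : Ind (heckeToCherednik N κ) ρF),
        e (Ind.map (heckeToCherednik N κ) ρF (LieModule.toEnd ℂ (sl m) (FN m N U) X) (hF X) y) =
          coinvRep m (AN m N (ParInd m (κ - m) U)) X (e y)) :=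
  ⟨parInd_isSmooth, (fn_heckeData hm N U).lift, fn_isHeckeAction hm N U, fn_comm hm N U,
    anRep hm parInd_isSmooth κ, anRep_isCherednikAction hm parInd_isSmooth κ,
    coinvIndRep hm N κ U, fun _ _ => rfl,
    coinvCherednik_comm hm parInd_isSmooth central_lie_parInd,
    indEquivCoinv hm N κ U,
    indLift_action _ _ (coinvIndRep_fnToCoinv hm N κ U),
    fun X => indLift_map _ _ (coinvIndRep_fnToCoinv hm N κ U) _ _ _
      (coinvCherednik_comm hm parInd_isSmooth central_lie_parInd X)
      (fnToCoinv_lie N κ U hm X)⟩
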